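/- Let $\mathcal A$ be a compact set of real $2\times2$ matrices which is irreducible (its matrices have no common invariant line) and does not contain the zero matrix. A trajectory of $\mathcal A$ is a solution $x:[0,\infty)\to\mathbb R^2$ of $\dot x(t)=A(t)x(t)$ for almost every $t$ with a measurable switching law $A(t)\in\mathcal A$. The Lyapunov exponent $\sigma(\mathcal A)$ is the infimum of all real numbers $\sigma$ such that every trajectory satisfies $\|x(t)\|\le C_x e^{\sigma t}$, $t\ge 0$. Suppose $\sigma(\mathcal A)=0$. Definitions. A norm $f$ is a Barabanov norm of $\mathcal A$ if $f(x(t))\le f(x(0))$, $t\ge 0$, along every trajectory of $\mathcal A$, and for every $x_0\in\mathbb R^2$ there is a trajectory $\bar x$ of the convex hull $\mathrm{co}(\mathcal A)$ with $\bar x(0)=x_0$ and $f(\bar x(t))=f(x_0)$ for all $t\ge0$. A nonzero matrix $A\in\mathrm{co}(\mathcal A)$ is dominant if the largest real part of its eigenvalues is $0$; the system has real (complex) dominance if some dominant matrix has real (non-real) eigenvalues. A point $x$ is feasible if there are no $A\in\mathcal A$ and $\lambda\ge0$ with $Ax=\lambda x$. At a feasible point $x$, consider the vectors $Ax$, $A\in\mathcal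 A$, whose oriented (counterclockwise) angle with $x$ lies in $(0,\pi)$, if there are any; a matrix $A\in\mathcal A$ whose image $Ax$ has the smallest such angle and, among the images with this angle, the maximal length is a leading left matrix at $x$, and $a_x$ is the ray from $x$ along $Ax$. A leading right matrix and the ray $b_x$ are defined in the same way by the largest angle in $(-\pi,0)$. A leading left (right) trajectory is an absolutely continuous curve that satisfies $\dot x(t)=A(t)x(t)$ for almost every $t$, where $A(\cdot)$ is measurable and, for every $t$, $A(t)$ is a leading left (right) matrix at $x(t)$. For a norm with unit ball $G$ and unit sphere $S$, the ray from $x\in S$ along $v$ is tangent to $S$ if $\mathrm{dist}(x+\lambda v,S)=o(\lambda)$ as $\lambda\to+0$, and is directed inside $S$ if $x+\lambda v\in\mathrm{int}\,G$ for all small $\lambda>0$. Theorem. The system has no real dominance if and only if $\mathrm{co}(\mathcal A)$ contains no degenerate matrix other than, possibly, the zero matrix. If it has no real dominance, then a Barabanov norm exists and is unique up to multiplication by a positive constant, and its unit sphere $S$ is described by one period of a periodic leading trajectory, either left or right: there are such a trajectory $x$ and $T>0$ such that $x$ is $T$-periodic and maps $[0,T)$ bijectively onto $S$. Moreover, if the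 system has no complex dominance either, then its periodic leading trajectory is unique up to normalization: for any two periodic leading trajectories $x,y$ (each left or right) there are $c>0$ and $\tau\in\mathbb R$ such that $y(t)=c\,x(t+\tau)$ for all $t$. If it is a left trajectory, then at every point $x\in S$ the ray $a_x$ exists and is tangent to $S$, and $b_x$ is either directed inside $S$ or does not exist. If it is a right trajectory, then at every point $x\in S$ the ray $b_x$ exists and is tangent to $S$, and $a_x$ is either directed inside $S$ or does not exist. -/

import Mathlib

open Set Filter Topology MeasureTheory Asymptotics

namespace Barabanov

/-- The Euclidean plane. -/
abbrev Plane : Type := EuclideanSpace ℝ (Fin 2)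

/-- Real `2 × 2` matrices. -/
abbrev Mat : Type := Matrix (Fin 2) (Fin 2) ℝ

/-- The vector `A x`. -/
noncomputable def act (A : Mat) (x : Plane) : Plane := Matrix.toEuclideanLin A x

/-- On the interval `I`, the continuous curve `x` is a (Carathéodory) solution of
`x' (t) = A (t) x (t)`, where `A` is Lebesgue measurable on `I`; the equation is written in
integral form. -/
def IsSolutionOn (A : ℝ → Mat) (x : ℝ → Plane) (I : Set ℝ) : Prop :=
  AEStronglyMeasurable A (volume.restrict I) ∧ ContinuousOn x I ∧
    ∀ s ∈ I, ∀ t ∈ I, x t = x s + ∫ τ in s..t, act (A τ) (x τ)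

/-- `x` (on `[0, ∞)`) is a trajectory of the linear switching system with control set `𝒜`. -/
def IsTrajectory (𝒜 : Set Mat) (x : ℝ → Plane) : Prop :=
  ∃ A : ℝ → Mat, (∀ t ∈ Ici (0 : ℝ), A t ∈ 𝒜) ∧ IsSolutionOn A x (Ici 0)

/-- The Lyapunov exponent `σ(𝒜)`. -/
noncomputable def lyapunovExponent (𝒜 : Set Mat) : ℝ :=
  sInf {σ : ℝ | ∀ x : ℝ → Plane, IsTrajectory 𝒜 x →
    ∃ C : ℝ, ∀ t : ℝ, 0 ≤ t → ‖x t‖ ≤ C * Real.exp (σ * t)}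

/-- The matrices of `𝒜` share no nontrivial invariant subspace. -/
def IsIrreducible (𝒜 : Set Mat) : Prop :=
  ∀ V : Submodule ℝ Plane, (∀ A ∈ 𝒜, ∀ v ∈ V, act A v ∈ V) → V = ⊥ ∨ V = ⊤

/-- The norm `f` is a Barabanov (invariant) norm of the system `𝒜`. A norm on the plane is a
seminorm that vanishes only at the origin. -/
def IsBarabanovNorm (𝒜 : Set Mat) (f : Seminorm ℝ Plane) : Prop :=
  (∀ x : Plane, f x = 0 → x = 0) ∧
  (∀ x : ℝ → Plane, IsTrajectory 𝒜 x →
    ∀ t : ℝ, 0 ≤ t → f (x t) ≤ Real.exp (lyapunovExponent 𝒜 * t) * f (x 0)) ∧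
  (∀ x₀ : Plane, ∃ x : ℝ → Plane, IsTrajectory (convexHull ℝ 𝒜) x ∧ x 0 = x₀ ∧
    ∀ t : ℝ, 0 ≤ t → f (x t) = Real.exp (lyapunovExponent 𝒜 * t) * f x₀)

/-- The unit ball of `f`. -/
def unitBall (f : Seminorm ℝ Plane) : Set Plane := {x | f x ≤ 1}

/-- The unit sphere of `f`. -/
def unitSphere (f : Seminorm ℝ Plane) : Set Plane := {x | f x = 1}

/-- The complex eigenvalues of a real matrix. -/
def eigenvalues (A : Mat) : Set ℂ := spectrum ℂ (A.map (algebraMap ℝ ℂ))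

/-- `A ∈ co(𝒜)`, `A ≠ σ I`, and the largest real part of the eigenvalues of `A` is `σ(𝒜)`. -/
def IsDominant (𝒜 : Set Mat) (A : Mat) : Prop :=
  A ∈ convexHull ℝ 𝒜 ∧ A ≠ lyapunovExponent 𝒜 • (1 : Mat) ∧
    IsGreatest (Complex.re '' eigenvalues A) (lyapunovExponent 𝒜)

/-- Real dominance: some dominant matrix has real eigenvalues. -/
def HasRealDominance (𝒜 : Set Mat) : Prop :=
  ∃ A, IsDominant 𝒜 A ∧ ∀ μ ∈ eigenvalues A, μ.im = 0

/-- Complex dominance: some dominant matrix has non-real eigenvalues. -/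
def HasComplexDominance (𝒜 : Set Mat) : Prop :=
  ∃ A, IsDominant 𝒜 A ∧ ¬ ∀ μ ∈ eigenvalues A, μ.im = 0

/-- The oriented angle from `x` to `y`, in `(-π, π]` (counterclockwise is positive): the argument
of `conj x * y` when the plane is identified with `ℂ`. -/
noncomputable def orientedAngle (x y : Plane) : ℝ :=
  Complex.arg ⟨x 0 * y 0 + x 1 * y 1, x 0 * y 1 - x 1 * y 0⟩

/-- `x` is not an eigenvector with a nonnegative eigenvalue of a matrix from `𝒜`
(nor the zero vector, when `𝒜` is nonempty). -/
def IsFeasible (𝒜 : Set Mat) (x : Plane) : Prop :=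
  ¬ ∃ A ∈ 𝒜, ∃ c : ℝ, 0 ≤ c ∧ act A x = c • x

/-- `A` is a leading left matrix of `𝒜` at `x`: among the images `B x`, `B ∈ 𝒜`, whose oriented
angle with `x` lies in `(0, π)`, the vector `A x` has the minimal angle and, among the images with
this angle, the maximal length. -/
def IsLeadingLeft (𝒜 : Set Mat) (x : Plane) (A : Mat) : Prop :=
  IsFeasible 𝒜 x ∧ A ∈ 𝒜 ∧ orientedAngle x (act A x) ∈ Ioo 0 Real.pi ∧
    ∀ B ∈ 𝒜, orientedAngle x (act B x) ∈ Ioo 0 Real.pi →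
      orientedAngle x (act A x) ≤ orientedAngle x (act B x) ∧
      (orientedAngle x (act B x) = orientedAngle x (act A x) → ‖act B x‖ ≤ ‖act A x‖)

/-- `A` is a leading right matrix of `𝒜` at `x`: the same with the maximal angle in `(-π, 0)`. -/
def IsLeadingRight (𝒜 : Set Mat) (x : Plane) (A : Mat) : Prop :=
  IsFeasible 𝒜 x ∧ A ∈ 𝒜 ∧ orientedAngle x (act A x) ∈ Ioo (-Real.pi) 0 ∧
    ∀ B ∈ 𝒜, orientedAngle x (act B x) ∈ Ioo (-Real.pi) 0 →
      orientedAngle x (act B x) ≤ orientedAngle x (act A x) ∧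
      (orientedAngle x (act B x) = orientedAngle x (act A x) → ‖act B x‖ ≤ ‖act A x‖)

/-- `x` is a leading left trajectory of `𝒜` on the interval `I`: a solution of
`x' (t) = A (t) x (t)`, where every `A (t)` is a leading left matrix at the point `x (t)`. -/
def IsLeadingLeftTrajectoryOn (𝒜 : Set Mat) (x : ℝ → Plane) (I : Set ℝ) : Prop :=
  ∃ A : ℝ → Mat, (∀ t ∈ I, IsLeadingLeft 𝒜 (x t) (A t)) ∧ IsSolutionOn A x I

/-- `x` is a leading right trajectory of `𝒜` on the interval `I`. -/
def IsLeadingRightTrajectoryOn (𝒜 : Set Mat) (x : ℝ → Plane) (I : Set ℝ) : Prop :=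
  ∃ A : ℝ → Mat, (∀ t ∈ I, IsLeadingRight 𝒜 (x t) (A t)) ∧ IsSolutionOn A x I

/-- `x` is a leading left trajectory with period `T > 0`. -/
def IsPeriodicLeadingLeft (𝒜 : Set Mat) (x : ℝ → Plane) (T : ℝ) : Prop :=
  0 < T ∧ Function.Periodic x T ∧ IsLeadingLeftTrajectoryOn 𝒜 x univ

/-- `x` is a leading right trajectory with period `T > 0`. -/
def IsPeriodicLeadingRight (𝒜 : Set Mat) (x : ℝ → Plane) (T : ℝ) : Prop :=
  0 < T ∧ Function.Periodic x T ∧ IsLeadingRightTrajectoryOn 𝒜 x univ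

/-- `x` is a leading trajectory, either left or right, with period `T > 0`. -/
def IsPeriodicLeading (𝒜 : Set Mat) (x : ℝ → Plane) (T : ℝ) : Prop :=
  IsPeriodicLeadingLeft 𝒜 x T ∨ IsPeriodicLeadingRight 𝒜 x T

/-- The ray from `x` along `v` is tangent to the curve `S`: the distance from `x + r v` to `S` is
`o(r)` as `r → +0`. -/
def IsTangentTo (S : Set Plane) (x v : Plane) : Prop :=
  (fun r : ℝ => Metric.infDist (x + r • v) S) =o[𝓝[>] 0] (fun r : ℝ => r)

/-- The ray from `x` along `v` is directed inside the body `G`: `x + r v` is an interior point of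
`G` for all small `r > 0`. -/
def IsDirectedInside (G : Set Plane) (x v : Plane) : Prop :=
  ∀ᶠ r : ℝ in 𝓝[>] 0, x + r • v ∈ interior G

end Barabanov

/-! Identify the plane with ℂ and write x = exp ζ. Then x' = Ax becomes ζ' = Ax/x, a velocity that
depends only on the angle θ = Im ζ and has period π in it (`polarVelocity`). A velocity with
positive imaginary part turns left, and its ratio Re/Im is the slope d log r/dθ. The leading left
trajectory follows the maximal slope g(θ), so it closes up exactly when the integral of g over [0,
π] vanishes. The right side is the mirror image.

From σ = 0 and irreducibility comes a norm f that decreases weakly along all trajectories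
(`exists_extremal_norm`). To first order this is a convex condition on the matrix, so it holds on
co(𝒜) and forces det ≥ 0 and tr ≤ 0 there. A nonzero degenerate matrix of co(𝒜) then has the
eigenvalues 0 and tr ≤ 0, hence is dominant; this is the equivalence. Without real dominance no
matrix of 𝒜 has a nonnegative real eigenvalue, so the slope tends to -∞ as a left velocity
approaches the real axis, and the maximal slope is continuous wherever left velocities exist.

The crux is that the left or the right leading slope has integral zero (`exists_closed_leadSlope`).
It is at most 0, since f cannot grow over a half-turn (`IsSide.integral_nonpos`). For the converse,
a traceless matrix in 𝒜 has closed elliptic orbits, whose slope has mean zero and is dominated by g.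
If there is none, co(𝒜) omits 0 and all left slopes lie strictly below all right slopes
(`velocities_gap`). Were both integrals negative, a continuous slope k of mean zero would fit
strictly in between, log r - ∫k would decrease at a uniform rate along every trajectory, and σ would
be negative (`exists_isLeadSlope_of_gap`, `IsSide.exists_slope_le`).

A norm that decreases weakly along a closed contour is constant on it, so the contour is a sphere of
every such norm. This gives existence, uniqueness and the description of the sphere. Without complex
dominance the gap is always strict: the two contours cannot both close, and relative to the tangent
of the closed one every velocity of the other side has an inward radial component. -/

namespace Barabanov

/-! ### Almost-everywhere calculus for locally Lipschitz curves, and logarithms of curves. -/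

section LocallyLipschitzCurves

variable {F : Type*} [NormedAddCommGroup F]

theorem exists_lipschitzOnWith_Icc {f : ℝ → F} (hf : LocallyLipschitz f) (a b : ℝ) :
    ∃ K, LipschitzOnWith K f (Icc a b) :=
  LocallyLipschitzOn.exists_lipschitzOnWith_of_compact isCompact_Icc (hf.locallyLipschitzOn)

theorem _root_.LocallyLipschitz.absolutelyContinuousOnInterval {f : ℝ → F}
    (hf : LocallyLipschitz f) (a b : ℝ) : AbsolutelyContinuousOnInterval f a b := by
  obtain ⟨K, hK⟩ := exists_lipschitzOnWith_Icc hf (min a b) (max a b)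
  exact LipschitzOnWith.absolutelyContinuousOnInterval hK

theorem locallyLipschitz_of_Icc {f : ℝ → F}
    (h : ∀ t, ∃ K, LipschitzOnWith K f (Icc (t - 1) (t + 1))) : LocallyLipschitz f := by
  intro t
  obtain ⟨K, hK⟩ := h t
  exact ⟨K, Icc (t - 1) (t + 1), Icc_mem_nhds (by linarith) (by linarith), hK⟩

theorem eq_of_ae_hasDerivAt_zero [NormedSpace ℝ F] {f : ℝ → F} (hf : LocallyLipschitz f) {a b : ℝ}
    (hab : a ≤ b) (h : ∀ᵐ t, t ∈ Icc a b → HasDerivAt f 0 t) : f b = f a := by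
  obtain ⟨C, hC⟩ := (hf.absolutelyContinuousOnInterval a b).const_of_ae_hasDerivAt_zero
    (by rwa [uIcc_of_le hab])
  rw [hC a (by simp), hC b (by simp)]

theorem ae_differentiableAt_of_locallyLipschitz {f : ℝ → ℝ} (hf : LocallyLipschitz f) :
    ∀ᵐ t, DifferentiableAt ℝ f t := by
  have h : ∀ n : ℕ, ∀ᵐ t, t ∈ uIcc (-(n : ℝ)) n → DifferentiableAt ℝ f t := fun n =>
    (hf.absolutelyContinuousOnInterval _ _).ae_differentiableAt
  filter_upwards [ae_all_iff.2 h] with t ht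
  obtain ⟨n, hn⟩ := exists_nat_ge |t|
  refine ht n ?_
  rw [uIcc_of_le (by have := abs_nonneg t; linarith)]
  exact abs_le.1 hn

theorem le_of_ae_deriv_nonpos {φ : ℝ → ℝ} (hf : LocallyLipschitz φ) {a b : ℝ} (hab : a ≤ b)
    (h : ∀ᵐ t, t ∈ Icc a b → ∀ d, HasDerivAt φ d t → d ≤ 0) : φ b ≤ φ a := by
  have h1 := (hf.absolutelyContinuousOnInterval a b).integral_deriv_eq_sub
  have h2 : ∫ x in a..b, deriv φ x ≤ 0 := by
    rw [intervalIntegral.integral_of_le hab]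
    apply integral_nonpos_of_ae
    rw [EventuallyLE, ae_restrict_iff' measurableSet_Ioc]
    filter_upwards [h, ae_differentiableAt_of_locallyLipschitz hf] with t ht hd hm
    exact ht (Ioc_subset_Icc_self hm) _ hd.hasDerivAt
  linarith

theorem sub_le_of_ae_deriv_le {φ : ℝ → ℝ} (hf : LocallyLipschitz φ) {a b c : ℝ} (hab : a ≤ b)
    (h : ∀ᵐ t, t ∈ Icc a b → ∀ d, HasDerivAt φ d t → d ≤ c) : φ b - φ a ≤ c * (b - a) := by
  have hl : LocallyLipschitz (fun t : ℝ => c * t) :=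
    ContDiff.locallyLipschitz (𝕂 := ℝ) (by fun_prop)
  have h' : LocallyLipschitz (fun t => φ t - c * t) := by
    simpa [sub_eq_add_neg] using hf.add hl.neg
  have := le_of_ae_deriv_nonpos h' hab (by
    filter_upwards [h] with t ht hm d hd
    have h3 : HasDerivAt φ (d + c * 1) t := by
      have := hd.add ((hasDerivAt_id t).const_mul c)
      refine this.congr_of_eventuallyEq (Eventually.of_forall fun s => ?_)
      simp
    have := ht hm _ h3
    linarith)
  linarith

theorem le_sub_of_ae_le_deriv {φ : ℝ → ℝ} (hf : LocallyLipschitz φ) {a b c : ℝ} (hab : a ≤ b)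
    (h : ∀ᵐ t, t ∈ Icc a b → ∀ d, HasDerivAt φ d t → c ≤ d) : c * (b - a) ≤ φ b - φ a := by
  have := sub_le_of_ae_deriv_le (c := -c) hf.neg hab (by
    filter_upwards [h] with t ht hm d hd
    have h3 : HasDerivAt φ (-d) t := by simpa using hd.neg
    have := ht hm _ h3
    linarith)
  simp only [Pi.neg_apply] at this
  linarith

/-- Measurability of `v` is not assumed: `v` is replaced by `deriv y` cut off to `[a, b]`, which is
measurable and bounded by a Lipschitz constant. The primitive of the cut-off differs from `y` by a
Lipschitz function whose derivative vanishes almost everywhere. -/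
theorem integral_eq_sub_of_ae_hasDerivAt [NormedSpace ℝ F] [CompleteSpace F]
    [SecondCountableTopology F] {y v : ℝ → F} (hy : LocallyLipschitz y) {a b : ℝ} (hab : a ≤ b)
    (h : ∀ᵐ t, t ∈ Icc a b → HasDerivAt y (v t) t) : ∫ t in a..b, v t = y b - y a := by
  borelize F
  obtain ⟨K, hK⟩ := exists_lipschitzOnWith_Icc hy (a - 1) (b + 1)
  set w : ℝ → F := (Icc a b).indicator (deriv y) with hw
  have hwm : AEStronglyMeasurable w := (stronglyMeasurable_deriv y).indicator measurableSet_Icc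
    |>.aestronglyMeasurable
  have hwb : ∀ t, ‖w t‖ ≤ K := by
    intro t
    by_cases ht : t ∈ Icc a b
    · rw [hw, indicator_of_mem ht]
      exact norm_deriv_le_of_lipschitzOn
        (Icc_mem_nhds (by linarith [ht.1]) (by linarith [ht.2])) hK
    · rw [hw, indicator_of_notMem ht]; simp
  have hint : ∀ c d, IntervalIntegrable w volume c d := by
    intro c d
    rw [intervalIntegrable_iff]
    exact Measure.integrableOn_of_bounded (M := K) (by simp)
      hwm (Eventually.of_forall hwb)
  have hloc : LocallyIntegrable w := by
    rw [locallyIntegrable_iff]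
    intro k hk
    exact Measure.integrableOn_of_bounded (M := K) hk.measure_ne_top
      hwm (Eventually.of_forall hwb)
  have hL : LipschitzWith K (fun t => ∫ s in a..t, w s) := by
    apply LipschitzWith.of_dist_le_mul
    intro s t
    rw [dist_eq_norm, intervalIntegral.integral_interval_sub_left (hint _ _) (hint _ _),
      Real.dist_eq]
    exact intervalIntegral.norm_integral_le_of_norm_le_const (fun x _ => hwb x)
  have hg : LocallyLipschitz (fun t => y t - ∫ s in a..t, w s) := by
    simpa [sub_eq_add_neg] using hy.add hL.locallyLipschitz.neg
  have := eq_of_ae_hasDerivAt_zero hg hab (by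
    filter_upwards [h, LocallyIntegrable.ae_hasDerivAt_integral hloc] with t ht h2 hm
    have := (ht hm).sub (h2 a)
    rwa [hw, indicator_of_mem hm, (ht hm).deriv, sub_self] at this)
  have h3 : ∫ t in a..b, v t = ∫ t in a..b, w t := by
    apply intervalIntegral.integral_congr_ae
    filter_upwards [h] with t ht hm
    rw [uIoc_of_le hab] at hm
    have hm' := Ioc_subset_Icc_self hm
    rw [hw, indicator_of_mem hm', (ht hm').deriv]
  simp only [intervalIntegral.integral_same, sub_zero] at this
  rw [h3, ← this]
  abel

/-- Lifting through the covering `exp` supplies trajectories with a continuous angle. -/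
theorem exists_exp_lift {z : ℝ → ℂ} (hz : Continuous z) (h0 : ∀ t, z t ≠ 0) :
    ∃ ζ : ℝ → ℂ, Continuous ζ ∧ ∀ t, Complex.exp (ζ t) = z t := by
  let f : C(ℝ, {z : ℂ // z ≠ 0}) := ⟨fun t => ⟨z t, h0 t⟩, by fun_prop⟩
  obtain ⟨g, hg, -⟩ := Complex.isCoveringMap_exp.existsUnique_continuousMap_lifts f
    (a₀ := (0 : ℝ)) (e₀ := Complex.log (z 0)) (by
      apply Subtype.ext
      simp [f, Complex.exp_log (h0 0)])
  refine ⟨g, g.continuous, fun t => ?_⟩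
  have := congrFun hg.2 t
  exact congrArg Subtype.val this

/-- Near `t₀` the lift moves by less than 1 < π, so the principal logarithm recovers the increment.
-/
theorem eventuallyEq_log_of_exp_eq {ζ z : ℝ → ℂ} (hζ : Continuous ζ)
    (h : ∀ t, Complex.exp (ζ t) = z t) (t₀ : ℝ) :
    ζ =ᶠ[𝓝 t₀] fun t => ζ t₀ + Complex.log (z t / z t₀) := by
  have : ∀ᶠ t in 𝓝 t₀, ‖ζ t - ζ t₀‖ < 1 := by
    have h1 : Tendsto (fun t => ‖ζ t - ζ t₀‖) (𝓝 t₀) (𝓝 0) := by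
      have : Continuous fun t => ‖ζ t - ζ t₀‖ := by fun_prop
      simpa using this.tendsto t₀
    exact h1.eventually_lt_const one_pos
  filter_upwards [this] with t ht
  have hi := (Complex.abs_im_le_norm _).trans ht.le
  have hpi := Real.pi_gt_three
  rw [← h t, ← h t₀, ← Complex.exp_sub, Complex.log_exp] <;>
    [ring; linarith [abs_le.1 hi]; linarith [abs_le.1 hi]]

theorem hasDerivAt_of_exp_eq {ζ z : ℝ → ℂ} (hζ : Continuous ζ)
    (h : ∀ t, Complex.exp (ζ t) = z t) {t : ℝ} {z' : ℂ} (hz : HasDerivAt z z' t) :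
    HasDerivAt ζ (z' / z t) t := by
  have h0 : z t ≠ 0 := by rw [← h t]; exact Complex.exp_ne_zero _
  refine HasDerivAt.congr_of_eventuallyEq ?_ (eventuallyEq_log_of_exp_eq hζ h t)
  have h1 := (hz.div_const (z t)).clog_real (by simp [h0])
  simpa [h0] using h1.const_add (ζ t)

theorem locallyLipschitz_of_exp_eq {ζ z : ℝ → ℂ} (hζ : Continuous ζ)
    (h : ∀ t, Complex.exp (ζ t) = z t) (hz : LocallyLipschitz z) : LocallyLipschitz ζ := by
  intro t
  have h0 : z t ≠ 0 := by rw [← h t]; exact Complex.exp_ne_zero _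
  have hc : ContDiffAt ℝ 1 (fun w => ζ t + Complex.log (w / z t)) (z t) := by
    have : ContDiffAt ℝ 1 (fun w : ℂ => w / z t) (z t) := by
      simp only [div_eq_mul_inv]; fun_prop
    have hl : ContDiffAt ℝ 1 Complex.log (z t / z t) :=
      (Complex.contDiffAt_log (by simp [h0])).restrict_scalars ℝ
    exact contDiffAt_const.add (ContDiffAt.comp (g := Complex.log) (z t) hl this)
  obtain ⟨K, s, hs, hK⟩ := hc.exists_lipschitzOnWith
  obtain ⟨K', s', hs', hK'⟩ := hz t
  refine ⟨K * K', _, inter_mem (inter_mem hs' (hz.continuous.continuousAt hs))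
    (eventuallyEq_log_of_exp_eq hζ h t), ?_⟩
  have := (hK.comp (hK'.mono (inter_subset_left (t := z ⁻¹' s)))
    (fun x hx => hx.2)).mono (inter_subset_left (t := {x | ζ x = ζ t + Complex.log (z x / z t)}))
  intro x hx y hy
  have := this hx hy
  have e1 := hx.2
  have e2 := hy.2
  simp only [mem_ofPred_eq] at e1 e2
  rw [e1, e2]
  exact this

end LocallyLipschitzCurves

/-! ### The plane as ℂ, and bounds on the action of matrices. -/

section Complexification

/-- The identification of the plane with `ℂ`. -/
noncomputable def toC : Plane ≃L[ℝ] ℂ :=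
  (Complex.orthonormalBasisOneI.repr.symm).toContinuousLinearEquiv

theorem toC_apply (x : Plane) : toC x = ⟨x 0, x 1⟩ := by
  have : toC x = x 0 • (1 : ℂ) + x 1 • Complex.I := by
    simp [toC, Complex.orthonormalBasisOneI]
  rw [this]
  apply Complex.ext <;> simp

theorem norm_toC (x : Plane) : ‖toC x‖ = ‖x‖ :=
  (Complex.orthonormalBasisOneI.repr.symm).norm_map x

theorem act_apply (A : Mat) (x : Plane) (i : Fin 2) :
    act A x i = A i 0 * x 0 + A i 1 * x 1 := by
  fin_cases i <;> simp [act, Matrix.toLpLin_apply]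

theorem act_add_right (A : Mat) (x y : Plane) : act A (x + y) = act A x + act A y := by
  simp [act]

theorem act_smul_right (A : Mat) (c : ℝ) (x : Plane) : act A (c • x) = c • act A x := by
  simp [act]

theorem act_zero_right (A : Mat) : act A 0 = 0 := by simp [act]

theorem act_add_left (A B : Mat) (x : Plane) : act (A + B) x = act A x + act B x := by
  simp [act]

theorem act_smul_left (A : Mat) (c : ℝ) (x : Plane) : act (c • A) x = c • act A x := by
  simp [act]

theorem continuous_act : Continuous fun p : Mat × Plane => act p.1 p.2 := by
  have h : Continuous fun p : Mat × Plane =>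
      (WithLp.toLp 2 fun i => p.1 i 0 * p.2 0 + p.1 i 1 * p.2 1 : Plane) := by
    refine (PiLp.continuous_toLp 2 _).comp ?_
    refine continuous_pi fun i => ?_
    have h1 : ∀ j : Fin 2, Continuous fun p : Mat × Plane => p.1 i j := fun j =>
      (continuous_apply_apply i j).comp continuous_fst
    have h2 : ∀ j : Fin 2, Continuous fun p : Mat × Plane => p.2 j := fun j =>
      (EuclideanSpace.proj j).continuous.comp continuous_snd
    exact ((h1 0).mul (h2 0)).add ((h1 1).mul (h2 1))
  convert h using 2 with p
  ext i
  exact act_apply _ _ _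

theorem exists_norm_act_le {𝒜 : Set Mat} (h : IsCompact 𝒜) :
    ∃ M : ℝ, 0 < M ∧ ∀ A ∈ 𝒜, ∀ x, ‖act A x‖ ≤ M * ‖x‖ := by
  have hc : Continuous fun A : Mat => ‖act A (EuclideanSpace.single 0 1)‖ +
      ‖act A (EuclideanSpace.single 1 1)‖ :=
    ((continuous_act.comp (by fun_prop : Continuous fun A : Mat =>
      (A, (EuclideanSpace.single 0 1 : Plane)))).norm).add
    ((continuous_act.comp (by fun_prop : Continuous fun A : Mat =>
      (A, (EuclideanSpace.single 1 1 : Plane)))).norm)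
  obtain ⟨C, hC⟩ := h.exists_bound_of_continuousOn hc.continuousOn
  refine ⟨max C 1, by positivity, fun A hA x => ?_⟩
  have hx : x = x 0 • (EuclideanSpace.single 0 1 : Plane) + x 1 • EuclideanSpace.single 1 1 := by
    ext i; fin_cases i <;> simp
  have h0 : ‖x 0‖ ≤ ‖x‖ := PiLp.norm_apply_le x 0
  have h1 : ‖x 1‖ ≤ ‖x‖ := PiLp.norm_apply_le x 1
  have h2 := (le_abs_self _).trans (hC A hA)
  calc ‖act A x‖ = ‖x 0 • act A (EuclideanSpace.single 0 1) +
        x 1 • act A (EuclideanSpace.single 1 1)‖ := by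
        rw [← act_smul_right, ← act_smul_right, ← act_add_right, ← hx]
    _ ≤ ‖x 0‖ * ‖act A (EuclideanSpace.single 0 1)‖ +
        ‖x 1‖ * ‖act A (EuclideanSpace.single 1 1)‖ := by
        refine (norm_add_le _ _).trans ?_
        rw [norm_smul, norm_smul]
    _ ≤ ‖x‖ * ‖act A (EuclideanSpace.single 0 1)‖ +
        ‖x‖ * ‖act A (EuclideanSpace.single 1 1)‖ := by gcongr
    _ = (‖act A (EuclideanSpace.single 0 1)‖ + ‖act A (EuclideanSpace.single 1 1)‖) * ‖x‖ := by
        ring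
    _ ≤ max C 1 * ‖x‖ := by gcongr; exact h2.trans (le_max_left _ _)

end Complexification

/-! ### Carathéodory solutions as locally Lipschitz curves. -/

section Solutions

theorem IsSolutionOn.aestronglyMeasurable_act {A : ℝ → Mat} {x : ℝ → Plane} {I : Set ℝ}
    (h : IsSolutionOn A x I) (hI : MeasurableSet I) :
    AEStronglyMeasurable (fun t => act (A t) (x t)) (volume.restrict I) := by
  obtain ⟨h1, h2, -⟩ := h
  have h3 : AEStronglyMeasurable x (volume.restrict I) := h2.aestronglyMeasurable hI
  exact Continuous.comp_aestronglyMeasurable (g := fun p : Mat × Plane => act p.1 p.2)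
    (f := fun t => (A t, x t)) continuous_act (h1.prodMk h3)

theorem IsSolutionOn.intervalIntegrable {A : ℝ → Mat} {x : ℝ → Plane} {I : Set ℝ}
    (h : IsSolutionOn A x I) (hI : MeasurableSet I) {M : ℝ}
    (hM : ∀ t ∈ I, ∀ y, ‖act (A t) y‖ ≤ M * ‖y‖) {a b : ℝ} (hab : Icc a b ⊆ I) :
    ∃ C : ℝ, (∀ t ∈ Icc a b, ‖act (A t) (x t)‖ ≤ C) ∧
      IntegrableOn (fun t => act (A t) (x t)) (Icc a b) := by
  obtain ⟨R, hR⟩ := isCompact_Icc.exists_bound_of_continuousOn (h.2.1.mono hab)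
  have hb : ∀ t ∈ Icc a b, ‖act (A t) (x t)‖ ≤ |M| * R := fun t ht =>
    (hM t (hab ht) _).trans (by
      have := hR t ht
      have h1 := le_abs_self M
      have := norm_nonneg (x t)
      gcongr)
  refine ⟨|M| * R, hb, ?_⟩
  exact Integrable.of_bound
    ((h.aestronglyMeasurable_act hI).mono_set hab) (|M| * R)
    ((ae_restrict_iff' measurableSet_Icc).2 (Eventually.of_forall hb))

/-- `r` retracts the line onto the time interval `I`. -/
structure IsTimeRetraction (I : Set ℝ) (r : ℝ → ℝ) : Prop where
  measurableSet : MeasurableSet I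
  mono : Monotone r
  lipschitz : LipschitzWith 1 r
  maps : ∀ t, r t ∈ I
  ordConnected : OrdConnected I
  eq : ∀ t ∈ I, r t = t
  ae_mem : ∀ᵐ t, t ∈ I → I ∈ 𝓝 t

theorem isTimeRetraction_univ : IsTimeRetraction univ id where
  measurableSet := .univ
  mono := monotone_id
  lipschitz := LipschitzWith.id
  maps _ := mem_univ _
  ordConnected := ordConnected_univ
  eq _ _ := rfl
  ae_mem := by simp

theorem isTimeRetraction_Ici : IsTimeRetraction (Ici 0) (fun t => max t 0) where
  measurableSet := measurableSet_Ici
  mono := fun a b h => max_le_max_right 0 h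
  lipschitz := LipschitzWith.id.max_const 0
  maps t := le_max_right t 0
  ordConnected := ordConnected_Ici
  eq t ht := max_eq_left ht
  ae_mem := by
    have : ∀ᵐ t : ℝ, t ≠ 0 := by simp [ae_iff, measure_singleton]
    filter_upwards [this] with t ht hm
    exact Ici_mem_nhds (lt_of_le_of_ne hm (Ne.symm ht))

/-- Composition with the retraction extends the curve to the whole line, where the calculus above
applies. The endpoints of `I`, at which the extension may have a corner, form a null set by
`ae_mem`. -/
theorem IsSolutionOn.locallyLipschitz {A : ℝ → Mat} {x : ℝ → Plane} {I : Set ℝ} {r : ℝ → ℝ}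
    (hr : IsTimeRetraction I r) (h : IsSolutionOn A x I) {M : ℝ}
    (hM : ∀ t ∈ I, ∀ y, ‖act (A t) y‖ ≤ M * ‖y‖) :
    LocallyLipschitz (x ∘ r) ∧
      ∀ᵐ t, t ∈ I → HasDerivAt (x ∘ r) (act (A t) (x t)) t := by
  have hlip : ∀ a b, Icc a b ⊆ I → ∃ K, LipschitzOnWith K x (Icc a b) := by
    intro a b hab
    obtain ⟨C, hC, -⟩ := h.intervalIntegrable hr.measurableSet hM hab
    refine ⟨C.toNNReal, LipschitzOnWith.of_dist_le_mul fun s hs t ht => ?_⟩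
    rw [dist_eq_norm, h.2.2 t (hab ht) s (hab hs), add_sub_cancel_left, Real.dist_eq]
    refine intervalIntegral.norm_integral_le_of_norm_le_const fun u hu => ?_
    refine (hC u ?_).trans (Real.le_coe_toNNReal C)
    exact ordConnected_Icc.uIcc_subset ht hs (uIoc_subset_uIcc hu)
  constructor
  · apply locallyLipschitz_of_Icc
    intro t
    obtain ⟨K, hK⟩ := hlip (r (t - 1)) (r (t + 1)) (hr.ordConnected.out (hr.maps _) (hr.maps _))
    refine ⟨K * 1, hK.comp (hr.lipschitz.lipschitzOnWith) fun s hs => ?_⟩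
    exact ⟨hr.mono hs.1, hr.mono hs.2⟩
  · set w : ℝ → Plane := I.indicator fun t => act (A t) (x t) with hw
    have hloc : LocallyIntegrable w := by
      intro t
      refine ⟨Icc (t - 1) (t + 1), Icc_mem_nhds (by linarith) (by linarith), ?_⟩
      obtain ⟨C, hC, hi⟩ := h.intervalIntegrable hr.measurableSet hM
        (hr.ordConnected.out (hr.maps (t - 1)) (hr.maps (t + 1)))
      rw [hw, integrableOn_indicator_iff hr.measurableSet]
      refine hi.mono_set fun s hs => ?_
      rw [← hr.eq s hs.1]
      exact ⟨hr.mono hs.2.1, hr.mono hs.2.2⟩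
    filter_upwards [LocallyIntegrable.ae_hasDerivAt_integral hloc, hr.ae_mem] with t ht hm hI
    have h1 := (ht t).const_add (x t)
    rw [hw, indicator_of_mem hI] at h1
    refine h1.congr_of_eventuallyEq ?_
    filter_upwards [hm hI] with s hs
    rw [Function.comp_apply, hr.eq s hs, h.2.2 t hI s hs]
    congr 1
    refine intervalIntegral.integral_congr fun u hu => ?_
    rw [indicator_of_mem (hr.ordConnected.uIcc_subset hI hs hu)]

theorem isSolutionOn_of_ae_hasDerivAt {A : ℝ → Mat} {x y : ℝ → Plane} {I : Set ℝ}
    (hI : OrdConnected I) (hA : AEStronglyMeasurable A (volume.restrict I))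
    (hy : LocallyLipschitz y) (hxy : ∀ t ∈ I, x t = y t)
    (h : ∀ᵐ t, t ∈ I → HasDerivAt y (act (A t) (x t)) t) : IsSolutionOn A x I := by
  refine ⟨hA, hy.continuous.continuousOn.congr hxy, ?_⟩
  have key : ∀ s ∈ I, ∀ t ∈ I, s ≤ t → ∫ τ in s..t, act (A τ) (x τ) = y t - y s := by
    intro s hs t ht hst
    refine integral_eq_sub_of_ae_hasDerivAt hy hst ?_
    filter_upwards [h] with u hu hm
    exact hu (hI.out hs ht hm)
  intro s hs t ht
  rw [hxy s hs, hxy t ht]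
  rcases le_total s t with hst | hst
  · rw [key s hs t ht hst]; abel
  · rw [intervalIntegral.integral_symm, key t ht s hs hst]; abel

end Solutions

/-! ### The leading slope in logarithmic polar coordinates. -/

section PolarSystems

/-- A family of velocity fields in logarithmic polar coordinates `ζ = log r + i θ`: the point `ζ`
moves with one of the velocities `Ψ a θ`, none of which is a nonnegative real number. -/
structure PolarSystem {X : Type*} [TopologicalSpace X] (Ψ : X → ℝ → ℂ) : Prop where
  continuous : Continuous fun p : X × ℝ => Ψ p.1 p.2
  periodic : ∀ a θ, Ψ a (θ + Real.pi) = Ψ a θ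
  feasible : ∀ a θ, (Ψ a θ).im = 0 → (Ψ a θ).re < 0
  lipschitz : ∃ C, 0 < C ∧ ∀ a θ θ', ‖Ψ a θ - Ψ a θ'‖ ≤ C * |θ - θ'|

/-- The mirror image of a polar system. -/
noncomputable def reflect {X : Type*} (Ψ : X → ℝ → ℂ) (a : X) (θ : ℝ) : ℂ :=
  (starRingEnd ℂ) (Ψ a (-θ))

variable {X : Type*} {Ψ : X → ℝ → ℂ}

@[simp] theorem reflect_re (a : X) (θ : ℝ) : (reflect Ψ a θ).re = (Ψ a (-θ)).re := by
  simp [reflect]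

@[simp] theorem reflect_im (a : X) (θ : ℝ) : (reflect Ψ a θ).im = -(Ψ a (-θ)).im := by
  simp [reflect]

variable [TopologicalSpace X]

theorem PolarSystem.periodic' (h : PolarSystem Ψ) (a : X) : Function.Periodic (Ψ a) Real.pi :=
  h.periodic a

theorem PolarSystem.reflect (h : PolarSystem Ψ) : PolarSystem (reflect Ψ) where
  continuous := Complex.continuous_conj.comp
    (h.continuous.comp (continuous_fst.prodMk continuous_snd.neg))
  periodic a θ := by
    have := h.periodic a (-(θ + Real.pi))
    simp only [Barabanov.reflect]
    rw [← this]; congr 2; ring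
  feasible a θ hi := by
    simp only [reflect_im, neg_eq_zero, reflect_re] at hi ⊢
    exact h.feasible a _ hi
  lipschitz := by
    obtain ⟨C, hC, hl⟩ := h.lipschitz
    refine ⟨C, hC, fun a θ θ' => ?_⟩
    have := hl a (-θ) (-θ')
    simp only [Barabanov.reflect]
    rw [← map_sub, RCLike.norm_conj]
    refine this.trans (le_of_eq ?_)
    rw [← abs_neg]; congr 2; ring

/-- The slope `re / im` of a velocity directed to the left, truncated from below at `-M`. -/
noncomputable def truncSlope (M : ℝ) (z : ℂ) : ℝ :=
  if 0 < z.im then max (-M) (z.re / z.im) else -M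

/-- The hypothesis glues the two branches: at a real `z` the real part is negative, so nearby
velocities with positive imaginary part have slope below `-M`. -/
theorem continuousAt_truncSlope (M : ℝ) {z : ℂ} (hz : z.im = 0 → z.re < 0) :
    ContinuousAt (truncSlope M) z := by
  have hre : Tendsto Complex.re (𝓝 z) (𝓝 z.re) := Complex.continuous_re.tendsto z
  have him : Tendsto Complex.im (𝓝 z) (𝓝 z.im) := Complex.continuous_im.tendsto z
  rcases lt_trichotomy z.im 0 with h | h | h
  · have : truncSlope M =ᶠ[𝓝 z] fun _ => -M := by
      filter_upwards [him.eventually_lt_const h] with w hw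
      simp [truncSlope, hw.le]
    exact continuousAt_const.congr this.symm
  · have h1 := hz h
    have : truncSlope M =ᶠ[𝓝 z] fun _ => -M := by
      have h2 : Tendsto (fun w : ℂ => w.re + M * w.im) (𝓝 z) (𝓝 (z.re + M * z.im)) :=
        hre.add (him.const_mul M)
      rw [h, mul_zero, add_zero] at h2
      filter_upwards [h2.eventually_lt_const h1] with w hw
      unfold truncSlope
      split_ifs with hi
      · refine max_eq_left ?_
        rw [div_le_iff₀ hi]
        linarith
      · rfl
    exact continuousAt_const.congr this.symm
  · have : truncSlope M =ᶠ[𝓝 z] fun w => max (-M) (w.re / w.im) := by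
      filter_upwards [him.eventually_const_lt h] with w hw
      simp [truncSlope, hw]
    exact ContinuousAt.congr (f := fun w : ℂ => max (-M) (w.re / w.im))
      (continuousAt_const.max (ContinuousAt.div hre him h.ne')) this.symm

theorem truncSlope_antitone (z : ℂ) {M N : ℝ} (h : M ≤ N) : truncSlope N z ≤ truncSlope M z := by
  unfold truncSlope; split_ifs
  · exact max_le_max_right _ (by linarith)
  · linarith

/-- The largest truncated slope. -/
noncomputable def maxSlope (Ψ : X → ℝ → ℂ) (M : ℝ) (θ : ℝ) : ℝ :=
  sSup ((fun a => truncSlope M (Ψ a θ)) '' univ)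

theorem PolarSystem.continuous_truncSlope (h : PolarSystem Ψ) (M : ℝ) :
    Continuous fun p : ℝ × X => truncSlope M (Ψ p.2 p.1) := by
  rw [continuous_iff_continuousAt]
  intro p
  exact ContinuousAt.comp (f := fun p : ℝ × X => Ψ p.2 p.1)
    (continuousAt_truncSlope M (h.feasible p.2 p.1))
    (h.continuous.comp continuous_swap).continuousAt

theorem maxSlope_periodic (h : PolarSystem Ψ) (M : ℝ) :
    Function.Periodic (maxSlope Ψ M) Real.pi := by
  intro θ; simp [maxSlope, h.periodic]

variable [CompactSpace X]

theorem continuous_maxSlope (h : PolarSystem Ψ) (M : ℝ) : Continuous (maxSlope Ψ M) :=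
  isCompact_univ.continuous_sSup (h.continuous_truncSlope M)

theorem exists_forall_bound {G : Type*} [NormedAddCommGroup G] {f : X → ℝ → G}
    (hc : Continuous fun p : X × ℝ => f p.1 p.2) (hp : ∀ a, Function.Periodic (f a) Real.pi) :
    ∃ B, 0 < B ∧ ∀ a θ, ‖f a θ‖ ≤ B := by
  obtain ⟨B, hB⟩ := (isCompact_univ.prod (isCompact_Icc (a := (0 : ℝ)) (b := Real.pi))
    ).exists_bound_of_continuousOn (f := fun p : X × ℝ => f p.1 p.2) hc.continuousOn
  refine ⟨max B 1, by positivity, fun a θ => ?_⟩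
  obtain ⟨t, ht, he⟩ := (hp a).exists_mem_Ico₀ Real.pi_pos θ
  rw [he]
  exact (hB (a, t) ⟨mem_univ _, Ico_subset_Icc_self ht⟩).trans (le_max_left _ _)

theorem exists_forall_pos_le {f : X → ℝ → ℝ}
    (hc : Continuous fun p : X × ℝ => f p.1 p.2) (hp : ∀ a, Function.Periodic (f a) Real.pi)
    (h0 : ∀ a θ, 0 < f a θ) : ∃ m, 0 < m ∧ ∀ a θ, m ≤ f a θ := by
  obtain ⟨B, hB, h⟩ := exists_forall_bound (f := fun a θ => (f a θ)⁻¹)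
    (hc.inv₀ fun p => (h0 p.1 p.2).ne') (fun a θ => by simp [hp a θ])
  refine ⟨B⁻¹, by positivity, fun a θ => ?_⟩
  have h1 := (le_abs_self _).trans (h a θ)
  have := h0 a θ
  exact (inv_le_comm₀ this hB).1 h1

theorem truncSlope_le_maxSlope (h : PolarSystem Ψ) (M : ℝ) (a : X) (θ : ℝ) :
    truncSlope M (Ψ a θ) ≤ maxSlope Ψ M θ := by
  refine le_csSup ?_ ⟨a, mem_univ _, rfl⟩
  exact (isCompact_univ.image ((h.continuous_truncSlope M).comp
    (continuous_const.prodMk continuous_id) : Continuous fun a => truncSlope M (Ψ a θ))).bddAbove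

theorem re_le_maxSlope_mul (h : PolarSystem Ψ) (M : ℝ) {a : X} {θ : ℝ} (hi : 0 < (Ψ a θ).im) :
    (Ψ a θ).re ≤ maxSlope Ψ M θ * (Ψ a θ).im := by
  rw [← div_le_iff₀ hi]
  refine le_trans ?_ (truncSlope_le_maxSlope h M a θ)
  simp [truncSlope, hi]

/-- `g` is the slope `d log r / dθ` of the leading left trajectories. -/
structure IsLeadSlope (Ψ : X → ℝ → ℂ) (g : ℝ → ℝ) : Prop where
  continuous : Continuous g
  periodic : Function.Periodic g Real.pi
  upper : ∀ a θ, 0 < (Ψ a θ).im → (Ψ a θ).re ≤ g θ * (Ψ a θ).im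
  attained : ∀ θ, ∃ a, 0 < (Ψ a θ).im ∧ (Ψ a θ).re = g θ * (Ψ a θ).im

variable [Nonempty X]

theorem exists_maxSlope_eq (h : PolarSystem Ψ) (M θ : ℝ) :
    ∃ a, maxSlope Ψ M θ = truncSlope M (Ψ a θ) := by
  obtain ⟨a, -, ha⟩ := isCompact_univ.exists_sSup_image_eq (s := (univ : Set X)) univ_nonempty
    (f := fun a => truncSlope M (Ψ a θ)) ((h.continuous_truncSlope M).comp
      (continuous_const.prodMk continuous_id) :
        Continuous fun a => truncSlope M (Ψ a θ)).continuousOn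
  exact ⟨a, ha⟩

theorem maxSlope_antitone (h : PolarSystem Ψ) {M N : ℝ} (hMN : M ≤ N) (θ : ℝ) :
    maxSlope Ψ N θ ≤ maxSlope Ψ M θ := by
  obtain ⟨a, ha⟩ := exists_maxSlope_eq h N θ
  rw [ha]
  exact (truncSlope_antitone _ hMN).trans (truncSlope_le_maxSlope h M a θ)

theorem exists_maxSlope_le (h : PolarSystem Ψ) :
    ∃ B, 0 < B ∧ ∀ M, 0 ≤ M → ∀ θ, maxSlope Ψ M θ ≤ B := by
  obtain ⟨B, hB, hb⟩ := exists_forall_bound (X := X) (f := fun _ θ => maxSlope Ψ 0 θ)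
    ((continuous_maxSlope h 0).comp continuous_snd) (fun _ => maxSlope_periodic h 0)
  refine ⟨B, hB, fun M hM θ => ?_⟩
  exact (maxSlope_antitone h hM θ).trans ((le_abs_self _).trans (hb (Classical.arbitrary X) θ))

/-- For large `M` the truncation is inactive at the maximum: by compactness the largest imaginary
part at each angle is at least some m > 0, and velocities are bounded by some R, so the maximal
slope is at least -R/m. -/
theorem exists_isLeadSlope (h : PolarSystem Ψ) (hw : ∀ θ, ∃ a, 0 < (Ψ a θ).im) :
    ∃ M₀, ∀ M, M₀ ≤ M → IsLeadSlope Ψ (maxSlope Ψ M) := by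
  have hcim : Continuous fun p : ℝ × X => (Ψ p.2 p.1).im :=
    Complex.continuous_im.comp (h.continuous.comp continuous_swap)
  have hwc : Continuous fun θ => sSup ((fun a => (Ψ a θ).im) '' univ) :=
    isCompact_univ.continuous_sSup (f := fun θ a => (Ψ a θ).im) hcim
  have hmax : ∀ θ, ∃ a, sSup ((fun a => (Ψ a θ).im) '' univ) = (Ψ a θ).im := by
    intro θ
    obtain ⟨a, -, ha⟩ := isCompact_univ.exists_sSup_image_eq (s := (univ : Set X)) univ_nonempty
      (f := fun a => (Ψ a θ).im) (hcim.comp (continuous_const.prodMk continuous_id) :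
        Continuous fun a => (Ψ a θ).im).continuousOn
    exact ⟨a, ha⟩
  obtain ⟨m, hm, hmle⟩ := exists_forall_pos_le (X := X)
    (f := fun _ θ => sSup ((fun a => (Ψ a θ).im) '' univ))
    (hwc.comp continuous_snd) (fun _ θ => by simp [h.periodic]) (by
      intro _ θ
      obtain ⟨a, ha⟩ := hw θ
      refine ha.trans_le (le_csSup ?_ ⟨a, mem_univ _, rfl⟩)
      exact (isCompact_univ.image (hcim.comp (continuous_const.prodMk continuous_id) :
        Continuous fun a => (Ψ a θ).im)).bddAbove)
  obtain ⟨R, hR, hb⟩ := exists_forall_bound h.continuous h.periodic'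
  refine ⟨R / m + 1, fun M hM => ⟨continuous_maxSlope h M, maxSlope_periodic h M,
    fun a θ hi => re_le_maxSlope_mul h M hi, fun θ => ?_⟩⟩
  obtain ⟨b, hb'⟩ := hmax θ
  have hbm : m ≤ (Ψ b θ).im := hb' ▸ hmle (Classical.arbitrary X) θ
  obtain ⟨a, ha⟩ := exists_maxSlope_eq h M θ
  have hlt : -M < maxSlope Ψ M θ := by
    refine lt_of_lt_of_le ?_ ((le_max_right _ _).trans (le_of_eq (if_pos (hm.trans_le hbm)).symm)
      |>.trans (truncSlope_le_maxSlope h M b θ))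
    have h1 : -R ≤ (Ψ b θ).re := by
      have := (Complex.abs_re_le_norm _).trans (hb b θ)
      exact (abs_le.1 this).1
    have h2 : -(R / m) ≤ (Ψ b θ).re / (Ψ b θ).im := by
      rw [le_div_iff₀ (hm.trans_le hbm)]
      have : R / m * m ≤ R / m * (Ψ b θ).im := by gcongr
      rw [div_mul_cancel₀ _ hm.ne'] at this
      linarith
    linarith
  have hi : 0 < (Ψ a θ).im := by
    by_contra hn
    rw [ha, truncSlope, if_neg hn] at hlt
    exact lt_irrefl _ hlt
  refine ⟨a, hi, ?_⟩
  rw [ha, truncSlope, if_pos hi] at hlt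
  rw [ha, truncSlope, if_pos hi, max_eq_right (le_of_lt ((lt_max_iff.1 hlt).resolve_left
    (lt_irrefl _))), div_mul_cancel₀ _ hi.ne']

/-- If no velocity turns left at `θ₀`, then at angle `θ₀ + s` the imaginary parts are O(s), while
the real parts of the left velocities stay away from 0. The slopes are then at most -c/s, which is
not integrable, so the integrals of the truncated slopes tend to -∞ with `M`. -/
theorem exists_im_pos_of_integral_nonneg (h : PolarSystem Ψ) {M₀ : ℝ}
    (hI : ∀ M, M₀ ≤ M → 0 ≤ ∫ θ in 0..Real.pi, maxSlope Ψ M θ) (θ₀ : ℝ) :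
    ∃ a, 0 < (Ψ a θ₀).im := by
  by_contra! hno
  obtain ⟨B, hB, hBle⟩ := exists_maxSlope_le h
  obtain ⟨C, hC, hl⟩ := h.lipschitz
  have hcre : Continuous fun p : X × ℝ => (Ψ p.1 p.2).re :=
    Complex.continuous_re.comp h.continuous
  have hcim : Continuous fun p : X × ℝ => (Ψ p.1 p.2).im :=
    Complex.continuous_im.comp h.continuous
  obtain ⟨m, hm, hmle⟩ := exists_forall_pos_le
    (f := fun a θ => max (-(Ψ a θ).re) |(Ψ a θ).im|) (hcre.neg.max hcim.abs)
    (fun a θ => by simp [h.periodic]) (by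
      intro a θ
      by_cases hi : (Ψ a θ).im = 0
      · exact lt_max_of_lt_left (by linarith [h.feasible a θ hi])
      · exact lt_max_of_lt_right (abs_pos.2 hi))
  -- For s < c a left velocity has im ≤ C s < m, hence re ≤ -m and slope ≤ -c/s. The shift `c / M`
  -- in `key` makes the bound finite at s = 0 and keeps it above the truncation level: -c/(s + c/M)
  -- ≥ -M.
  set c := m / C with hc
  have hc0 : 0 < c := by positivity
  have key : ∀ M, 0 < M → ∀ s ∈ Icc (0 : ℝ) Real.pi,
      maxSlope Ψ M (s + θ₀) ≤ B + 2 - c * (s + c / M)⁻¹ := by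
    intro M hM s hs
    have hs0 := hs.1
    have he : 0 < c / M := by positivity
    -- Beyond `c / 2` the singular term is at most 2, which the constant `B + 2` absorbs.
    rcases lt_or_ge s (c / 2) with hsc | hsc
    · have : maxSlope Ψ M (s + θ₀) ≤ -(c * (s + c / M)⁻¹) := by
        obtain ⟨a, ha⟩ := exists_maxSlope_eq h M (s + θ₀)
        have hM' : -M ≤ -(c * (s + c / M)⁻¹) := by
          rw [neg_le_neg_iff, ← div_eq_mul_inv, div_le_iff₀ (by positivity), mul_add,
            mul_div_cancel₀ _ hM.ne']
          nlinarith
        rw [ha, truncSlope]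
        split_ifs with hi
        · refine max_le hM' ?_
          have him : (Ψ a (s + θ₀)).im ≤ C * s := by
            have h1 := (Complex.abs_im_le_norm _).trans (hl a (s + θ₀) θ₀)
            rw [add_sub_cancel_right, abs_of_nonneg hs0, Complex.sub_im] at h1
            linarith [(abs_le.1 h1).2, hno a]
          have hs1 : 0 < s := by
            by_contra hn
            have : s = 0 := le_antisymm (not_lt.1 hn) hs0
            rw [this, mul_zero] at him
            rw [this] at hi
            linarith
          have hCs : C * s < m := by
            have : C * s < C * c := by gcongr; linarith
            rwa [hc, mul_div_cancel₀ _ hC.ne'] at this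
          have hre : (Ψ a (s + θ₀)).re ≤ -m := by
            rcases le_max_iff.1 (hmle a (s + θ₀)) with h1 | h1
            · linarith
            · rw [abs_of_pos hi] at h1; linarith
          rw [div_le_iff₀ hi]
          have h3 : c * (s + c / M)⁻¹ * (Ψ a (s + θ₀)).im ≤ m := by
            calc c * (s + c / M)⁻¹ * (Ψ a (s + θ₀)).im ≤ c * s⁻¹ * (C * s) := by
                  gcongr; linarith
              _ = m := by rw [hc]; field_simp
          linarith
        · exact hM'
      linarith
    · have h1 : c * (s + c / M)⁻¹ ≤ 2 := by
        rw [← div_eq_mul_inv, div_le_iff₀ (by positivity)]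
        linarith
      linarith [hBle M hM.le (s + θ₀)]
  -- This makes the logarithm produced by the singular term at least (B + 2)π/c + 1, so that the
  -- integral is at most -c.
  set M := max M₀ (c / Real.pi * Real.exp ((B + 2) * Real.pi / c + 1)) with hMdef
  have hpi := Real.pi_pos
  have hM : 0 < M := lt_of_lt_of_le (by positivity) (le_max_right _ _)
  have h0 := hI M (le_max_left _ _)
  have hper : ∫ θ in 0..Real.pi, maxSlope Ψ M θ = ∫ s in 0..Real.pi, maxSlope Ψ M (s + θ₀) := by
    rw [intervalIntegral.integral_comp_add_right, zero_add]
    have := (maxSlope_periodic h M).intervalIntegral_add_eq 0 θ₀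
    rw [zero_add] at this
    rw [this, add_comm]
  have he : 0 < c / M := by positivity
  have hint : IntervalIntegrable (fun s => B + 2 - c * (s + c / M)⁻¹) volume 0 Real.pi := by
    apply ContinuousOn.intervalIntegrable
    rw [uIcc_of_le hpi.le]
    refine continuousOn_const.sub (continuousOn_const.mul
      (ContinuousOn.inv₀ (by fun_prop) fun s hs => ?_))
    have := hs.1
    positivity
  have hle : ∫ s in 0..Real.pi, maxSlope Ψ M (s + θ₀) ≤
      ∫ s in 0..Real.pi, (B + 2 - c * (s + c / M)⁻¹) :=
    intervalIntegral.integral_mono_on hpi.le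
      (((continuous_maxSlope h M).comp (by fun_prop)).intervalIntegrable _ _) hint (key M hM)
  have hval : ∫ s in 0..Real.pi, (B + 2 - c * (s + c / M)⁻¹) =
      (B + 2) * Real.pi - c * Real.log ((Real.pi + c / M) / (c / M)) := by
    rw [intervalIntegral.integral_sub, intervalIntegral.integral_const,
      intervalIntegral.integral_const_mul, intervalIntegral.integral_comp_add_right (fun s => s⁻¹),
      integral_inv_of_pos (by simpa using he) (by positivity)]
    · simp; ring
    · simp
    · have := (intervalIntegrable_const (μ := volume) (a := 0) (b := Real.pi) (c := B + 2)).sub hint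
      refine this.congr ?_
      intro s _
      simp
  have hlog : (B + 2) * Real.pi / c + 1 ≤ Real.log ((Real.pi + c / M) / (c / M)) := by
    rw [Real.le_log_iff_exp_le (by positivity), le_div_iff₀ he, mul_comm]
    have : c / Real.pi * Real.exp ((B + 2) * Real.pi / c + 1) ≤ M := le_max_right _ _
    have h5 : c / M * Real.exp ((B + 2) * Real.pi / c + 1) ≤ Real.pi := by
      rw [div_mul_eq_mul_div, div_le_iff₀ hM]
      calc c * Real.exp ((B + 2) * Real.pi / c + 1)
          = Real.pi * (c / Real.pi * Real.exp ((B + 2) * Real.pi / c + 1)) := by field_simp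
        _ ≤ Real.pi * M := by gcongr
    linarith
  have : c * ((B + 2) * Real.pi / c + 1) ≤ c * Real.log ((Real.pi + c / M) / (c / M)) := by
    gcongr
  rw [mul_add, mul_div_cancel₀ _ hc0.ne'] at this
  linarith [hper ▸ h0]

/-- If both integrals were negative, a slope `k` of mean zero lying strictly between the left and
the right slopes would violate `hno`. Truncated slopes are used because it is not yet known that one
of the two sides has velocities at every angle. -/
theorem exists_isLeadSlope_of_gap (h : PolarSystem Ψ)
    (hgap : ∀ a b θ, 0 < (Ψ a θ).im → (Ψ b θ).im < 0 →
      (Ψ b θ).re * (Ψ a θ).im < (Ψ a θ).re * (Ψ b θ).im)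
    (hno : ∀ k : ℝ → ℝ, Continuous k → Function.Periodic k Real.pi →
      ∫ θ in 0..Real.pi, k θ = 0 → ∃ a θ, k θ * (Ψ a θ).im ≤ (Ψ a θ).re) :
    (∃ g, IsLeadSlope Ψ g ∧ 0 ≤ ∫ θ in 0..Real.pi, g θ) ∨
    (∃ g, IsLeadSlope (reflect Ψ) g ∧ 0 ≤ ∫ θ in 0..Real.pi, g θ) := by
  have hr := h.reflect
  obtain ⟨B, hB, hBle⟩ := exists_maxSlope_le h
  obtain ⟨B', hB', hBle'⟩ := exists_maxSlope_le hr
  -- A truncated term equals `-M` and outweighs the other one, which is at most `B` or `B'`; if both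
  -- slopes are genuine, the gap applies.
  have hsum : ∀ M, max B B' < M → ∀ θ, maxSlope Ψ M θ + maxSlope (reflect Ψ) M (-θ) < 0 := by
    intro M hM θ
    have hMB := (le_max_left _ _).trans_lt hM
    have hMB' := (le_max_right _ _).trans_lt hM
    have hM0 : 0 < M := hB.trans hMB
    obtain ⟨a, ha⟩ := exists_maxSlope_eq h M θ
    obtain ⟨b, hb⟩ := exists_maxSlope_eq hr M (-θ)
    have h1 := hBle M hM0.le θ
    have h2 := hBle' M hM0.le (-θ)
    by_cases hia : 0 < (Ψ a θ).im
    · by_cases hib : (Ψ b θ).im < 0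
      · have hib' : 0 < (reflect Ψ b (-θ)).im := by simpa using hib
        rw [ha, truncSlope, if_pos hia] at h1
        rw [hb, truncSlope, if_pos hib'] at h2
        rw [ha, hb, truncSlope, truncSlope, if_pos hia, if_pos hib']
        have := hgap a b θ hia hib
        have h3 : (Ψ a θ).re / (Ψ a θ).im + (reflect Ψ b (-θ)).re / (reflect Ψ b (-θ)).im < 0 := by
          simp only [reflect_re, reflect_im, neg_neg]
          rw [div_neg, ← sub_eq_add_neg, sub_neg, div_lt_iff₀ hia, div_mul_eq_mul_div,
            lt_div_iff_of_neg hib]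
          exact this
        have h4 := (le_max_right _ _).trans h1
        have h5 := (le_max_right _ _).trans h2
        rcases max_choice (-M) ((Ψ a θ).re / (Ψ a θ).im) with e | e <;>
        rcases max_choice (-M) ((reflect Ψ b (-θ)).re / (reflect Ψ b (-θ)).im) with e' | e' <;>
        rw [e, e'] <;> linarith
      · have hib' : ¬ 0 < (reflect Ψ b (-θ)).im := by simpa using hib
        rw [hb, truncSlope, if_neg hib']; linarith
    · rw [ha, truncSlope, if_neg hia]; linarith
  have hpi := Real.pi_pos
  have hci := fun M => (continuous_maxSlope h M).intervalIntegrable (μ := volume) 0 Real.pi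
  have hci' := fun M => (continuous_maxSlope hr M).intervalIntegrable (μ := volume) 0 Real.pi
  have hor : ∀ M, max B B' < M → 0 ≤ ∫ θ in 0..Real.pi, maxSlope Ψ M θ ∨
      0 ≤ ∫ θ in 0..Real.pi, maxSlope (reflect Ψ) M θ := by
    intro M hM
    by_contra! hneg
    set I := ∫ θ in 0..Real.pi, maxSlope Ψ M θ
    set J := ∫ θ in 0..Real.pi, maxSlope (reflect Ψ) M θ with hJ
    have hJ' : ∫ θ in 0..Real.pi, maxSlope (reflect Ψ) M (-θ) = J := by
      rw [intervalIntegral.integral_comp_neg, neg_zero]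
      have := (maxSlope_periodic hr M).intervalIntegral_add_eq 0 (-Real.pi)
      rw [neg_add_cancel, zero_add] at this
      rw [hJ, this]
    have hIJ : I + J < 0 := by linarith
    -- The weight for which k = (1 - s) g - s g', with g' the reflected slope at -θ, has mean (1 -
    -- s) I - s J = 0. Both 0 < s and s < 1 are needed for `k` to lie strictly between the slopes.
    set s := I / (I + J) with hs
    have hs0 : 0 < s := div_pos_of_neg_of_neg hneg.1 hIJ
    have hs1 : s < 1 := by rw [hs, div_lt_one_of_neg hIJ]; linarith
    have hcr : Continuous fun θ => maxSlope (reflect Ψ) M (-θ) :=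
      (continuous_maxSlope hr M).comp continuous_neg
    obtain ⟨a, θ, hle⟩ := hno
      (fun θ => (1 - s) * maxSlope Ψ M θ - s * maxSlope (reflect Ψ) M (-θ))
      ((continuous_const.mul (continuous_maxSlope h M)).sub (continuous_const.mul hcr))
      (by
        intro θ
        have h1 := maxSlope_periodic h M θ
        have h2 := (maxSlope_periodic hr M).sub_eq (-θ)
        simp only
        rw [h1, show -(θ + Real.pi) = -θ - Real.pi by ring, h2])
      (by
        rw [intervalIntegral.integral_sub, intervalIntegral.integral_const_mul,
          intervalIntegral.integral_const_mul, hJ']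
        · change (1 - s) * I - s * J = 0
          have hsI : s * (I + J) = I := div_mul_cancel₀ _ hIJ.ne
          linarith
        · exact (hci M).const_mul _
        · exact (hcr.intervalIntegrable _ _).const_mul _)
    have hlt := hsum M hM θ
    rcases lt_trichotomy (Ψ a θ).im 0 with hi | hi | hi
    · have h1 := re_le_maxSlope_mul hr M (a := a) (θ := -θ) (by simpa using hi)
      simp only [reflect_re, reflect_im, neg_neg] at h1
      have h2 := mul_pos (mul_pos (sub_pos.2 hs1) (neg_pos.2 hlt)) (neg_pos.2 hi)
      linarith
    · rw [hi, mul_zero] at hle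
      linarith [h.feasible a θ hi]
    · have h1 := re_le_maxSlope_mul h M hi
      have h2 := mul_pos (mul_pos hs0 (neg_pos.2 hlt)) hi
      linarith
  -- One side must work for all `M` at once. Truncated slopes decrease as `M` grows, so failures of
  -- the two sides at `M` and `N` would both persist at `max M N`.
  have hall : (∀ M, max B B' < M → 0 ≤ ∫ θ in 0..Real.pi, maxSlope Ψ M θ) ∨
      (∀ M, max B B' < M → 0 ≤ ∫ θ in 0..Real.pi, maxSlope (reflect Ψ) M θ) := by
    by_contra! hneg
    obtain ⟨⟨M, hM, h1⟩, ⟨N, hN, h2⟩⟩ := hneg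
    rcases hor (max M N) (lt_max_of_lt_left hM) with h3 | h3
    · exact absurd (h3.trans (intervalIntegral.integral_mono_on hpi.le (hci _) (hci _)
        fun θ _ => maxSlope_antitone h (le_max_left M N) θ)) (not_le.2 h1)
    · exact absurd (h3.trans (intervalIntegral.integral_mono_on hpi.le (hci' _) (hci' _)
        fun θ _ => maxSlope_antitone hr (le_max_right M N) θ)) (not_le.2 h2)
  rcases hall with hall | hall
  · left
    obtain ⟨M₀, hM₀⟩ := exists_isLeadSlope h
      (exists_im_pos_of_integral_nonneg h (M₀ := max B B' + 1) fun M hM => hall M (by linarith))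
    exact ⟨_, hM₀ (max M₀ (max B B' + 1)) (le_max_left _ _),
      hall _ ((lt_add_one _).trans_le (le_max_right _ _))⟩
  · right
    obtain ⟨M₀, hM₀⟩ := exists_isLeadSlope hr
      (exists_im_pos_of_integral_nonneg hr (M₀ := max B B' + 1) fun M hM => hall M (by linarith))
    exact ⟨_, hM₀ (max M₀ (max B B' + 1)) (le_max_left _ _),
      hall _ ((lt_add_one _).trans_le (le_max_right _ _))⟩

end PolarSystems

/-! ### Measurable selection by maximization over a compact set. -/

section Selection

variable {X : Type*} [TopologicalSpace X] [CompactSpace X]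

/-- A superlevel set of the maximum is the preimage under `p` of the projection of a closed set
along the compact factor `X`, and such a projection is closed. -/
theorem exists_measurable_isGreatest {P : Type*} [TopologicalSpace P] [MeasurableSpace P]
    [BorelSpace P] {p : ℝ → P} (hp : Measurable p) {C : Set (P × X)} (hC : IsClosed C)
    (hne : ∀ t, ∃ a, (p t, a) ∈ C) {u : P × X → ℝ} (hu : Continuous u) :
    ∃ m : ℝ → ℝ, Measurable m ∧ ∀ t, IsGreatest {r | ∃ a, (p t, a) ∈ C ∧ u (p t, a) = r} (m t) := by
  have hex : ∀ t, ∃ r, IsGreatest {r | ∃ a, (p t, a) ∈ C ∧ u (p t, a) = r} r := by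
    intro t
    have hc : IsCompact ((fun a => u (p t, a)) '' {a | (p t, a) ∈ C}) :=
      ((hC.preimage (by fun_prop : Continuous fun a : X => (p t, a))).isCompact).image (by fun_prop)
    obtain ⟨a, ha⟩ := hne t
    exact hc.exists_isGreatest ⟨_, a, ha, rfl⟩
  choose m hm using hex
  refine ⟨m, measurable_of_Ici fun c => ?_, hm⟩
  have : m ⁻¹' Ici c = p ⁻¹' (Prod.fst '' (C ∩ {q | c ≤ u q})) := by
    ext t
    constructor
    · intro ht
      obtain ⟨a, ha, he⟩ := (hm t).1
      exact ⟨(p t, a), ⟨ha, by simpa [he] using ht⟩, rfl⟩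
    · rintro ⟨⟨q, a⟩, ⟨h1, h2⟩, rfl⟩
      exact le_trans h2 ((hm t).2 ⟨a, h1, rfl⟩)
  rw [this]
  exact hp (isClosedMap_fst_of_compactSpace _
    (hC.inter (isClosed_le continuous_const hu))).measurableSet

/-- Lexicographic maximization: each `u` is pinned to its maximal value, recorded as an extra
parameter in `P × ℝ`, before the next one is treated. The remaining freedom is settled by arbitrary
choice, because only the functions `u ∘ s` have to be measurable. -/
theorem exists_measurable_selection (us : List (X → ℝ)) : (∀ u ∈ us, Continuous u) →
    ∀ {P : Type} [TopologicalSpace P] [MeasurableSpace P] [BorelSpace P]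
    [SecondCountableTopology P] {p : ℝ → P}, Measurable p → ∀ {C : Set (P × X)}, IsClosed C →
    (∀ t, ∃ a, (p t, a) ∈ C) →
    ∃ s : ℝ → X, (∀ t, (p t, s t) ∈ C) ∧ ∀ u ∈ us, Measurable (u ∘ s) := by
  induction us with
  | nil =>
    intro _ P _ _ _ _ p _ C _ hne
    choose s hs using hne
    exact ⟨s, hs, by simp⟩
  | cons u us ih =>
    intro hu P _ _ _ _ p hp C hC hne
    have huc : Continuous u := hu u (by simp)
    obtain ⟨m, hm, hmg⟩ := exists_measurable_isGreatest hp hC hne (u := fun q => u q.2)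
      (huc.comp continuous_snd)
    obtain ⟨s, hs, hsu⟩ := ih (fun v hv => hu v (by simp [hv])) (p := fun t => (p t, m t))
      (hp.prodMk hm) (C := {q : (P × ℝ) × X | (q.1.1, q.2) ∈ C ∧ u q.2 = q.1.2})
      ((hC.preimage (by fun_prop : Continuous fun q : (P × ℝ) × X => (q.1.1, q.2))).inter
        (isClosed_eq (huc.comp continuous_snd) (by fun_prop)))
      (fun t => by
        obtain ⟨a, ha, he⟩ := (hmg t).1
        exact ⟨a, ha, he⟩)
    refine ⟨s, fun t => (hs t).1, fun v hv => ?_⟩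
    rcases List.mem_cons.1 hv with rfl | hv
    · have : v ∘ s = m := funext fun t => (hs t).2
      rwa [this]
    · exact hsu v hv

end Selection

/-! ### The leading curve: contour, time parametrization, uniqueness and period. -/

section LeadingCurves

variable {X : Type*} {Ψ : X → ℝ → ℂ} {g : ℝ → ℝ}

/-- The velocity `Ψ a θ` has the maximal slope among the velocities directed to the left, and the
maximal length among the velocities of this slope. -/
def IsLead (Ψ : X → ℝ → ℂ) (θ : ℝ) (a : X) : Prop :=
  0 < (Ψ a θ).im ∧ ∀ b, 0 < (Ψ b θ).im →
    (Ψ b θ).re / (Ψ b θ).im ≤ (Ψ a θ).re / (Ψ a θ).im ∧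
    ((Ψ b θ).re / (Ψ b θ).im = (Ψ a θ).re / (Ψ a θ).im → (Ψ b θ).im ≤ (Ψ a θ).im)

/-- The angular speed of the leading trajectories. -/
noncomputable def leadSpeed (Ψ : X → ℝ → ℂ) (g : ℝ → ℝ) (θ : ℝ) : ℝ :=
  sSup {r | ∃ a, (Ψ a θ).re = g θ * (Ψ a θ).im ∧ (Ψ a θ).im = r}

/-- The velocity of the leading trajectories. -/
noncomputable def leadVelocity (Ψ : X → ℝ → ℂ) (g : ℝ → ℝ) (θ : ℝ) : ℂ :=
  ⟨g θ * leadSpeed Ψ g θ, leadSpeed Ψ g θ⟩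

/-- The primitive of the leading slope. -/
noncomputable def leadRadius (g : ℝ → ℝ) (θ : ℝ) : ℝ := ∫ s in 0..θ, g s

theorem hasDerivAt_leadRadius (hg : Continuous g) (θ : ℝ) :
    HasDerivAt (leadRadius g) (g θ) θ :=
  intervalIntegral.integral_hasDerivAt_right (hg.intervalIntegrable _ _)
    hg.aestronglyMeasurable.stronglyMeasurableAtFilter hg.continuousAt

theorem contDiff_leadRadius (hg : Continuous g) : ContDiff ℝ 1 (leadRadius g) := by
  rw [contDiff_one_iff_deriv]
  refine ⟨fun θ => (hasDerivAt_leadRadius hg θ).differentiableAt, ?_⟩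
  rwa [show deriv (leadRadius g) = g from funext fun θ => (hasDerivAt_leadRadius hg θ).deriv]

theorem leadRadius_add_pi (hg : IsLeadSlope Ψ g) (θ : ℝ) :
    leadRadius g (θ + Real.pi) = leadRadius g θ + leadRadius g Real.pi := by
  have hi := fun a b => hg.continuous.intervalIntegrable (μ := volume) a b
  have := hg.periodic.intervalIntegral_add_eq θ 0
  rw [zero_add] at this
  rw [leadRadius, leadRadius, leadRadius, ← this,
    intervalIntegral.integral_add_adjacent_intervals (hi _ _) (hi _ _)]

/-- The curve traced by the leading trajectories, parametrized by the angle. -/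
noncomputable def leadContour (g : ℝ → ℝ) (θ : ℝ) : ℂ := ⟨leadRadius g θ, θ⟩

theorem leadContour_eq (g : ℝ → ℝ) (θ : ℝ) :
    leadContour g θ = (leadRadius g θ : ℂ) + θ * Complex.I := by
  apply Complex.ext <;> simp [leadContour]

theorem hasDerivAt_leadContour (hg : Continuous g) (θ : ℝ) :
    HasDerivAt (leadContour g) (⟨g θ, 1⟩ : ℂ) θ := by
  have h1 := (hasDerivAt_leadRadius hg θ).ofReal_comp.add
    (((hasDerivAt_id θ).ofReal_comp).mul_const Complex.I)
  have h2 : (⟨g θ, 1⟩ : ℂ) = (g θ : ℂ) + ((1 : ℝ) : ℂ) * Complex.I := by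
    apply Complex.ext <;> simp
  rw [h2]
  exact h1.congr_of_eventuallyEq (Eventually.of_forall fun s => leadContour_eq g s)

theorem contDiff_leadContour (hg : Continuous g) : ContDiff ℝ 1 (leadContour g) := by
  rw [show leadContour g = fun θ => (leadRadius g θ : ℂ) + θ * Complex.I from
    funext (leadContour_eq g)]
  have h1 : ContDiff ℝ 1 fun θ => (leadRadius g θ : ℂ) :=
    Complex.ofRealCLM.contDiff.comp (contDiff_leadRadius hg)
  have h2 : ContDiff ℝ 1 fun θ : ℝ => (θ : ℂ) := Complex.ofRealCLM.contDiff
  exact h1.add (h2.mul contDiff_const)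

theorem leadContour_add_two_pi (hg : IsLeadSlope Ψ g) (h0 : ∫ θ in 0..Real.pi, g θ = 0) (θ : ℝ) :
    leadContour g (θ + 2 * Real.pi) = leadContour g θ + 2 * Real.pi * Complex.I := by
  have : leadRadius g (θ + 2 * Real.pi) = leadRadius g θ := by
    rw [two_mul, ← add_assoc, leadRadius_add_pi hg, leadRadius_add_pi hg]
    simp [leadRadius, h0]
  rw [leadContour_eq, leadContour_eq, this]
  push_cast
  ring

variable [TopologicalSpace X]

theorem leadSpeed_periodic (h : PolarSystem Ψ) (hg : IsLeadSlope Ψ g) :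
    Function.Periodic (leadSpeed Ψ g) Real.pi := by
  intro θ; simp [leadSpeed, h.periodic, hg.periodic θ]

variable [CompactSpace X]

theorem measurable_leadSpeed_and (h : PolarSystem Ψ) (hg : IsLeadSlope Ψ g) :
    Measurable (leadSpeed Ψ g) ∧ ∀ θ, IsGreatest
      {r | ∃ a, (Ψ a θ).re = g θ * (Ψ a θ).im ∧ (Ψ a θ).im = r} (leadSpeed Ψ g θ) := by
  have hc : Continuous fun q : ℝ × X => Ψ q.2 q.1 := h.continuous.comp continuous_swap
  obtain ⟨m, hm, hmg⟩ := exists_measurable_isGreatest (p := id) measurable_id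
    (C := {q : ℝ × X | (Ψ q.2 q.1).re = g q.1 * (Ψ q.2 q.1).im})
    (isClosed_eq (Complex.continuous_re.comp hc)
      ((hg.continuous.comp continuous_fst).mul (Complex.continuous_im.comp hc)))
    (fun t => by obtain ⟨a, -, ha⟩ := hg.attained t; exact ⟨a, ha⟩)
    (u := fun q => (Ψ q.2 q.1).im) (Complex.continuous_im.comp hc)
  have : leadSpeed Ψ g = m := funext fun θ => (hmg θ).csSup_eq
  rw [this]
  exact ⟨hm, hmg⟩

theorem measurable_leadSpeed (h : PolarSystem Ψ) (hg : IsLeadSlope Ψ g) :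
    Measurable (leadSpeed Ψ g) := (measurable_leadSpeed_and h hg).1

theorem leadSpeed_isGreatest (h : PolarSystem Ψ) (hg : IsLeadSlope Ψ g) (θ : ℝ) : IsGreatest
      {r | ∃ a, (Ψ a θ).re = g θ * (Ψ a θ).im ∧ (Ψ a θ).im = r} (leadSpeed Ψ g θ) :=
  (measurable_leadSpeed_and h hg).2 θ

theorem leadSpeed_pos (h : PolarSystem Ψ) (hg : IsLeadSlope Ψ g) (θ : ℝ) :
    0 < leadSpeed Ψ g θ := by
  obtain ⟨a, ha, he⟩ := hg.attained θ
  exact ha.trans_le ((leadSpeed_isGreatest h hg θ).2 ⟨a, he, rfl⟩)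

/-- Several indices may lead, but they share one velocity, since both the slope and the speed are
prescribed. Leading trajectories therefore solve an autonomous equation. -/
theorem isLead_iff (h : PolarSystem Ψ) (hg : IsLeadSlope Ψ g) (θ : ℝ) (a : X) :
    IsLead Ψ θ a ↔ Ψ a θ = leadVelocity Ψ g θ := by
  have hG := leadSpeed_isGreatest h hg θ
  have hpos := leadSpeed_pos h hg θ
  constructor
  · rintro ⟨hi, hb⟩
    obtain ⟨b, hbe, hbs⟩ := hG.1
    have hbi : 0 < (Ψ b θ).im := hbs ▸ hpos
    have h1 := (hb b hbi).1
    have h2 := hg.upper a θ hi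
    have hbq : (Ψ b θ).re / (Ψ b θ).im = g θ := by rw [hbe]; field_simp
    have haq : (Ψ a θ).re / (Ψ a θ).im = g θ :=
      le_antisymm (by rwa [div_le_iff₀ hi]) (by rwa [← hbq])
    have hae : (Ψ a θ).re = g θ * (Ψ a θ).im := by rw [← haq]; field_simp
    have hle := (hb b hbi).2 (by rw [haq, hbq])
    have : (Ψ a θ).im = leadSpeed Ψ g θ := le_antisymm (hG.2 ⟨a, hae, rfl⟩) (hbs ▸ hle)
    apply Complex.ext
    · simp [leadVelocity, hae, this]
    · simp [leadVelocity, this]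
  · intro he
    have hre : (Ψ a θ).re = g θ * leadSpeed Ψ g θ := by rw [he, leadVelocity]
    have him : (Ψ a θ).im = leadSpeed Ψ g θ := by rw [he, leadVelocity]
    refine ⟨him ▸ hpos, fun b hb => ?_⟩
    have haq : (Ψ a θ).re / (Ψ a θ).im = g θ := by rw [hre, him]; field_simp
    rw [haq]
    refine ⟨by rw [div_le_iff₀ hb]; exact hg.upper b θ hb, fun hbq => ?_⟩
    rw [him]
    exact hG.2 ⟨b, by rw [← hbq]; field_simp, rfl⟩

/-- Continuity of the speed is not available, so compactness is applied to the velocities instead: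
one with re = g im cannot be real by feasibility, hence such velocities have |im| bounded away from
0. -/
theorem exists_leadSpeed_bounds (h : PolarSystem Ψ) (hg : IsLeadSlope Ψ g) :
    ∃ m M, 0 < m ∧ 0 < M ∧ ∀ θ, m ≤ leadSpeed Ψ g θ ∧ leadSpeed Ψ g θ ≤ M := by
  obtain ⟨M, hM, hb⟩ := exists_forall_bound h.continuous h.periodic'
  have hcre := Complex.continuous_re.comp h.continuous
  have hcim := Complex.continuous_im.comp h.continuous
  obtain ⟨m, hm, hmle⟩ := exists_forall_pos_le
    (f := fun a θ => max |(Ψ a θ).re - g θ * (Ψ a θ).im| |(Ψ a θ).im|)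
    (((hcre.sub ((hg.continuous.comp continuous_snd).mul hcim)).abs).max hcim.abs)
    (fun a θ => by simp [h.periodic, hg.periodic θ]) (by
      intro a θ
      by_cases hi : (Ψ a θ).im = 0
      · refine lt_max_of_lt_left (abs_pos.2 ?_)
        rw [hi, mul_zero, sub_zero]
        exact (h.feasible a θ hi).ne
      · exact lt_max_of_lt_right (abs_pos.2 hi))
  refine ⟨m, M, hm, hM, fun θ => ?_⟩
  obtain ⟨a, ha, he⟩ := (leadSpeed_isGreatest h hg θ).1
  have hpos := leadSpeed_pos h hg θ
  rw [← he] at hpos ⊢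
  constructor
  · have := hmle a θ
    rw [ha, sub_self, abs_zero, abs_of_pos hpos] at this
    rcases le_max_iff.1 this with h1 | h1 <;> linarith
  · exact (le_abs_self _).trans ((Complex.abs_im_le_norm _).trans (hb a θ))

theorem exists_measurable_isLead (h : PolarSystem Ψ) (hg : IsLeadSlope Ψ g) (us : List (X → ℝ))
    (hus : ∀ u ∈ us, Continuous u) :
    ∃ s : ℝ → X, (∀ θ, IsLead Ψ θ (s θ)) ∧ ∀ u ∈ us, Measurable (u ∘ s) := by
  have hc : Continuous fun q : (ℝ × ℝ) × X => Ψ q.2 q.1.1 :=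
    h.continuous.comp (by fun_prop : Continuous fun q : (ℝ × ℝ) × X => (q.2, q.1.1))
  obtain ⟨s, hs, hsm⟩ := exists_measurable_selection us hus (p := fun θ => (θ, leadSpeed Ψ g θ))
    (measurable_id.prodMk (measurable_leadSpeed h hg))
    (C := {q : (ℝ × ℝ) × X | (Ψ q.2 q.1.1).re = g q.1.1 * (Ψ q.2 q.1.1).im ∧
      (Ψ q.2 q.1.1).im = q.1.2})
    ((isClosed_eq (Complex.continuous_re.comp hc)
      ((hg.continuous.comp (by fun_prop)).mul (Complex.continuous_im.comp hc))).inter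
      (isClosed_eq (Complex.continuous_im.comp hc) (by fun_prop)))
    (fun θ => (leadSpeed_isGreatest h hg θ).1)
  refine ⟨s, fun θ => (isLead_iff h hg θ _).2 ?_, hsm⟩
  obtain ⟨h1, h2⟩ := hs θ
  simp only at h1 h2
  apply Complex.ext
  · simp [leadVelocity, h1, h2]
  · simp [leadVelocity, h2]

/-- The time a leading trajectory needs to reach the angle `θ` from the angle `0`. -/
noncomputable def leadTime (Ψ : X → ℝ → ℂ) (g : ℝ → ℝ) (θ : ℝ) : ℝ :=
  ∫ s in 0..θ, (leadSpeed Ψ g s)⁻¹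

theorem intervalIntegrable_inv_leadSpeed (h : PolarSystem Ψ) (hg : IsLeadSlope Ψ g) (a b : ℝ) :
    IntervalIntegrable (fun s => (leadSpeed Ψ g s)⁻¹) volume a b := by
  obtain ⟨m, M, hm, hM, hb⟩ := exists_leadSpeed_bounds h hg
  rw [intervalIntegrable_iff]
  have : IsFiniteMeasure (volume.restrict (uIoc a b)) := by rw [uIoc]; infer_instance
  refine Integrable.of_bound (measurable_leadSpeed h hg).inv.aestronglyMeasurable m⁻¹
    (Eventually.of_forall fun s => ?_)
  have := (hm.trans_le (hb s).1)
  rw [Real.norm_of_nonneg (by positivity)]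
  exact inv_anti₀ hm (hb s).1

theorem leadTime_sub (h : PolarSystem Ψ) (hg : IsLeadSlope Ψ g) (a b : ℝ) :
    leadTime Ψ g b - leadTime Ψ g a = ∫ s in a..b, (leadSpeed Ψ g s)⁻¹ := by
  rw [leadTime, leadTime, intervalIntegral.integral_interval_sub_left] <;>
  exact intervalIntegrable_inv_leadSpeed h hg _ _

theorem exists_leadTime_bounds (h : PolarSystem Ψ) (hg : IsLeadSlope Ψ g) :
    ∃ c C, 0 < c ∧ 0 < C ∧ ∀ a b, a ≤ b → c * (b - a) ≤ leadTime Ψ g b - leadTime Ψ g a ∧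
      leadTime Ψ g b - leadTime Ψ g a ≤ C * (b - a) := by
  obtain ⟨m, M, hm, hM, hb⟩ := exists_leadSpeed_bounds h hg
  refine ⟨M⁻¹, m⁻¹, by positivity, by positivity, fun a b hab => ?_⟩
  rw [leadTime_sub h hg]
  have hc : ∀ r : ℝ, r * (b - a) = ∫ _ in a..b, r := fun r => by
    rw [intervalIntegral.integral_const, smul_eq_mul, mul_comm]
  rw [hc, hc]
  constructor <;> apply intervalIntegral.integral_mono_on hab
  · simp
  · exact intervalIntegrable_inv_leadSpeed h hg _ _
  · exact fun s _ => inv_anti₀ (hm.trans_le (hb s).1) (hb s).2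
  · exact intervalIntegrable_inv_leadSpeed h hg _ _
  · simp
  · exact fun s _ => inv_anti₀ hm (hb s).1

theorem ae_hasDerivAt_leadTime (h : PolarSystem Ψ) (hg : IsLeadSlope Ψ g) :
    ∀ᵐ θ, HasDerivAt (leadTime Ψ g) (leadSpeed Ψ g θ)⁻¹ θ := by
  have hloc : LocallyIntegrable fun s => (leadSpeed Ψ g s)⁻¹ := by
    intro t
    refine ⟨Icc (t - 1) (t + 1), Icc_mem_nhds (by linarith) (by linarith), ?_⟩
    rw [integrableOn_Icc_iff_integrableOn_Ioc,
      ← intervalIntegrable_iff_integrableOn_Ioc_of_le (by linarith)]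
    exact intervalIntegrable_inv_leadSpeed h hg _ _
  filter_upwards [LocallyIntegrable.ae_hasDerivAt_integral hloc] with θ hθ
  exact hθ 0

theorem lipschitz_leadTime (h : PolarSystem Ψ) (hg : IsLeadSlope Ψ g) :
    LocallyLipschitz (leadTime Ψ g) := by
  obtain ⟨c, C, hc, hC, hb⟩ := exists_leadTime_bounds h hg
  refine (LipschitzWith.of_dist_le_mul (K := ⟨C, hC.le⟩) fun a b => ?_).locallyLipschitz
  wlog hab : a ≤ b generalizing a b
  · rw [dist_comm, dist_comm a b]; exact this b a (le_of_not_ge hab)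
  have h1 := (hb a b hab)
  have h2 : 0 ≤ c * (b - a) := mul_nonneg hc.le (sub_nonneg.2 hab)
  rw [dist_comm, dist_comm a b, Real.dist_eq, Real.dist_eq, abs_of_nonneg (by linarith),
    abs_of_nonneg (by linarith)]
  exact h1.2

theorem strictMono_leadTime (h : PolarSystem Ψ) (hg : IsLeadSlope Ψ g) :
    StrictMono (leadTime Ψ g) := by
  obtain ⟨c, C, hc, hC, hb⟩ := exists_leadTime_bounds h hg
  intro a b hab
  have := (hb a b hab.le).1
  have h2 : 0 < c * (b - a) := mul_pos hc (sub_pos.2 hab)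
  linarith

theorem surjective_leadTime (h : PolarSystem Ψ) (hg : IsLeadSlope Ψ g) :
    Function.Surjective (leadTime Ψ g) := by
  obtain ⟨c, C, hc, hC, hb⟩ := exists_leadTime_bounds h hg
  have h0 : leadTime Ψ g 0 = 0 := by simp [leadTime]
  refine (lipschitz_leadTime h hg).continuous.surjective ?_ ?_
  · refine tendsto_atTop_mono' _ ?_ (tendsto_id.const_mul_atTop hc)
    filter_upwards [eventually_ge_atTop 0] with b hb'
    have := (hb 0 b hb').1
    simpa [h0] using this
  · refine tendsto_atBot_mono' _ ?_ (tendsto_id.const_mul_atBot hc)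
    filter_upwards [eventually_le_atBot 0] with a ha
    have := (hb a 0 ha).1
    simp only [h0, zero_sub, mul_neg] at this
    simp only [id]
    linarith

theorem leadTime_add_pi (h : PolarSystem Ψ) (hg : IsLeadSlope Ψ g) (θ : ℝ) :
    leadTime Ψ g (θ + Real.pi) = leadTime Ψ g θ + leadTime Ψ g Real.pi := by
  have hp : Function.Periodic (fun s => (leadSpeed Ψ g s)⁻¹) Real.pi := fun s => by
    simp only [leadSpeed_periodic h hg s]
  have := hp.intervalIntegral_add_eq θ 0
  rw [zero_add] at this
  have h2 := leadTime_sub h hg θ (θ + Real.pi)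
  rw [this] at h2
  rw [← sub_eq_iff_eq_add', h2, leadTime]

/-- The angle of the leading trajectory as a function of time. -/
noncomputable def leadAngle (h : PolarSystem Ψ) (hg : IsLeadSlope Ψ g) : ℝ ≃o ℝ :=
  ((strictMono_leadTime h hg).orderIsoOfSurjective _ (surjective_leadTime h hg)).symm

theorem leadTime_leadAngle (h : PolarSystem Ψ) (hg : IsLeadSlope Ψ g) (t : ℝ) :
    leadTime Ψ g (leadAngle h hg t) = t :=
  (StrictMono.orderIsoOfSurjective _ _ (surjective_leadTime h hg)).apply_symm_apply t

theorem leadAngle_leadTime (h : PolarSystem Ψ) (hg : IsLeadSlope Ψ g) (θ : ℝ) :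
    leadAngle h hg (leadTime Ψ g θ) = θ :=
  (StrictMono.orderIsoOfSurjective _ _ (surjective_leadTime h hg)).symm_apply_apply θ

/-- This justifies almost-everywhere chain rules. An expanding map is antilipschitz, so preimages of
null sets are null; one-dimensional Hausdorff measure expresses this. -/
theorem ae_comp_of_expanding {θ : ℝ → ℝ} {c : ℝ} (hc : 0 < c)
    (h : ∀ s t, s ≤ t → c * (t - s) ≤ θ t - θ s) {p : ℝ → Prop} (hp : ∀ᵐ s, p s) :
    ∀ᵐ t, p (θ t) := by
  have ha : AntilipschitzWith ⟨c⁻¹, by positivity⟩ θ := by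
    refine AntilipschitzWith.of_le_mul_dist fun s t => ?_
    wlog hst : s ≤ t generalizing s t
    · rw [dist_comm, dist_comm (θ s)]; exact this t s (le_of_not_ge hst)
    have h1 := h s t hst
    have h2 : 0 ≤ c * (t - s) := mul_nonneg hc.le (sub_nonneg.2 hst)
    rw [dist_comm, dist_comm (θ s), Real.dist_eq, Real.dist_eq, abs_of_nonneg (by linarith),
      abs_of_nonneg (by linarith)]
    change t - s ≤ c⁻¹ * (θ t - θ s)
    rw [← div_eq_inv_mul, le_div_iff₀ hc]
    linarith
  have h2 := ha.hausdorffMeasure_preimage_le (d := 1) zero_le_one {s | ¬ p s}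
  rw [hausdorffMeasure_real] at h2
  rw [ae_iff] at hp ⊢
  rw [hp, mul_zero] at h2
  exact le_antisymm h2 zero_le

theorem exists_leadAngle_bounds (h : PolarSystem Ψ) (hg : IsLeadSlope Ψ g) :
    ∃ c C, 0 < c ∧ 0 < C ∧ ∀ s t, s ≤ t → c * (t - s) ≤ leadAngle h hg t - leadAngle h hg s ∧
      leadAngle h hg t - leadAngle h hg s ≤ C * (t - s) := by
  obtain ⟨c, C, hc, hC, hb⟩ := exists_leadTime_bounds h hg
  refine ⟨C⁻¹, c⁻¹, by positivity, by positivity, fun s t hst => ?_⟩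
  have := hb _ _ ((leadAngle h hg).monotone hst)
  rw [leadTime_leadAngle, leadTime_leadAngle] at this
  rw [← div_eq_inv_mul, ← div_eq_inv_mul, le_div_iff₀ hc, div_le_iff₀ hC]
  constructor <;> linarith

theorem ae_hasDerivAt_leadAngle (h : PolarSystem Ψ) (hg : IsLeadSlope Ψ g) :
    ∀ᵐ t, HasDerivAt (leadAngle h hg) (leadSpeed Ψ g (leadAngle h hg t)) t := by
  obtain ⟨c, C, hc, hC, hb⟩ := exists_leadAngle_bounds h hg
  filter_upwards [ae_comp_of_expanding hc (fun s t hst => (hb s t hst).1)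
    (ae_hasDerivAt_leadTime h hg)] with t ht
  have := HasDerivAt.of_local_left_inverse (leadAngle h hg).continuous.continuousAt ht
    (inv_ne_zero (leadSpeed_pos h hg _).ne')
    (Eventually.of_forall fun y => leadTime_leadAngle h hg y)
  rwa [inv_inv] at this

theorem lipschitz_leadAngle (h : PolarSystem Ψ) (hg : IsLeadSlope Ψ g) :
    LocallyLipschitz (leadAngle h hg) := by
  obtain ⟨c, C, hc, hC, hb⟩ := exists_leadAngle_bounds h hg
  refine (LipschitzWith.of_dist_le_mul (K := ⟨C, hC.le⟩) fun a b => ?_).locallyLipschitz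
  wlog hab : a ≤ b generalizing a b
  · rw [dist_comm, dist_comm a b]; exact this b a (le_of_not_ge hab)
  have h1 := (hb a b hab)
  have h2 : 0 ≤ c * (b - a) := mul_nonneg hc.le (sub_nonneg.2 hab)
  rw [dist_comm, dist_comm a b, Real.dist_eq, Real.dist_eq, abs_of_nonneg (by linarith),
    abs_of_nonneg (by linarith)]
  exact h1.2

/-- The leading trajectory in logarithmic polar coordinates. -/
noncomputable def leadCurve (h : PolarSystem Ψ) (hg : IsLeadSlope Ψ g) (t : ℝ) : ℂ :=
  leadContour g (leadAngle h hg t)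

theorem leadCurve_im (h : PolarSystem Ψ) (hg : IsLeadSlope Ψ g) (t : ℝ) :
    (leadCurve h hg t).im = leadAngle h hg t := rfl

theorem lipschitz_leadCurve (h : PolarSystem Ψ) (hg : IsLeadSlope Ψ g) :
    LocallyLipschitz (leadCurve h hg) :=
  (contDiff_leadContour hg.continuous).locallyLipschitz.comp (lipschitz_leadAngle h hg)

theorem ae_hasDerivAt_leadCurve (h : PolarSystem Ψ) (hg : IsLeadSlope Ψ g) :
    ∀ᵐ t, HasDerivAt (leadCurve h hg) (leadVelocity Ψ g (leadCurve h hg t).im) t := by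
  filter_upwards [ae_hasDerivAt_leadAngle h hg] with t ht
  have := (hasDerivAt_leadContour hg.continuous (leadAngle h hg t)).scomp t ht
  rw [leadCurve_im]
  convert! this using 1
  apply Complex.ext <;> simp [leadVelocity, mul_comm]

/-- No Lipschitz uniqueness theorem is invoked, as the speed is only known to be measurable.
Instead, `leadTime` of the angle minus t, and log r minus `leadRadius` of the angle, are constants
of motion: their derivatives vanish almost everywhere. -/
theorem exists_eq_leadCurve (h : PolarSystem Ψ) (hg : IsLeadSlope Ψ g) {ζ : ℝ → ℂ}
    (hζ : LocallyLipschitz ζ)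
    (hd : ∀ᵐ t, HasDerivAt ζ (leadVelocity Ψ g (ζ t).im) t) :
    ∃ τ r : ℝ, ∀ t, ζ t = r + leadCurve h hg (t + τ) := by
  obtain ⟨m, M, hm, hM, hb⟩ := exists_leadSpeed_bounds h hg
  have hre : LocallyLipschitz fun t => (ζ t).re :=
    (Complex.reCLM.contDiff (n := 1)).locallyLipschitz.comp hζ
  have him : LocallyLipschitz fun t => (ζ t).im :=
    (Complex.imCLM.contDiff (n := 1)).locallyLipschitz.comp hζ
  have hdim : ∀ᵐ t, HasDerivAt (fun t => (ζ t).im) (leadSpeed Ψ g (ζ t).im) t := by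
    filter_upwards [hd] with t ht
    exact Complex.imCLM.hasFDerivAt.comp_hasDerivAt t ht
  have hdre : ∀ᵐ t, HasDerivAt (fun t => (ζ t).re)
      (g (ζ t).im * leadSpeed Ψ g (ζ t).im) t := by
    filter_upwards [hd] with t ht
    exact Complex.reCLM.hasFDerivAt.comp_hasDerivAt t ht
  have hexp : ∀ s t, s ≤ t → m * (t - s) ≤ (ζ t).im - (ζ s).im := fun s t hst =>
    le_sub_of_ae_le_deriv him hst (by
      filter_upwards [hdim] with u hu _ d hd
      rw [hd.unique hu]
      exact (hb _).1)
  have heq : ∀ f : ℝ → ℝ, LocallyLipschitz f → (∀ᵐ t, HasDerivAt f 0 t) → ∀ t, f t = f 0 := by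
    intro f hf hf0 t
    rcases le_total 0 t with h0 | h0
    · exact eq_of_ae_hasDerivAt_zero hf h0 (hf0.mono fun _ h _ => h)
    · exact (eq_of_ae_hasDerivAt_zero hf h0 (hf0.mono fun _ h _ => h)).symm
  have h1 := heq (fun t => leadTime Ψ g (ζ t).im + -t)
    (((lipschitz_leadTime h hg).comp him).add LocallyLipschitz.id.neg) (by
      filter_upwards [hdim, ae_comp_of_expanding hm hexp (ae_hasDerivAt_leadTime h hg)]
        with t ht h2
      have h3 := (h2.comp t ht).add (hasDerivAt_id t).neg
      rw [inv_mul_cancel₀ (leadSpeed_pos h hg _).ne', add_neg_cancel] at h3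
      exact h3)
  have h2 := heq (fun t => (ζ t).re + -leadRadius g (ζ t).im)
    (hre.add ((contDiff_leadRadius hg.continuous).locallyLipschitz.comp him).neg) (by
      filter_upwards [hdim, hdre] with t ht h2
      have h3 := h2.add ((hasDerivAt_leadRadius hg.continuous _).comp t ht).neg
      rw [add_neg_cancel] at h3
      exact h3)
  refine ⟨leadTime Ψ g (ζ 0).im, (ζ 0).re - leadRadius g (ζ 0).im, fun t => ?_⟩
  have h3 : leadTime Ψ g (ζ t).im = t + leadTime Ψ g (ζ 0).im := by
    have := h1 t; linarith
  have h4 : leadAngle h hg (t + leadTime Ψ g (ζ 0).im) = (ζ t).im := by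
    rw [← h3, leadAngle_leadTime]
  have h5 := h2 t
  rw [leadCurve, h4]
  apply Complex.ext
  · simp only [leadContour, Complex.add_re, Complex.ofReal_re]; linarith
  · simp [leadContour]

/-- The period of the leading trajectory. -/
noncomputable def leadPeriod (Ψ : X → ℝ → ℂ) (g : ℝ → ℝ) : ℝ := 2 * leadTime Ψ g Real.pi

theorem leadTime_add_two_pi (h : PolarSystem Ψ) (hg : IsLeadSlope Ψ g) (θ : ℝ) :
    leadTime Ψ g (θ + 2 * Real.pi) = leadTime Ψ g θ + leadPeriod Ψ g := by
  rw [two_mul, ← add_assoc, leadTime_add_pi h hg, leadTime_add_pi h hg, leadPeriod]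
  ring

theorem leadPeriod_pos (h : PolarSystem Ψ) (hg : IsLeadSlope Ψ g) : 0 < leadPeriod Ψ g := by
  have := strictMono_leadTime h hg Real.pi_pos
  rw [show leadTime Ψ g 0 = 0 by simp [leadTime]] at this
  unfold leadPeriod
  linarith

theorem leadAngle_add_leadPeriod (h : PolarSystem Ψ) (hg : IsLeadSlope Ψ g) (t : ℝ) :
    leadAngle h hg (t + leadPeriod Ψ g) = leadAngle h hg t + 2 * Real.pi := by
  rw [← leadAngle_leadTime h hg (leadAngle h hg t + 2 * Real.pi), leadTime_add_two_pi h hg,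
    leadTime_leadAngle]

theorem exp_leadCurve_periodic (h : PolarSystem Ψ) (hg : IsLeadSlope Ψ g)
    (h0 : ∫ θ in 0..Real.pi, g θ = 0) :
    Function.Periodic (fun t => Complex.exp (leadCurve h hg t)) (leadPeriod Ψ g) := by
  intro t
  simp only [leadCurve, leadAngle_add_leadPeriod, leadContour_add_two_pi hg h0,
    Complex.exp_add, Complex.exp_two_pi_mul_I, mul_one]

/-- Over one period the strictly increasing angle runs once through [0, 2π). -/
theorem injOn_exp_leadCurve (h : PolarSystem Ψ) (hg : IsLeadSlope Ψ g) :
    InjOn (fun t => Complex.exp (leadCurve h hg t)) (Ico 0 (leadPeriod Ψ g)) := by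
  intro s hs t ht hst
  obtain ⟨n, hn⟩ := Complex.exp_eq_exp_iff_exists_int.1 hst
  have him := congrArg Complex.im hn
  have hA : leadAngle h hg 0 = 0 := by
    have := leadAngle_leadTime h hg 0
    rwa [show leadTime Ψ g 0 = 0 by simp [leadTime]] at this
  have hT : leadAngle h hg (leadPeriod Ψ g) = 2 * Real.pi := by
    have := leadAngle_add_leadPeriod h hg 0
    rwa [zero_add, hA, zero_add] at this
  have key : ∀ u ∈ Ico 0 (leadPeriod Ψ g), leadAngle h hg u ∈ Ico 0 (2 * Real.pi) :=
    fun u hu => ⟨hA ▸ (leadAngle h hg).monotone hu.1, hT ▸ (leadAngle h hg).strictMono hu.2⟩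
  have h1 := key s hs
  have h2 := key t ht
  rw [leadCurve_im, Complex.add_im, leadCurve_im] at him
  have h3 : ((n : ℂ) * (2 * Real.pi * Complex.I)).im = n * (2 * Real.pi) := by simp
  rw [h3] at him
  have hpi := Real.pi_pos
  have hn0 : n = 0 := by
    have h4 : (n : ℝ) < 1 := by
      by_contra hc
      have : 1 * (2 * Real.pi) ≤ n * (2 * Real.pi) := by gcongr; exact not_lt.1 hc
      linarith [h1.1, h1.2, h2.1, h2.2]
    have h5 : (-1 : ℝ) < n := by
      by_contra hc
      have : n * (2 * Real.pi) ≤ (-1) * (2 * Real.pi) := by gcongr; exact not_lt.1 hc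
      linarith [h1.1, h1.2, h2.1, h2.2]
    have h4' : n < 1 := by exact_mod_cast h4
    have h5' : -1 < n := by exact_mod_cast h5
    omega
  rw [hn0] at him
  simpa using him

theorem exists_leadCurve_eq (h : PolarSystem Ψ) (hg : IsLeadSlope Ψ g)
    (h0 : ∫ θ in 0..Real.pi, g θ = 0) (θ : ℝ) :
    ∃ t ∈ Ico 0 (leadPeriod Ψ g),
      Complex.exp (leadCurve h hg t) = Complex.exp (leadContour g θ) := by
  obtain ⟨t, ht, he⟩ := (exp_leadCurve_periodic h hg h0).exists_mem_Ico₀ (leadPeriod_pos h hg)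
    (leadTime Ψ g θ)
  refine ⟨t, ht, ?_⟩
  rw [← he]
  simp only [leadCurve, leadAngle_leadTime]

end LeadingCurves

/-! ### Growth of trajectories, concatenation, and the Lyapunov exponent. -/

section Growth

theorem norm_le_of_ae_hasDerivAt {y v : ℝ → Plane} (hy : LocallyLipschitz y) {M a b : ℝ}
    (hab : a ≤ b) (h : ∀ᵐ t, t ∈ Icc a b → HasDerivAt y (v t) t ∧ ‖v t‖ ≤ M * ‖y t‖) :
    ‖y b‖ ≤ Real.exp (M * (b - a)) * ‖y a‖ ∧ Real.exp (-(M * (b - a))) * ‖y a‖ ≤ ‖y b‖ := by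
  have hn : LocallyLipschitz fun t => ‖y t‖ ^ 2 :=
    (contDiff_norm_sq ℝ (n := 1) (E := Plane)).locallyLipschitz (𝕂 := ℝ) |>.comp hy
  have hl : ∀ c : ℝ, LocallyLipschitz fun t => Real.exp (c * t) * ‖y t‖ ^ 2 := fun c => by
    have h1 : LocallyLipschitz fun t => Real.exp (c * t) :=
      ContDiff.locallyLipschitz (𝕂 := ℝ) (by fun_prop)
    have h2 : LocallyLipschitz fun p : ℝ × ℝ => p.1 * p.2 :=
      ContDiff.locallyLipschitz (𝕂 := ℝ) (by fun_prop)
    exact h2.comp (h1.prodMk hn)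
  have hd : ∀ c : ℝ, ∀ t, HasDerivAt y (v t) t → HasDerivAt (fun t => Real.exp (c * t) * ‖y t‖ ^ 2)
      (Real.exp (c * t) * (c * ‖y t‖ ^ 2 + 2 * inner ℝ (y t) (v t))) t := fun c t ht => by
    have h1 : HasDerivAt (fun t => Real.exp (c * t)) (Real.exp (c * t) * (c * 1)) t :=
      ((hasDerivAt_id t).const_mul c).exp
    exact (h1.mul ht.norm_sq).congr_deriv (by ring)
  have hin : ∀ t, ‖v t‖ ≤ M * ‖y t‖ → |inner ℝ (y t) (v t)| ≤ M * ‖y t‖ ^ 2 := fun t ht => by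
    refine (abs_real_inner_le_norm _ _).trans ?_
    calc ‖y t‖ * ‖v t‖ ≤ ‖y t‖ * (M * ‖y t‖) := by gcongr
      _ = M * ‖y t‖ ^ 2 := by ring
  have h1 : Real.exp (-(2 * M) * b) * ‖y b‖ ^ 2 ≤ Real.exp (-(2 * M) * a) * ‖y a‖ ^ 2 :=
    le_of_ae_deriv_nonpos (hl _) hab (by
      filter_upwards [h] with t ht hm d hdt
      obtain ⟨h1, h2⟩ := ht hm
      rw [hdt.unique (hd _ t h1)]
      refine mul_nonpos_of_nonneg_of_nonpos (Real.exp_pos _).le ?_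
      linarith [(abs_le.1 (hin t h2)).2])
  have h2 : Real.exp ((2 * M) * a) * ‖y a‖ ^ 2 ≤ Real.exp ((2 * M) * b) * ‖y b‖ ^ 2 := by
    have := le_sub_of_ae_le_deriv (c := 0) (hl (2 * M)) hab (by
      filter_upwards [h] with t ht hm d hdt
      obtain ⟨h1, h2⟩ := ht hm
      rw [hdt.unique (hd _ t h1)]
      refine mul_nonneg (Real.exp_pos _).le ?_
      linarith [(abs_le.1 (hin t h2)).1])
    linarith
  have hsq : ∀ r : ℝ, Real.exp (2 * r) = Real.exp r ^ 2 := fun r => by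
    rw [← Real.exp_nat_mul]; norm_num
  constructor
  · refine le_of_sq_le_sq ?_ (by positivity)
    rw [mul_pow, ← hsq]
    have := mul_le_mul_of_nonneg_left h1 (Real.exp_pos (2 * M * b)).le
    rw [← mul_assoc, ← mul_assoc, ← Real.exp_add, ← Real.exp_add] at this
    ring_nf at this ⊢
    simpa using this
  · refine le_of_sq_le_sq ?_ (norm_nonneg _)
    rw [mul_pow, ← hsq]
    have := mul_le_mul_of_nonneg_left h2 (Real.exp_pos (-(2 * M * b))).le
    rw [← mul_assoc, ← mul_assoc, ← Real.exp_add, ← Real.exp_add] at this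
    ring_nf at this ⊢
    simpa using this

theorem IsTrajectory.norm_bounds {𝒜 : Set Mat} {M : ℝ}
    (hM : ∀ A ∈ 𝒜, ∀ x, ‖act A x‖ ≤ M * ‖x‖) {x : ℝ → Plane} (hx : IsTrajectory 𝒜 x) {t : ℝ}
    (ht : 0 ≤ t) : ‖x t‖ ≤ Real.exp (M * t) * ‖x 0‖ ∧
      Real.exp (-(M * t)) * ‖x 0‖ ≤ ‖x t‖ := by
  obtain ⟨A, hA, hs⟩ := hx
  obtain ⟨hl, hd⟩ := hs.locallyLipschitz isTimeRetraction_Ici fun t ht => hM _ (hA t ht)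
  have := norm_le_of_ae_hasDerivAt (M := M) hl ht (v := fun t => act (A t) (x t)) (by
    filter_upwards [hd] with s hs' hm
    refine ⟨hs' hm.1, ?_⟩
    rw [Function.comp_apply, max_eq_left hm.1]
    exact hM _ (hA s hm.1) _)
  simpa [max_eq_left ht] using this

/-- The matrix as a bounded operator. -/
noncomputable def toOp (A : Mat) : Plane →L[ℝ] Plane :=
  LinearMap.toContinuousLinearMap (Matrix.toEuclideanLin A)

theorem toOp_apply (A : Mat) (x : Plane) : toOp A x = act A x := rfl

/-- The flow of the linear equation `x' = A x`. -/
noncomputable def flow (A : Mat) (t : ℝ) : Plane →L[ℝ] Plane := NormedSpace.exp (t • toOp A)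

theorem flow_zero (A : Mat) : flow A 0 = 1 := by
  have : (0 : ℝ) • toOp A = 0 := zero_smul ℝ (toOp A)
  rw [flow, this, NormedSpace.exp_zero]

theorem hasDerivAt_flow (A : Mat) (x : Plane) (t : ℝ) :
    HasDerivAt (fun t => flow A t x) (act A (flow A t x)) t :=
  (hasDerivAt_exp_smul_const' (toOp A) t).clm_apply (hasDerivAt_const t x) |>.congr_deriv (by
    simp [flow, toOp_apply])

theorem locallyLipschitz_flow (A : Mat) (x : Plane) : LocallyLipschitz fun t => flow A t x := by
  refine ContDiff.locallyLipschitz (𝕂 := ℝ) (contDiff_one_iff_deriv.2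
    ⟨fun t => (hasDerivAt_flow A x t).differentiableAt, ?_⟩)
  rw [show deriv (fun t => flow A t x) = fun t => toOp A (flow A t x) from
    funext fun t => (hasDerivAt_flow A x t).deriv]
  exact (toOp A).continuous.comp
    (continuous_iff_continuousAt.2 fun t => (hasDerivAt_flow A x t).continuousAt)

/-- A trajectory together with its switching law, both extended to negative times. -/
structure IsMotion (𝒜 : Set Mat) (A : ℝ → Mat) (y : ℝ → Plane) : Prop where
  measurable : StronglyMeasurable A
  mem : ∀ t, A t ∈ 𝒜
  lipschitz : LocallyLipschitz y
  hasDerivAt : ∀ᵐ t, 0 ≤ t → HasDerivAt y (act (A t) (y t)) t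

theorem IsMotion.isTrajectory {𝒜 : Set Mat} {A : ℝ → Mat} {y : ℝ → Plane}
    (h : IsMotion 𝒜 A y) : IsTrajectory 𝒜 y :=
  ⟨A, fun t _ => h.mem t, isSolutionOn_of_ae_hasDerivAt ordConnected_Ici
    h.measurable.aestronglyMeasurable h.lipschitz (fun _ _ => rfl) h.hasDerivAt⟩

theorem isMotion_flow {𝒜 : Set Mat} {A : Mat} (hA : A ∈ 𝒜) (x : Plane) :
    IsMotion 𝒜 (fun _ => A) fun t => flow A t x where
  measurable := stronglyMeasurable_const
  mem _ := hA
  lipschitz := locallyLipschitz_flow A x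
  hasDerivAt := Eventually.of_forall fun t _ => hasDerivAt_flow A x t

theorem norm_flow_le {𝒜 : Set Mat} {M : ℝ} (hM : ∀ A ∈ 𝒜, ∀ x, ‖act A x‖ ≤ M * ‖x‖) {A : Mat}
    (hA : A ∈ 𝒜) (x : Plane) {t : ℝ} (ht : 0 ≤ t) : ‖flow A t x‖ ≤ Real.exp (M * t) * ‖x‖ := by
  have := ((isMotion_flow hA x).isTrajectory.norm_bounds hM ht).1
  simpa [flow_zero] using this

theorem IsMotion.switch {𝒜 : Set Mat} {A : ℝ → Mat} {y : ℝ → Plane} (h : IsMotion 𝒜 A y)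
    {T : ℝ} {B : Mat} (hB : B ∈ 𝒜) :
    IsMotion 𝒜 ((Iio T).piecewise A fun _ => B)
      ((Iic T).piecewise y fun t => flow B (t - T) (y T)) where
  measurable := h.measurable.piecewise measurableSet_Iio stronglyMeasurable_const
  mem t := by
    by_cases ht : t ∈ Iio T
    · rw [piecewise_eq_of_mem _ _ _ ht]; exact h.mem t
    · rw [piecewise_eq_of_notMem _ _ _ ht]; exact hB
  lipschitz := by
    -- Written with `min` and `max`, the glued curve is visibly a sum of compositions of locally
    -- Lipschitz maps.
    have : ((Iic T).piecewise y fun t => flow B (t - T) (y T)) =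
        fun t => y (min t T) + (flow B (max t T - T) (y T) + -y T) := by
      ext1 t
      by_cases ht : t ≤ T
      · rw [piecewise_eq_of_mem _ _ _ (by exact ht), min_eq_left ht, max_eq_right ht, sub_self,
          flow_zero]
        simp
      · rw [piecewise_eq_of_notMem _ _ _ (by exact ht), min_eq_right (not_le.1 ht).le,
          max_eq_left (not_le.1 ht).le]
        abel
    rw [this]
    have h1 : LocallyLipschitz fun t : ℝ => min t T := LocallyLipschitz.id.min_const T
    have h2 : LocallyLipschitz fun t : ℝ => max t T := LocallyLipschitz.id.max_const T
    have h3 : LocallyLipschitz fun t : ℝ => t - T :=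
      ContDiff.locallyLipschitz (𝕂 := ℝ) (by fun_prop)
    exact (h.lipschitz.comp h1).add
      (((locallyLipschitz_flow B (y T)).comp (h3.comp h2)).add (LocallyLipschitz.const _))
  hasDerivAt := by
    have hne : ∀ᵐ t : ℝ, t ≠ T := by simp [ae_iff, measure_singleton]
    filter_upwards [h.hasDerivAt, hne] with t ht hT h0
    rcases lt_or_gt_of_ne hT with hlt | hgt
    · rw [piecewise_eq_of_mem _ _ _ (by exact hlt), piecewise_eq_of_mem _ _ _ (by exact hlt.le)]
      refine (ht h0).congr_of_eventuallyEq ?_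
      filter_upwards [Iio_mem_nhds hlt] with s hs
      rw [piecewise_eq_of_mem _ _ _ (by exact (mem_Iio.1 hs).le)]
    · rw [piecewise_eq_of_notMem _ _ _ (by simpa using hgt.le),
        piecewise_eq_of_notMem _ _ _ (by simpa using hgt)]
      refine ((hasDerivAt_flow B (y T) (t - T)).comp_sub_const t T).congr_of_eventuallyEq ?_
      filter_upwards [Ioi_mem_nhds hgt] with s hs
      rw [piecewise_eq_of_notMem _ _ _ (by simpa using hs)]

/-- The transition operators of the piecewise constant switching laws of a given duration. -/
inductive Reach (𝒜 : Set Mat) : ℝ → (Plane →L[ℝ] Plane) → Prop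
  | one : Reach 𝒜 0 1
  | step {A : Mat} {s t : ℝ} {P : Plane →L[ℝ] Plane} (hA : A ∈ 𝒜) (hs : 0 ≤ s)
      (h : Reach 𝒜 t P) : Reach 𝒜 (t + s) (flow A s * P)

variable {𝒜 : Set Mat}

theorem Reach.nonneg {t : ℝ} {P : Plane →L[ℝ] Plane} (h : Reach 𝒜 t P) : 0 ≤ t := by
  induction h with
  | one => exact le_rfl
  | step _ hs _ ih => linarith

theorem Reach.mul {s t : ℝ} {P Q : Plane →L[ℝ] Plane} (hQ : Reach 𝒜 s Q) (hP : Reach 𝒜 t P) :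
    Reach 𝒜 (t + s) (Q * P) := by
  induction hQ with
  | one => simpa using hP
  | step hA hs _ ih =>
    rw [mul_assoc, ← add_assoc]
    exact .step hA hs ih

theorem reach_flow {A : Mat} (hA : A ∈ 𝒜) {s : ℝ} (hs : 0 ≤ s) : Reach 𝒜 s (flow A s) := by
  simpa using Reach.step hA hs Reach.one

theorem Reach.norm_le {M : ℝ} (hM : ∀ A ∈ 𝒜, ∀ x, ‖act A x‖ ≤ M * ‖x‖) {t : ℝ}
    {P : Plane →L[ℝ] Plane} (h : Reach 𝒜 t P) (x : Plane) : ‖P x‖ ≤ Real.exp (M * t) * ‖x‖ := by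
  induction h with
  | one => simp
  | @step A s t P hA hs _ ih =>
    refine (norm_flow_le hM hA _ hs).trans ?_
    rw [mul_add, Real.exp_add, mul_comm (Real.exp (M * t)), mul_assoc]
    exact mul_le_mul_of_nonneg_left ih (Real.exp_pos _).le

theorem IsMotion.extend {A : ℝ → Mat} {y : ℝ → Plane} (h : IsMotion 𝒜 A y) (T : ℝ)
    {s : ℝ} {P : Plane →L[ℝ] Plane} (hP : Reach 𝒜 s P) :
    ∃ A' y', IsMotion 𝒜 A' y' ∧ EqOn A' A (Iio T) ∧ EqOn y' y (Iic T) ∧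
      y' (T + s) = P (y T) := by
  induction hP with
  | one => exact ⟨A, y, h, fun _ _ => rfl, fun _ _ => rfl, by simp⟩
  | @step B s t P hB hs hP ih =>
    obtain ⟨A', y', h', hA, hy, he⟩ := ih
    have ht := hP.nonneg
    refine ⟨_, _, h'.switch (T := T + t) hB, fun u hu => ?_, fun u hu => ?_, ?_⟩
    · rw [piecewise_eq_of_mem _ _ _ (by rw [mem_Iio] at hu ⊢; linarith)]
      exact hA hu
    · rw [piecewise_eq_of_mem _ _ _ (by rw [mem_Iic] at hu ⊢; linarith)]
      exact hy hu
    · by_cases hs0 : s = 0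
      · subst hs0
        rw [piecewise_eq_of_mem _ _ _ (by simp), add_zero, he, flow_zero]
        simp
      · have : 0 < s := lt_of_le_of_ne hs (Ne.symm hs0)
        rw [piecewise_eq_of_notMem _ _ _ (by simpa using this), he]
        simp [add_sub_cancel_left, ← add_assoc]

theorem exists_isMotion_limit {A : ℕ → ℝ → Mat} {y : ℕ → ℝ → Plane} {T : ℕ → ℝ}
    (h : ∀ n, IsMotion 𝒜 (A n) (y n)) (hT : Tendsto T atTop atTop) (hmono : Monotone T)
    (hA : ∀ n, EqOn (A (n + 1)) (A n) (Iio (T n))) (hy : ∀ n, EqOn (y (n + 1)) (y n) (Iic (T n))) :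
    ∃ A' y', IsMotion 𝒜 A' y' ∧ ∀ n, EqOn y' (y n) (Iio (T n)) := by
  have hA' : ∀ n m, n ≤ m → EqOn (A m) (A n) (Iio (T n)) := by
    intro n m hnm
    induction m, hnm using Nat.le_induction with
    | base => exact fun _ _ => rfl
    | succ m hm ih => exact fun t ht =>
        (hA m ((mem_Iio.1 ht).trans_le (hmono hm))).trans (ih ht)
  have hy' : ∀ n m, n ≤ m → EqOn (y m) (y n) (Iio (T n)) := by
    intro n m hnm
    induction m, hnm using Nat.le_induction with
    | base => exact fun _ _ => rfl
    | succ m hm ih => exact fun t ht =>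
        (hy m ((mem_Iio.1 ht).trans_le (hmono hm)).le).trans (ih ht)
  choose N hN using fun t : ℝ => (hT.eventually_gt_atTop t).exists
  have hyN : ∀ n, EqOn (fun t => y (N t) t) (y n) (Iio (T n)) := by
    intro n t ht
    rcases le_total n (N t) with hle | hle
    · exact hy' n _ hle ht
    · exact (hy' _ n hle (hN t)).symm
  have hAN : ∀ n, EqOn (fun t => A (N t) t) (A n) (Iio (T n)) := by
    intro n t ht
    rcases le_total n (N t) with hle | hle
    · exact hA' n _ hle ht
    · exact (hA' _ n hle (hN t)).symm
  refine ⟨fun t => A (N t) t, fun t => y (N t) t, ⟨?_, fun t => (h _).mem t, ?_, ?_⟩, hyN⟩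
  · have : TopologicalSpace.PseudoMetrizableSpace Mat :=
      inferInstanceAs (TopologicalSpace.PseudoMetrizableSpace (Fin 2 → Fin 2 → ℝ))
    refine stronglyMeasurable_of_tendsto atTop (fun n => (h n).measurable) ?_
    rw [tendsto_pi_nhds]
    intro t
    refine tendsto_const_nhds.congr' ?_
    filter_upwards [hT.eventually_gt_atTop t] with n hn
    exact hAN n hn
  · intro t
    obtain ⟨K, s, hs, hK⟩ := (h (N t)).lipschitz t
    refine ⟨K, _, inter_mem hs (Iio_mem_nhds (hN t)), ?_⟩
    intro a ha b hb
    rw [hyN (N t) ha.2, hyN (N t) hb.2]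
    exact hK ha.1 hb.1
  · filter_upwards [ae_all_iff.2 fun n => (h n).hasDerivAt] with t ht h0
    have h1 := ht (N t) h0
    exact h1.congr_of_eventuallyEq ((hyN (N t)).eventuallyEq_of_mem (Iio_mem_nhds (hN t)))

/-- Concatenate segments on each of which the norm gains the factor 2 exp(εt). Doubling takes time
at least log 2 / M, so the switching times diverge and the result is a trajectory on [0, ∞). At the
n-th switching time T its norm is at least 2ⁿ exp(εT) times the initial one. -/
theorem exists_growing_trajectory {M : ℝ} (hM : ∀ A ∈ 𝒜, ∀ x, ‖act A x‖ ≤ M * ‖x‖)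
    (hM0 : 0 < M) (hne : 𝒜.Nonempty) {ε : ℝ} (hε : 0 ≤ ε)
    (h : ∀ x : Plane, x ≠ 0 → ∃ t P, Reach 𝒜 t P ∧ 2 * Real.exp (ε * t) * ‖x‖ < ‖P x‖) :
    ∃ x, IsTrajectory 𝒜 x ∧ ¬ ∃ C, ∀ t, 0 ≤ t → ‖x t‖ ≤ C * Real.exp (ε * t) := by
  obtain ⟨B, hB⟩ := hne
  obtain ⟨x₀, hx₀⟩ := exists_ne (0 : Plane)
  let S := {p : (ℝ → Mat) × (ℝ → Plane) × ℝ // IsMotion 𝒜 p.1 p.2.1 ∧ 0 ≤ p.2.2 ∧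
    p.2.1 p.2.2 ≠ 0}
  have hstep : ∀ p : S, ∃ q : S, p.1.2.2 + Real.log 2 / M ≤ q.1.2.2 ∧
      EqOn q.1.1 p.1.1 (Iio p.1.2.2) ∧ EqOn q.1.2.1 p.1.2.1 (Iic p.1.2.2) ∧
      2 * Real.exp (ε * (q.1.2.2 - p.1.2.2)) * ‖p.1.2.1 p.1.2.2‖ ≤ ‖q.1.2.1 q.1.2.2‖ := by
    rintro ⟨⟨A, y, T⟩, hm, hT, h0⟩
    simp only at hm hT h0
    obtain ⟨t, P, hP, hlt⟩ := h _ h0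
    obtain ⟨A', y', hm', hA, hy, he⟩ := hm.extend T hP
    have ht := hP.nonneg
    have hpos : 0 < ‖P (y T)‖ := lt_of_le_of_lt (by positivity) hlt
    refine ⟨⟨⟨A', y', T + t⟩, hm', add_nonneg hT ht, ?_⟩, ?_, hA, hy, ?_⟩
    · simp only [he]; exact norm_pos_iff.1 hpos
    · have h1 := hP.norm_le hM (y T)
      have h2 : 2 * ‖y T‖ < Real.exp (M * t) * ‖y T‖ := by
        refine lt_of_le_of_lt ?_ (hlt.trans_le h1)
        have : 1 ≤ Real.exp (ε * t) := Real.one_le_exp (mul_nonneg hε ht)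
        have := norm_nonneg (y T)
        nlinarith
      have h3 := lt_of_mul_lt_mul_right h2 (norm_nonneg _)
      have h4 := (Real.log_lt_log two_pos h3).le
      rw [Real.log_exp] at h4
      simp only [add_le_add_iff_left]
      rw [div_le_iff₀ hM0]
      linarith
    · simp only [he, add_sub_cancel_left]; exact hlt.le
  choose next hT hA hy hn using hstep
  let σ : ℕ → S := fun n => next^[n] ⟨⟨fun _ => B, fun t => flow B t x₀, 0⟩, isMotion_flow hB x₀,
    le_rfl, by simpa [flow_zero] using hx₀⟩
  have hσ : ∀ n, σ (n + 1) = next (σ n) := fun n => Function.iterate_succ_apply' _ _ _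
  set τ := Real.log 2 / M with hτ
  have hτ0 : 0 < τ := div_pos (Real.log_pos one_lt_two) hM0
  have hTn : ∀ n, (σ n).1.2.2 + τ ≤ (σ (n + 1)).1.2.2 := fun n => by rw [hσ]; exact hT _
  have hlin : ∀ n : ℕ, n * τ ≤ (σ n).1.2.2 := by
    intro n
    induction n with
    | zero => simp [σ]
    | succ n ih => have := hTn n; push_cast; linarith
  obtain ⟨A', y', hm, heq⟩ := exists_isMotion_limit (A := fun n => (σ n).1.1)
    (y := fun n => (σ n).1.2.1) (T := fun n => (σ n).1.2.2) (fun n => (σ n).2.1)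
    (tendsto_atTop_mono hlin (tendsto_natCast_atTop_atTop.atTop_mul_const hτ0))
    (monotone_nat_of_le_succ fun n => by linarith [hTn n])
    (fun n => by rw [hσ]; exact hA _) (fun n => by rw [hσ]; exact hy _)
  refine ⟨y', hm.isTrajectory, ?_⟩
  rintro ⟨C, hC⟩
  have hgrow : ∀ n : ℕ, 2 ^ n * Real.exp (ε * (σ n).1.2.2) * ‖x₀‖ ≤
      ‖(σ n).1.2.1 (σ n).1.2.2‖ := by
    intro n
    induction n with
    | zero => simp [σ, flow_zero]
    | succ n ih =>
      have h1 := hn (σ n)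
      rw [← hσ] at h1
      refine le_trans ?_ h1
      have h2 := mul_le_mul_of_nonneg_left ih
        (show 0 ≤ 2 * Real.exp (ε * ((σ (n + 1)).1.2.2 - (σ n).1.2.2)) by positivity)
      refine le_trans (le_of_eq ?_) h2
      rw [show ε * (σ (n + 1)).1.2.2 = ε * ((σ (n + 1)).1.2.2 - (σ n).1.2.2) +
        ε * (σ n).1.2.2 by ring, Real.exp_add]
      ring
  have hval : ∀ n, y' (σ n).1.2.2 = (σ n).1.2.1 (σ n).1.2.2 := by
    intro n
    rw [heq (n + 1) (by have := hTn n; rw [mem_Iio]; linarith), hσ]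
    exact hy _ (mem_Iic.2 le_rfl)
  have hx0 : 0 < ‖x₀‖ := norm_pos_iff.2 hx₀
  obtain ⟨n, hn'⟩ := pow_unbounded_of_one_lt (C / ‖x₀‖) one_lt_two
  have h1 := (hgrow n).trans (hval n ▸ hC _ (σ n).2.2.1)
  have h2 : 2 ^ n * ‖x₀‖ ≤ C := by
    have h3 := Real.exp_pos (ε * (σ n).1.2.2)
    refine le_of_mul_le_mul_right ?_ h3
    linarith
  rw [div_lt_iff₀ hx0] at hn'
  linarith

/-- A real `sInf` takes the default value 0 on a set unbounded below, so this is needed to bound the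
exponent by members of the set. A nonzero trajectory decays no faster than exp(-Mt). -/
theorem lyapunovExponent_bddBelow {M : ℝ} (hM : ∀ A ∈ 𝒜, ∀ x, ‖act A x‖ ≤ M * ‖x‖)
    (hne : 𝒜.Nonempty) :
    BddBelow {σ : ℝ | ∀ x : ℝ → Plane, IsTrajectory 𝒜 x →
      ∃ C : ℝ, ∀ t : ℝ, 0 ≤ t → ‖x t‖ ≤ C * Real.exp (σ * t)} := by
  obtain ⟨B, hB⟩ := hne
  obtain ⟨x₀, hx₀⟩ := exists_ne (0 : Plane)
  have hx0 : 0 < ‖x₀‖ := norm_pos_iff.2 hx₀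
  refine ⟨-M, fun σ hσ => ?_⟩
  by_contra! hlt
  have htr := (isMotion_flow hB x₀).isTrajectory
  obtain ⟨C, hC⟩ := hσ _ htr
  have hd : 0 < -M - σ := by linarith
  have key : ∀ t : ℝ, 0 ≤ t → Real.exp ((-M - σ) * t) * ‖x₀‖ ≤ C := by
    intro t ht
    have h1 := (htr.norm_bounds hM ht).2.trans (hC t ht)
    simp only [flow_zero, one_apply_eq_self] at h1
    refine le_of_mul_le_mul_right ?_ (Real.exp_pos (σ * t))
    refine le_trans (le_of_eq ?_) h1
    rw [mul_right_comm, ← Real.exp_add]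
    ring_nf
  have h2 : Tendsto (fun t : ℝ => Real.exp ((-M - σ) * t) * ‖x₀‖) atTop atTop :=
    (Real.tendsto_exp_atTop.comp (tendsto_id.const_mul_atTop hd)).atTop_mul_const hx0
  obtain ⟨t, ht, h0⟩ := ((h2.eventually_gt_atTop C).and (eventually_ge_atTop 0)).exists
  exact absurd (key t h0) (not_le.2 ht)

theorem exists_bound_of_lyapunovExponent_lt {M : ℝ} (hM : ∀ A ∈ 𝒜, ∀ x, ‖act A x‖ ≤ M * ‖x‖)
    {ε : ℝ} (hε : lyapunovExponent 𝒜 < ε) {x : ℝ → Plane} (hx : IsTrajectory 𝒜 x) :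
    ∃ C, ∀ t, 0 ≤ t → ‖x t‖ ≤ C * Real.exp (ε * t) := by
  obtain ⟨σ, hσ, hlt⟩ := exists_lt_of_csInf_lt ⟨M, fun x hx => ⟨‖x 0‖, fun t ht => by
    rw [mul_comm]; exact (IsTrajectory.norm_bounds hM hx ht).1⟩⟩ hε
  obtain ⟨C, hC⟩ := hσ x hx
  refine ⟨|C|, fun t ht => (hC t ht).trans ?_⟩
  have := le_abs_self C
  gcongr

theorem lyapunovExponent_le_of_forall {M : ℝ} (hM : ∀ A ∈ 𝒜, ∀ x, ‖act A x‖ ≤ M * ‖x‖)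
    (hne : 𝒜.Nonempty) {σ : ℝ} (h : ∀ x : ℝ → Plane, IsTrajectory 𝒜 x →
      ∃ C : ℝ, ∀ t : ℝ, 0 ≤ t → ‖x t‖ ≤ C * Real.exp (σ * t)) : lyapunovExponent 𝒜 ≤ σ :=
  csInf_le (lyapunovExponent_bddBelow hM hne) h

end Growth

/-! ### A norm that does not increase along trajectories. -/

section ExtremalNorm

variable {𝒜 : Set Mat}

theorem IsIrreducible.nonempty (h : IsIrreducible 𝒜) : 𝒜.Nonempty := by
  by_contra hne
  rw [not_nonempty_iff_eq_empty] at hne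
  rcases h (Submodule.span ℝ {(EuclideanSpace.single 0 1 : Plane)}) (by simp [hne]) with h1 | h1
  · rw [Submodule.span_singleton_eq_bot] at h1
    have := congrArg (fun x : Plane => x 0) h1
    simp at this
  · have : (EuclideanSpace.single 1 1 : Plane) ∈
        Submodule.span ℝ {(EuclideanSpace.single 0 1 : Plane)} := h1 ▸ Submodule.mem_top
    obtain ⟨c, hc⟩ := Submodule.mem_span_singleton.1 this
    have := congrArg (fun x : Plane => x 1) hc
    simp at this

theorem act_mem_of_flow_mem {V : Submodule ℝ Plane} {A : Mat} {x : Plane} (hx : x ∈ V)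
    (h : ∀ s, 0 ≤ s → flow A s x ∈ V) : act A x ∈ V := by
  have h1 := (hasDerivAt_flow A x 0).tendsto_slope_zero_right
  simp only [flow_zero, zero_add, one_apply_eq_self] at h1
  refine V.closed_of_finiteDimensional.mem_of_tendsto h1 ?_
  filter_upwards [self_mem_nhdsWithin] with s hs
  exact V.smul_mem _ (V.sub_mem (h s (le_of_lt hs)) hx)

/-- The exponent bounds each trajectory with its own constant; irreducibility makes the bound
uniform over switching laws. The vectors with a uniform bound form an invariant subspace. Were it
trivial, every nonzero vector could be made to grow, and `exists_growing_trajectory` would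
contradict the exponent. -/
theorem exists_reach_bound (hcompact : IsCompact 𝒜) (hirr : IsIrreducible 𝒜) {ε : ℝ}
    (hε : lyapunovExponent 𝒜 < ε) (hε0 : 0 ≤ ε) (x : Plane) :
    ∃ C, ∀ t P, Reach 𝒜 t P → ‖P x‖ ≤ C * Real.exp (ε * t) := by
  obtain ⟨M, hM0, hM⟩ := exists_norm_act_le hcompact
  let E : Submodule ℝ Plane :=
    { carrier := {x | ∃ C, ∀ t P, Reach 𝒜 t P → ‖P x‖ ≤ C * Real.exp (ε * t)}
      add_mem' := by
        rintro a b ⟨C, hC⟩ ⟨D, hD⟩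
        refine ⟨C + D, fun t P hP => ?_⟩
        rw [map_add, add_mul]
        exact (norm_add_le _ _).trans (add_le_add (hC t P hP) (hD t P hP))
      zero_mem' := ⟨0, fun t P _ => by simp⟩
      smul_mem' := by
        rintro c a ⟨C, hC⟩
        refine ⟨|c| * C, fun t P hP => ?_⟩
        rw [map_smul, norm_smul, mul_assoc, Real.norm_eq_abs]
        exact mul_le_mul_of_nonneg_left (hC t P hP) (abs_nonneg c) }
  have hinv : ∀ A ∈ 𝒜, ∀ v ∈ E, act A v ∈ E := by
    intro A hA v hv
    refine act_mem_of_flow_mem hv fun s hs => ?_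
    obtain ⟨C, hC⟩ := hv
    refine ⟨C * Real.exp (ε * s), fun t P hP => ?_⟩
    have := hC _ _ (hP.mul (reach_flow hA hs))
    rwa [mul_apply_eq_comp, mul_add, Real.exp_add, ← mul_assoc] at this
  rcases hirr E hinv with h | h
  · exfalso
    obtain ⟨y, hy, hn⟩ := exists_growing_trajectory hM hM0 hirr.nonempty (ε := ε) hε0 (by
      intro v hv
      have : v ∉ E := by rw [h]; simpa using hv
      by_contra! hc
      exact this ⟨2 * ‖v‖, fun t P hP => (hc t P hP).trans (le_of_eq (by ring))⟩)
    exact hn (exists_bound_of_lyapunovExponent_lt hM hε hy)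
  · have : x ∈ E := h ▸ Submodule.mem_top
    exact this

/-- The largest growth of `x` under piecewise constant switching laws, discounted at rate `ε`. -/
noncomputable def discountedSup (𝒜 : Set Mat) (ε : ℝ) (x : Plane) : ℝ :=
  sSup {r | ∃ t P, Reach 𝒜 t P ∧ r = Real.exp (-(ε * t)) * ‖P x‖}

/-- For ε > 0 the discounted supremum is a norm that grows at most at rate ε along flows. Normalized
to have sum 1 on the basis vectors, these norms have an ultrafilter limit as ε → 0, which no flow
increases. Its kernel is invariant and, by the normalization, not the whole plane, so it is trivial
by irreducibility. -/
theorem exists_extremal_norm (hcompact : IsCompact 𝒜) (hirr : IsIrreducible 𝒜)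
    (hσ : lyapunovExponent 𝒜 = 0) :
    ∃ f : Seminorm ℝ Plane, (∀ x, f x = 0 → x = 0) ∧
      ∀ A ∈ 𝒜, ∀ s, 0 ≤ s → ∀ x, f (flow A s x) ≤ f x := by
  set e : Fin 2 → Plane := fun i => EuclideanSpace.single i 1 with he
  have hxe : ∀ x : Plane, x = x 0 • e 0 + x 1 • e 1 := fun x => by
    ext i; fin_cases i <;> simp [he]
  have hbdd : ∀ ε, 0 < ε → ∀ x,
      BddAbove {r | ∃ t P, Reach 𝒜 t P ∧ r = Real.exp (-(ε * t)) * ‖P x‖} := by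
    intro ε hε x
    obtain ⟨C, hC⟩ := exists_reach_bound hcompact hirr (hσ ▸ hε) hε.le x
    refine ⟨C, ?_⟩
    rintro _ ⟨t, P, hP, rfl⟩
    rw [Real.exp_neg, ← div_eq_inv_mul, div_le_iff₀ (Real.exp_pos _)]
    exact hC t P hP
  have hle : ∀ ε, 0 < ε → ∀ x t P, Reach 𝒜 t P →
      Real.exp (-(ε * t)) * ‖P x‖ ≤ discountedSup 𝒜 ε x := fun ε hε x t P hP =>
    le_csSup (hbdd ε hε x) ⟨t, P, hP, rfl⟩
  have hsup : ∀ ε x C, (∀ t P, Reach 𝒜 t P → Real.exp (-(ε * t)) * ‖P x‖ ≤ C) →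
      discountedSup 𝒜 ε x ≤ C := by
    intro ε x C h
    refine csSup_le ⟨_, 0, 1, Reach.one, rfl⟩ ?_
    rintro _ ⟨t, P, hP, rfl⟩
    exact h t P hP
  have hnorm : ∀ ε, 0 < ε → ∀ x, ‖x‖ ≤ discountedSup 𝒜 ε x := fun ε hε x => by
    simpa using hle ε hε x 0 1 Reach.one
  have hadd : ∀ ε, 0 < ε → ∀ x y,
      discountedSup 𝒜 ε (x + y) ≤ discountedSup 𝒜 ε x + discountedSup 𝒜 ε y := by
    intro ε hε x y
    refine hsup ε _ _ fun t P hP => ?_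
    refine le_trans ?_ (add_le_add (hle ε hε x t P hP) (hle ε hε y t P hP))
    rw [← mul_add, map_add]
    exact mul_le_mul_of_nonneg_left (norm_add_le _ _) (Real.exp_pos _).le
  have hsmul : ∀ ε, 0 < ε → ∀ (c : ℝ) x,
      discountedSup 𝒜 ε (c • x) ≤ ‖c‖ * discountedSup 𝒜 ε x := by
    intro ε hε c x
    refine hsup ε _ _ fun t P hP => ?_
    rw [map_smul, norm_smul, mul_left_comm]
    exact mul_le_mul_of_nonneg_left (hle ε hε x t P hP) (norm_nonneg c)
  have hflow : ∀ ε, 0 < ε → ∀ A ∈ 𝒜, ∀ s, 0 ≤ s → ∀ x,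
      discountedSup 𝒜 ε (flow A s x) ≤ Real.exp (ε * s) * discountedSup 𝒜 ε x := by
    intro ε hε A hA s hs x
    refine hsup ε _ _ fun t P hP => ?_
    have := mul_le_mul_of_nonneg_left (hle ε hε x _ _ (hP.mul (reach_flow hA hs)))
      (Real.exp_pos (ε * s)).le
    refine le_trans (le_of_eq ?_) this
    rw [mul_apply_eq_comp, ← mul_assoc, ← Real.exp_add]
    ring_nf
  set δ : ℕ → ℝ := fun n => 1 / ((n : ℝ) + 1) with hδ
  have hδ0 : ∀ n, 0 < δ n := fun n => by positivity
  set N : ℕ → ℝ := fun n => discountedSup 𝒜 (δ n) (e 0) + discountedSup 𝒜 (δ n) (e 1) with hN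
  have hen : ∀ i, ‖e i‖ = 1 := fun i => by simp [he]
  have hN0 : ∀ n, 0 < N n := fun n => by
    have h0 := hnorm (δ n) (hδ0 n) (e 0)
    have h1 := hnorm (δ n) (hδ0 n) (e 1)
    rw [hen] at h0 h1
    simp only [hN]; linarith
  set F : ℕ → Plane → ℝ := fun n x => discountedSup 𝒜 (δ n) x / N n with hF
  have hF0 : ∀ n x, 0 ≤ F n x := fun n x =>
    div_nonneg ((norm_nonneg x).trans (hnorm _ (hδ0 n) x)) (hN0 n).le
  have hFle : ∀ n x, F n x ≤ ‖x 0‖ + ‖x 1‖ := by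
    intro n x
    simp only [hF]
    rw [div_le_iff₀ (hN0 n)]
    conv_lhs => rw [hxe x]
    refine (hadd _ (hδ0 n) _ _).trans ((add_le_add (hsmul _ (hδ0 n) _ _)
      (hsmul _ (hδ0 n) _ _)).trans ?_)
    have h0 := (norm_nonneg _).trans (hnorm _ (hδ0 n) (e 0))
    have h1 := (norm_nonneg _).trans (hnorm _ (hδ0 n) (e 1))
    have h2 := norm_nonneg (x 0)
    have h3 := norm_nonneg (x 1)
    simp only [hN]
    nlinarith [mul_nonneg h2 h1, mul_nonneg h3 h0]
  let U : Ultrafilter ℕ := hyperfilter ℕ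
  have hlim : ∀ x, ∃ r, Tendsto (fun n => F n x) U (𝓝 r) := by
    intro x
    obtain ⟨r, -, hr⟩ := (isCompact_Icc (a := (0 : ℝ)) (b := ‖x 0‖ + ‖x 1‖)).ultrafilter_le_nhds
      (U.map fun n => F n x) (by
        rw [le_principal_iff]
        exact Filter.mem_map.2 (Eventually.of_forall fun n => ⟨hF0 n x, hFle n x⟩))
    exact ⟨r, hr⟩
  choose f hf using hlim
  have hUa : (U : Filter ℕ) ≤ atTop := by
    rw [← Nat.cofinite_eq_atTop]; exact hyperfilter_le_cofinite
  have hfadd : ∀ x y, f (x + y) ≤ f x + f y := fun x y =>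
    le_of_tendsto_of_tendsto' (hf (x + y)) ((hf x).add (hf y)) fun n => by
      simp only [hF]
      rw [← add_div]
      exact div_le_div_of_nonneg_right (hadd _ (hδ0 n) x y) (hN0 n).le
  have hfsmul : ∀ (c : ℝ) x, f (c • x) ≤ ‖c‖ * f x := fun c x =>
    le_of_tendsto_of_tendsto' (hf (c • x)) ((hf x).const_mul ‖c‖) fun n => by
      simp only [hF]
      rw [← mul_div_assoc]
      exact div_le_div_of_nonneg_right (hsmul _ (hδ0 n) c x) (hN0 n).le
  have hf0 : f 0 = 0 := by
    have h1 := hfsmul 0 0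
    have h2 : 0 ≤ f 0 := ge_of_tendsto' (hf 0) fun n => hF0 n 0
    simp only [smul_zero, norm_zero, zero_mul] at h1
    exact le_antisymm h1 h2
  let g : Seminorm ℝ Plane := Seminorm.ofSMulLE f hf0 hfadd hfsmul
  have hgf : ∀ x, g x = f x := fun x => rfl
  have hginv : ∀ A ∈ 𝒜, ∀ s, 0 ≤ s → ∀ x, g (flow A s x) ≤ g x := by
    intro A hA s hs x
    have h1 : Tendsto (fun n => Real.exp (δ n * s)) U (𝓝 1) := by
      have h2 : Tendsto (fun n => Real.exp (δ n * s)) atTop (𝓝 (Real.exp (0 * s))) :=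
        (Real.continuous_exp.tendsto _).comp (tendsto_one_div_add_atTop_nhds_zero_nat.mul_const s)
      rw [zero_mul, Real.exp_zero] at h2
      exact h2.mono_left hUa
    have h2 := h1.mul (hf x)
    rw [one_mul] at h2
    refine le_of_tendsto_of_tendsto' (hf _) h2 fun n => ?_
    simp only [hF]
    rw [← mul_div_assoc]
    exact div_le_div_of_nonneg_right (hflow _ (hδ0 n) A hA s hs x) (hN0 n).le
  have hsum : g (e 0) + g (e 1) = 1 := by
    refine tendsto_nhds_unique ((hf (e 0)).add (hf (e 1))) ?_
    refine tendsto_const_nhds.congr fun n => ?_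
    simp only [hF]
    rw [← add_div]
    exact (div_self (hN0 n).ne').symm
  refine ⟨g, ?_, hginv⟩
  let K : Submodule ℝ Plane :=
    { carrier := {x | g x = 0}
      add_mem' := by
        intro a b ha hb
        refine le_antisymm ((map_add_le_add g a b).trans ?_) (apply_nonneg g _)
        rw [mem_ofPred_eq] at ha hb
        rw [ha, hb, add_zero]
      zero_mem' := map_zero g
      smul_mem' := by
        intro c a ha
        rw [mem_ofPred_eq] at ha ⊢
        rw [map_smul_eq_mul, ha, mul_zero] }
  rcases hirr K (fun A hA v hv => act_mem_of_flow_mem hv fun s hs =>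
    le_antisymm ((hginv A hA s hs v).trans (le_of_eq hv)) (apply_nonneg g _)) with h | h
  · intro x hx
    have : x ∈ K := hx
    rwa [h, Submodule.mem_bot] at this
  · have h0 : g (e 0) = 0 := (h ▸ Submodule.mem_top : e 0 ∈ K)
    have h1 : g (e 1) = 0 := (h ▸ Submodule.mem_top : e 1 ∈ K)
    rw [h0, h1, add_zero] at hsum
    exact absurd hsum zero_ne_one

theorem Seminorm.exists_le_norm (f : Seminorm ℝ Plane) : ∃ K : NNReal, ∀ x, f x ≤ K * ‖x‖ := by
  set e : Fin 2 → Plane := fun i => EuclideanSpace.single i 1 with he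
  refine ⟨⟨f (e 0) + f (e 1), add_nonneg (apply_nonneg f _) (apply_nonneg f _)⟩, fun x => ?_⟩
  have hx : x = x 0 • e 0 + x 1 • e 1 := by ext i; fin_cases i <;> simp [he]
  have h0 : ‖x 0‖ ≤ ‖x‖ := PiLp.norm_apply_le x 0
  have h1 : ‖x 1‖ ≤ ‖x‖ := PiLp.norm_apply_le x 1
  have h2 := apply_nonneg f (e 0)
  have h3 := apply_nonneg f (e 1)
  calc f x = f (x 0 • e 0 + x 1 • e 1) := by rw [← hx]
    _ ≤ ‖x 0‖ * f (e 0) + ‖x 1‖ * f (e 1) := by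
      refine (map_add_le_add f _ _).trans ?_
      rw [map_smul_eq_mul, map_smul_eq_mul]
    _ ≤ ‖x‖ * f (e 0) + ‖x‖ * f (e 1) := by gcongr
    _ = (f (e 0) + f (e 1)) * ‖x‖ := by ring

theorem Seminorm.exists_lipschitzWith (f : Seminorm ℝ Plane) :
    ∃ K : NNReal, LipschitzWith K f := by
  obtain ⟨K, hK⟩ := Seminorm.exists_le_norm f
  refine ⟨K, LipschitzWith.of_dist_le_mul fun x y => ?_⟩
  rw [Real.dist_eq, dist_eq_norm]
  exact (abs_sub_map_le_sub f x y).trans (hK _)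

/-- The seminorm `f` does not increase to the first order in the direction `A x`. -/
def IsDissipative (f : Seminorm ℝ Plane) (A : Mat) : Prop :=
  ∀ x : Plane, ∀ ε : ℝ, 0 < ε → ∀ᶠ h : ℝ in 𝓝[>] 0, f (x + h • act A x) ≤ f x + ε * h

theorem eventually_seminorm_le_of_hasDerivAt (f : Seminorm ℝ Plane) {y : ℝ → Plane} {v : Plane}
    {t ε : ℝ} (hy : HasDerivAt y v t) (hε : 0 < ε) :
    ∀ᶠ h : ℝ in 𝓝[>] 0, f (y (t + h) - (y t + h • v)) ≤ ε * h := by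
  obtain ⟨K, hK⟩ := Seminorm.exists_le_norm f
  have h1 := (hasDerivAt_iff_isLittleO_nhds_zero.1 hy).def
    (show 0 < ε / (K + 1) by positivity)
  filter_upwards [h1.filter_mono nhdsWithin_le_nhds, self_mem_nhdsWithin] with h hh hpos
  have hp : 0 < h := hpos
  rw [Real.norm_of_nonneg hp.le] at hh
  refine (hK _).trans ?_
  rw [← sub_sub]
  calc (K : ℝ) * ‖y (t + h) - y t - h • v‖ ≤ K * (ε / (K + 1) * h) := by gcongr
    _ = K / (K + 1) * (ε * h) := by ring
    _ ≤ 1 * (ε * h) := by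
      gcongr
      rw [div_le_one (by positivity)]
      linarith
    _ = ε * h := one_mul _

theorem isDissipative_of_flow {f : Seminorm ℝ Plane} {A : Mat}
    (h : ∀ s, 0 ≤ s → ∀ x, f (flow A s x) ≤ f x) : IsDissipative f A := by
  intro x ε hε
  have h1 := eventually_seminorm_le_of_hasDerivAt f (hasDerivAt_flow A x 0) hε
  filter_upwards [h1, self_mem_nhdsWithin] with s hs hpos
  simp only [zero_add, flow_zero, one_apply_eq_self] at hs
  have h2 : f (x + s • act A x) ≤ f (flow A s x) + f (flow A s x - (x + s • act A x)) := by
    have := map_sub_le_add f (flow A s x) (flow A s x - (x + s • act A x))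
    rwa [sub_sub_cancel] at this
  linarith [h s (le_of_lt hpos) x]

/-- The purpose of the first-order form of decay: by the triangle inequality it passes to convex
combinations, hence from 𝒜 to co(𝒜). -/
theorem convex_isDissipative (f : Seminorm ℝ Plane) : Convex ℝ {A | IsDissipative f A} := by
  intro A hA B hB a b ha hb hab x ε hε
  filter_upwards [hA x ε hε, hB x ε hε] with h h1 h2
  have : x + h • act (a • A + b • B) x = a • (x + h • act A x) + b • (x + h • act B x) := by
    rw [act_add_left, act_smul_left, act_smul_left]
    generalize act A x = u
    generalize act B x = v
    have h3 : b = 1 - a := by linarith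
    rw [h3]
    module
  rw [this]
  refine (map_add_le_add f _ _).trans ?_
  rw [map_smul_eq_mul, map_smul_eq_mul, Real.norm_of_nonneg ha, Real.norm_of_nonneg hb]
  calc a * f (x + h • act A x) + b * f (x + h • act B x)
      ≤ a * (f x + ε * h) + b * (f x + ε * h) := by gcongr
    _ = (a + b) * (f x + ε * h) := by ring
    _ = f x + ε * h := by rw [hab, one_mul]

theorem seminorm_le_of_isDissipative {f : Seminorm ℝ Plane} {y : ℝ → Plane} {A : ℝ → Mat}
    (hy : LocallyLipschitz y) {a b : ℝ} (hab : a ≤ b)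
    (h : ∀ᵐ t, t ∈ Icc a b → HasDerivAt y (act (A t) (y t)) t ∧ IsDissipative f (A t)) :
    f (y b) ≤ f (y a) := by
  obtain ⟨K, hK⟩ := Seminorm.exists_lipschitzWith f
  refine le_of_ae_deriv_nonpos (φ := fun t => f (y t)) (hK.locallyLipschitz.comp hy) hab ?_
  filter_upwards [h] with t ht hm d hd
  obtain ⟨h1, h2⟩ := ht hm
  refine le_of_forall_pos_le_add fun ε hε => ?_
  rw [zero_add]
  refine le_of_tendsto hd.tendsto_slope_zero_right ?_
  filter_upwards [eventually_seminorm_le_of_hasDerivAt f h1 (half_pos hε),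
    h2 (y t) (ε / 2) (half_pos hε), self_mem_nhdsWithin] with s hs hs2 hpos
  have hp : 0 < s := hpos
  have h3 : f (y (t + s)) ≤ f (y t + s • act (A t) (y t)) +
      f (y (t + s) - (y t + s • act (A t) (y t))) := by
    have := map_add_le_add f (y t + s • act (A t) (y t)) (y (t + s) - (y t + s • act (A t) (y t)))
    rwa [add_sub_cancel] at this
  rw [smul_eq_mul, ← div_eq_inv_mul, div_le_iff₀ hp]
  linarith

theorem seminorm_trajectory_le {f : Seminorm ℝ Plane} {ℬ : Set Mat} {M : ℝ}
    (hM : ∀ A ∈ ℬ, ∀ x, ‖act A x‖ ≤ M * ‖x‖) (hf : ∀ A ∈ ℬ, IsDissipative f A)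
    {x : ℝ → Plane} (hx : IsTrajectory ℬ x) {t : ℝ} (ht : 0 ≤ t) : f (x t) ≤ f (x 0) := by
  obtain ⟨A, hA, hs⟩ := hx
  obtain ⟨hl, hd⟩ := hs.locallyLipschitz isTimeRetraction_Ici fun t ht => hM _ (hA t ht)
  have := seminorm_le_of_isDissipative (f := f) (A := A) hl ht (by
    filter_upwards [hd] with s hs' hm
    refine ⟨?_, hf _ (hA s hm.1)⟩
    have := hs' hm.1
    rwa [Function.comp_apply, max_eq_left hm.1])
  simpa [max_eq_left ht] using this

end ExtremalNorm

/-! ### Polar velocities of planar matrices; determinant, trace and dominance. -/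

section PlanarMatrices

/-- The coefficient of `z` in the action of a real matrix on the complex plane. -/
noncomputable def linCoeff (A : Mat) : ℂ := ⟨(A 0 0 + A 1 1) / 2, (A 1 0 - A 0 1) / 2⟩

/-- The coefficient of `conj z` in the action of a real matrix on the complex plane. -/
noncomputable def conjCoeff (A : Mat) : ℂ := ⟨(A 0 0 - A 1 1) / 2, (A 1 0 + A 0 1) / 2⟩

theorem toC_act (A : Mat) (x : Plane) :
    toC (act A x) = linCoeff A * toC x + conjCoeff A * (starRingEnd ℂ) (toC x) := by
  simp only [toC_apply, act_apply, linCoeff, conjCoeff]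
  apply Complex.ext <;> simp <;> ring

/-- The velocity `A x / x` at a point `x` of argument `θ`. -/
noncomputable def polarVelocity (A : Mat) (θ : ℝ) : ℂ :=
  linCoeff A + conjCoeff A * Complex.exp (-(2 * θ) * Complex.I)

/-- Division of az + b conj z by z leaves a + b exp(-2iθ), so the velocity of log x does not depend
on |x|. -/
theorem toC_act_exp (A : Mat) (ζ : ℂ) :
    toC (act A (toC.symm (Complex.exp ζ))) = Complex.exp ζ * polarVelocity A ζ.im := by
  rw [toC_act, ContinuousLinearEquiv.apply_symm_apply, ← Complex.exp_conj]
  have : (starRingEnd ℂ) ζ = ζ + -(2 * ζ.im) * Complex.I := by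
    apply Complex.ext <;> simp; ring
  rw [this, Complex.exp_add, polarVelocity]
  ring

theorem polarVelocity_re (A : Mat) (θ : ℝ) : (polarVelocity A θ).re =
    (A 0 0 + A 1 1) / 2 + (A 0 0 - A 1 1) / 2 * Real.cos (2 * θ) +
      (A 1 0 + A 0 1) / 2 * Real.sin (2 * θ) := by
  have : -(2 * (θ : ℂ)) * Complex.I = ((-(2 * θ) : ℝ) : ℂ) * Complex.I := by push_cast; ring
  rw [polarVelocity, this, Complex.add_re, Complex.mul_re, Complex.exp_ofReal_mul_I_re,
    Complex.exp_ofReal_mul_I_im, Real.cos_neg, Real.sin_neg]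
  simp only [linCoeff, conjCoeff]
  ring

theorem polarVelocity_im (A : Mat) (θ : ℝ) : (polarVelocity A θ).im =
    (A 1 0 - A 0 1) / 2 + (A 1 0 + A 0 1) / 2 * Real.cos (2 * θ) -
      (A 0 0 - A 1 1) / 2 * Real.sin (2 * θ) := by
  have : -(2 * (θ : ℂ)) * Complex.I = ((-(2 * θ) : ℝ) : ℂ) * Complex.I := by push_cast; ring
  rw [polarVelocity, this, Complex.add_im, Complex.mul_im, Complex.exp_ofReal_mul_I_re,
    Complex.exp_ofReal_mul_I_im, Real.cos_neg, Real.sin_neg]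
  simp only [linCoeff, conjCoeff]
  ring

theorem continuous_entry (i j : Fin 2) : Continuous fun A : Mat => A i j :=
  continuous_apply_apply i j

theorem continuous_polarVelocity : Continuous fun p : Mat × ℝ => polarVelocity p.1 p.2 := by
  have hmk : ∀ {f g : Mat × ℝ → ℝ}, Continuous f → Continuous g →
      Continuous fun p => (⟨f p, g p⟩ : ℂ) := fun hf hg =>
    (Complex.equivRealProdCLM.symm.continuous).comp (hf.prodMk hg)
  have he : ∀ i j, Continuous fun p : Mat × ℝ => p.1 i j := fun i j =>
    (continuous_entry i j).comp continuous_fst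
  unfold polarVelocity linCoeff conjCoeff
  refine (hmk ?_ ?_).add ((hmk ?_ ?_).mul ?_)
  · exact ((he 0 0).add (he 1 1)).div_const 2
  · exact ((he 1 0).sub (he 0 1)).div_const 2
  · exact ((he 0 0).sub (he 1 1)).div_const 2
  · exact ((he 1 0).add (he 0 1)).div_const 2
  · fun_prop

theorem norm_polarVelocity_sub_le (A : Mat) (θ θ' : ℝ) :
    ‖polarVelocity A θ - polarVelocity A θ'‖ ≤ ‖conjCoeff A‖ * 2 * |θ - θ'| := by
  have h1 : polarVelocity A θ - polarVelocity A θ' = conjCoeff A *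
      (Complex.exp (-(2 * θ') * Complex.I) *
        (Complex.exp (Complex.I * ((2 * (θ' - θ) : ℝ) : ℂ)) - 1)) := by
    rw [mul_sub, ← Complex.exp_add, mul_one, polarVelocity, polarVelocity]
    rw [show -(2 * (θ' : ℂ)) * Complex.I + Complex.I * ((2 * (θ' - θ) : ℝ) : ℂ) =
      -(2 * θ) * Complex.I by push_cast; ring]
    ring
  have h2 : ‖Complex.exp (-(2 * (θ' : ℂ)) * Complex.I)‖ = 1 := by
    rw [show -(2 * (θ' : ℂ)) * Complex.I = ((-(2 * θ') : ℝ) : ℂ) * Complex.I by push_cast; ring]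
    exact Complex.norm_exp_ofReal_mul_I _
  rw [h1, norm_mul, norm_mul, h2, one_mul, mul_assoc]
  gcongr
  refine (Real.norm_exp_I_mul_ofReal_sub_one_le).trans (le_of_eq ?_)
  rw [Real.norm_eq_abs, abs_mul, abs_two, abs_sub_comm]

variable {𝒜 : Set Mat}

/-- The velocities of the matrices of `𝒜`. -/
noncomputable def velocities (𝒜 : Set Mat) (a : 𝒜) (θ : ℝ) : ℂ := polarVelocity a θ

theorem polarSystem_velocities (hcompact : IsCompact 𝒜)
    (hf : ∀ A ∈ 𝒜, ∀ θ, (polarVelocity A θ).im = 0 → (polarVelocity A θ).re < 0) :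
    PolarSystem (velocities 𝒜) where
  continuous := continuous_polarVelocity.comp
    (by fun_prop : Continuous fun p : 𝒜 × ℝ => ((p.1 : Mat), p.2))
  periodic a θ := by
    rw [velocities, velocities, polarVelocity, polarVelocity, show
      -(2 * ((θ + Real.pi : ℝ) : ℂ)) * Complex.I =
        -(2 * θ) * Complex.I - 2 * Real.pi * Complex.I by push_cast; ring,
      Complex.exp_sub, Complex.exp_two_pi_mul_I, div_one]
  feasible a θ := hf a a.2 θ
  lipschitz := by
    have hc : Continuous fun A : Mat => conjCoeff A := by
      unfold conjCoeff
      exact (Complex.equivRealProdCLM.symm.continuous).comp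
        ((((continuous_entry 0 0).sub (continuous_entry 1 1)).div_const 2).prodMk
        (((continuous_entry 1 0).add (continuous_entry 0 1)).div_const 2))
    obtain ⟨C, hC⟩ := hcompact.exists_bound_of_continuousOn hc.continuousOn
    refine ⟨max C 1 * 2, by positivity, fun a θ θ' => ?_⟩
    refine (norm_polarVelocity_sub_le a θ θ').trans ?_
    gcongr
    exact (hC a a.2).trans (le_max_left _ _)

theorem det_eq (A : Mat) : A.det = A 0 0 * A 1 1 - A 0 1 * A 1 0 := Matrix.det_fin_two A

theorem exists_act_eq_smul {A : Mat} {c : ℝ}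
    (h : (A 0 0 - c) * (A 1 1 - c) - A 0 1 * A 1 0 = 0) :
    ∃ x : Plane, x ≠ 0 ∧ act A x = c • x := by
  have hd : (A - c • (1 : Mat)).det = 0 := by
    rw [det_eq]; simpa using h
  obtain ⟨v, hv, he⟩ := Matrix.exists_mulVec_eq_zero_iff.2 hd
  refine ⟨WithLp.toLp 2 v, fun h0 => hv ?_, ?_⟩
  · exact congrArg WithLp.ofLp h0
  · have h0 := congrFun he 0
    have h1 := congrFun he 1
    simp [Matrix.mulVec, dotProduct] at h0 h1
    ext i
    rw [act_apply]
    fin_cases i <;> simp <;> linarith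

theorem IsDissipative.eigenvalue_nonpos {f : Seminorm ℝ Plane} (hf : ∀ x, f x = 0 → x = 0)
    {A : Mat} (h : IsDissipative f A) {c : ℝ} {x : Plane} (hx : x ≠ 0) (he : act A x = c • x) :
    c ≤ 0 := by
  by_contra! hc
  have hfx : 0 < f x := lt_of_le_of_ne (apply_nonneg f x) fun h0 => hx (hf x h0.symm)
  obtain ⟨s, hs, hpos⟩ := ((h x (c * f x / 2) (by positivity)).and self_mem_nhdsWithin).exists
  have hp : 0 < s := hpos
  rw [he, show x + s • c • x = (1 + s * c) • x by rw [add_smul, one_smul, mul_smul],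
    map_smul_eq_mul, Real.norm_of_nonneg (by positivity)] at hs
  have : 0 < s * (c * f x) := by positivity
  nlinarith

theorem IsDissipative.det_nonneg {f : Seminorm ℝ Plane} (hf : ∀ x, f x = 0 → x = 0)
    {A : Mat} (h : IsDissipative f A) : 0 ≤ A.det := by
  by_contra! hd
  rw [det_eq] at hd
  set D := (A 0 0 + A 1 1) ^ 2 - 4 * (A 0 0 * A 1 1 - A 0 1 * A 1 0) with hD
  have hD0 : 0 ≤ D := by rw [hD]; nlinarith [sq_nonneg (A 0 0 + A 1 1)]
  have hs := Real.sq_sqrt hD0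
  obtain ⟨x, hx, he⟩ := exists_act_eq_smul (A := A)
    (c := ((A 0 0 + A 1 1) + Real.sqrt D) / 2) (by nlinarith)
  have h1 := h.eigenvalue_nonpos hf hx he
  have h2 : Real.sqrt D ^ 2 ≤ (A 0 0 + A 1 1) ^ 2 := by
    have := Real.sqrt_nonneg D
    nlinarith
  linarith

/-- Real eigenvalues with positive sum include a positive one. For non-real ones f² is compared with
a definite quadratic form q, which x ↦ x + sAx multiplies by det(1 + sA) = 1 + s tr A + s² det A. At
a minimizer of f²/q the function f² must grow at least as fast, against dissipativity. -/
theorem IsDissipative.trace_nonpos {f : Seminorm ℝ Plane} (hf : ∀ x, f x = 0 → x = 0)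
    {A : Mat} (h : IsDissipative f A) : A 0 0 + A 1 1 ≤ 0 := by
  by_contra! ht
  have hdet := h.det_nonneg hf
  rw [det_eq] at hdet
  rcases le_or_gt 0 ((A 0 0 + A 1 1) ^ 2 - 4 * (A 0 0 * A 1 1 - A 0 1 * A 1 0)) with hD0 | hD0
  · set D := (A 0 0 + A 1 1) ^ 2 - 4 * (A 0 0 * A 1 1 - A 0 1 * A 1 0) with hD
    have hs := Real.sq_sqrt hD0
    obtain ⟨x, hx, he⟩ := exists_act_eq_smul (A := A)
      (c := ((A 0 0 + A 1 1) + Real.sqrt D) / 2) (by nlinarith)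
    have h1 := h.eigenvalue_nonpos hf hx he
    linarith [Real.sqrt_nonneg D]
  · -- the quadratic form `x ∧ A x` is definite and grows at the rate `tr A`
    let q : Plane → ℝ := fun x => |x 0 * act A x 1 - x 1 * act A x 0|
    have hqc : Continuous q := by
      have h0 : ∀ i, Continuous fun x : Plane => x i := fun i => (EuclideanSpace.proj i).continuous
      have h1 : ∀ i, Continuous fun x : Plane => act A x i := fun i =>
        (h0 i).comp (toOp A).continuous
      exact (((h0 0).mul (h1 1)).sub ((h0 1).mul (h1 0))).abs
    have hq0 : ∀ x, x ≠ 0 → 0 < q x := by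
      intro x hx
      refine abs_pos.2 fun h0 => hx ?_
      rw [act_apply, act_apply] at h0
      have hA : A 1 0 ≠ 0 := by
        intro hz
        rw [hz] at hD0
        nlinarith [sq_nonneg (A 0 0 - A 1 1)]
      have h3 : (2 * A 1 0 * x 0 + (A 1 1 - A 0 0) * x 1) ^ 2 +
          (4 * (A 0 0 * A 1 1 - A 0 1 * A 1 0) - (A 0 0 + A 1 1) ^ 2) * x 1 ^ 2 = 0 := by
        linear_combination 4 * A 1 0 * h0
      have hx1 : x 1 = 0 := by
        by_contra hne
        have : 0 < x 1 ^ 2 := by positivity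
        nlinarith [sq_nonneg (2 * A 1 0 * x 0 + (A 1 1 - A 0 0) * x 1)]
      have hx0 : x 0 = 0 := by
        rw [hx1] at h3
        have : (2 * A 1 0 * x 0) ^ 2 = 0 := by linarith
        simpa [hA] using this
      ext i; fin_cases i <;> simpa
    obtain ⟨K, hK⟩ := Seminorm.exists_lipschitzWith f
    have hfpos : ∀ x, x ≠ 0 → 0 < f x := fun x hx =>
      lt_of_le_of_ne (apply_nonneg f x) fun h0 => hx (hf x h0.symm)
    have hsph : ∀ x ∈ Metric.sphere (0 : Plane) 1, x ≠ 0 := fun x hx =>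
      ne_zero_of_mem_unit_sphere ⟨x, hx⟩
    obtain ⟨p, hp, hmin⟩ := (isCompact_sphere (0 : Plane) 1).exists_isMinOn
      (NormedSpace.sphere_nonempty.2 zero_le_one) (f := fun x => f x ^ 2 / q x)
      ((hK.continuous.pow 2).continuousOn.div hqc.continuousOn fun x hx => (hq0 x (hsph x hx)).ne')
    have hp0 := hsph p hp
    have hle : ∀ x, f p ^ 2 / q p * q x ≤ f x ^ 2 := by
      intro x
      by_cases hx : x = 0
      · simp [hx, q, act_zero_right]
      have hn : 0 < ‖x‖ := norm_pos_iff.2 hx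
      have h1 : f p ^ 2 / q p ≤ f (‖x‖⁻¹ • x) ^ 2 / q (‖x‖⁻¹ • x) :=
        hmin (by simp [norm_smul, hn.ne'])
      have h2 : f (‖x‖⁻¹ • x) ^ 2 / q (‖x‖⁻¹ • x) = f x ^ 2 / q x := by
        have : q (‖x‖⁻¹ • x) = (‖x‖⁻¹) ^ 2 * q x := by
          simp only [q, act_smul_right, PiLp.smul_apply, smul_eq_mul]
          rw [← abs_of_nonneg (sq_nonneg (‖x‖⁻¹)), ← abs_mul]
          congr 1; ring
        rw [this, map_smul_eq_mul, Real.norm_of_nonneg (by positivity), mul_pow,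
          mul_div_mul_left _ _ (by positivity)]
      rw [h2] at h1
      exact (le_div_iff₀ (hq0 x hx)).1 h1
    set τ := A 0 0 + A 1 1 with hτ
    have hfp := hfpos p hp0
    have hqp := hq0 p hp0
    -- For s > 0, (1 + τs/4)² < 1 + τs amounts to τs < 8.
    have hsmall : ∀ᶠ s : ℝ in 𝓝[>] 0, s < 8 / τ :=
      (eventually_lt_nhds (by positivity)).filter_mono nhdsWithin_le_nhds
    obtain ⟨s, ⟨hs, hpos⟩, hs8⟩ := (((h p (f p * τ / 4) (by positivity)).and
      self_mem_nhdsWithin).and hsmall).exists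
    have hsp : 0 < s := hpos
    have hqs : q (p + s • act A p) =
        (1 + τ * s + (A 0 0 * A 1 1 - A 0 1 * A 1 0) * s ^ 2) * q p := by
      simp only [q]
      rw [← abs_of_nonneg (show 0 ≤ 1 + τ * s + (A 0 0 * A 1 1 - A 0 1 * A 1 0) * s ^ 2 by
        positivity), ← abs_mul]
      congr 1
      simp only [act_apply, PiLp.add_apply, PiLp.smul_apply, smul_eq_mul]
      rw [hτ]; ring
    have h1 := hle (p + s • act A p)
    rw [hqs, mul_comm, mul_assoc, mul_div_cancel₀ _ hqp.ne'] at h1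
    have h2 : f (p + s • act A p) ^ 2 ≤ (f p + f p * τ / 4 * s) ^ 2 := by
      have := apply_nonneg f (p + s • act A p)
      gcongr
    rw [lt_div_iff₀ ht] at hs8
    have h3 : f p ^ 2 * (1 + τ * s + (A 0 0 * A 1 1 - A 0 1 * A 1 0) * s ^ 2) ≤
        f p ^ 2 * (1 + τ / 4 * s) ^ 2 := by linarith [h1.trans h2]
    have h4 := le_of_mul_le_mul_left h3 (by positivity)
    have h5 : 0 ≤ (A 0 0 * A 1 1 - A 0 1 * A 1 0) * s ^ 2 := by positivity
    have h6 : 0 < τ * s := by positivity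
    nlinarith

theorem act_toC_symm_exp_of_im_eq_zero {A : Mat} {θ : ℝ} (h : (polarVelocity A θ).im = 0) :
    act A (toC.symm (Complex.exp (θ * Complex.I))) =
      (polarVelocity A θ).re • toC.symm (Complex.exp (θ * Complex.I)) := by
  apply toC.injective
  rw [toC_act_exp, map_smul, ContinuousLinearEquiv.apply_symm_apply]
  have h1 : (θ * Complex.I).im = θ := by simp
  have h2 : polarVelocity A θ = ((polarVelocity A θ).re : ℂ) := by
    apply Complex.ext <;> simp [h]
  rw [h1, mul_comm]
  conv_lhs => rw [h2]
  rw [Complex.real_smul]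

theorem toC_symm_exp_ne_zero (ζ : ℂ) : toC.symm (Complex.exp ζ) ≠ 0 := by
  rw [Ne, ContinuousLinearEquiv.map_eq_zero_iff]
  exact Complex.exp_ne_zero ζ

theorem det_eq_zero_of_act_eq_zero {A : Mat} {x : Plane} (hx : x ≠ 0) (h : act A x = 0) :
    A.det = 0 := by
  refine Matrix.exists_mulVec_eq_zero_iff.1 ⟨x.ofLp, fun h0 => hx ?_, ?_⟩
  · ext i; exact congrFun h0 i
  · exact congrArg WithLp.ofLp h

theorem IsDissipative.polarVelocity_re_neg {f : Seminorm ℝ Plane} (hf : ∀ x, f x = 0 → x = 0)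
    {A : Mat} (h : IsDissipative f A) (hdet : A.det ≠ 0) {θ : ℝ}
    (him : (polarVelocity A θ).im = 0) : (polarVelocity A θ).re < 0 := by
  have he := act_toC_symm_exp_of_im_eq_zero him
  have hx := toC_symm_exp_ne_zero (θ * Complex.I)
  refine lt_of_le_of_ne (h.eigenvalue_nonpos hf hx he) fun h0 => hdet ?_
  rw [h0, zero_smul] at he
  exact det_eq_zero_of_act_eq_zero hx he

theorem mem_eigenvalues (A : Mat) (μ : ℂ) : μ ∈ eigenvalues A ↔
    μ ^ 2 - (A 0 0 + A 1 1 : ℝ) * μ + (A.det : ℝ) = 0 := by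
  rw [eigenvalues, spectrum.mem_iff, Matrix.isUnit_iff_isUnit_det, isUnit_iff_ne_zero, not_not,
    Matrix.det_fin_two, det_eq]
  simp only [Matrix.algebraMap_eq_diagonal, Matrix.sub_apply, Matrix.diagonal_apply,
    Matrix.map_apply, Pi.algebraMap_apply]
  simp
  constructor <;> intro h <;> linear_combination h

/-- The eigenvalues are 0 and the trace. -/
theorem hasRealDominance_of_det_eq_zero (hσ : lyapunovExponent 𝒜 = 0) {A : Mat}
    (hA : A ∈ convexHull ℝ 𝒜) (h0 : A ≠ 0) (hdet : A.det = 0) (htr : A 0 0 + A 1 1 ≤ 0) :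
    HasRealDominance 𝒜 := by
  have key : ∀ μ ∈ eigenvalues A, μ.im = 0 ∧ μ.re ≤ 0 := by
    intro μ hμ
    rw [mem_eigenvalues, hdet] at hμ
    have : μ * (μ - (A 0 0 + A 1 1 : ℝ)) = 0 := by
      rw [← hμ]; push_cast; ring
    rcases mul_eq_zero.1 this with h | h
    · simp [h]
    · rw [sub_eq_zero] at h
      rw [h]
      exact ⟨Complex.ofReal_im _, by rwa [Complex.ofReal_re]⟩
  refine ⟨A, ⟨hA, by rwa [hσ, zero_smul], ?_⟩, fun μ hμ => (key μ hμ).1⟩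
  rw [hσ]
  refine ⟨⟨0, ?_, by simp⟩, ?_⟩
  · rw [mem_eigenvalues, hdet]; simp
  · rintro _ ⟨μ, hμ, rfl⟩
    exact (key μ hμ).2

theorem HasRealDominance.exists_det_eq_zero (hσ : lyapunovExponent 𝒜 = 0)
    (h : HasRealDominance 𝒜) : ∃ A ∈ convexHull ℝ 𝒜, A.det = 0 ∧ A ≠ 0 := by
  obtain ⟨A, ⟨hA, h0, ⟨μ, hμ, hre⟩, -⟩, him⟩ := h
  rw [hσ, zero_smul] at h0
  refine ⟨A, hA, ?_, h0⟩
  have : μ = 0 := Complex.ext (hre.trans hσ) (him μ hμ)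
  rw [mem_eigenvalues, this] at hμ
  simpa using hμ

theorem hasComplexDominance_of_trace_eq_zero (hσ : lyapunovExponent 𝒜 = 0) {A : Mat}
    (hA : A ∈ convexHull ℝ 𝒜) (hdet : 0 < A.det) (htr : A 0 0 + A 1 1 = 0) :
    HasComplexDominance 𝒜 := by
  have key : ∀ μ ∈ eigenvalues A, μ.re = 0 := by
    intro μ hμ
    rw [mem_eigenvalues, htr] at hμ
    have hr := congrArg Complex.re hμ
    have hi := congrArg Complex.im hμ
    simp [pow_two] at hr hi
    by_contra hne
    have : μ.im = 0 := by
      have : μ.re * μ.im = 0 := by linarith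
      exact (mul_eq_zero.1 this).resolve_left hne
    rw [this] at hr
    nlinarith [sq_nonneg μ.re]
  have hmem : (⟨0, Real.sqrt A.det⟩ : ℂ) ∈ eigenvalues A := by
    rw [mem_eigenvalues, htr]
    have hs := Real.mul_self_sqrt hdet.le
    apply Complex.ext
    · simp [pow_two, hs]
    · simp [pow_two]
  refine ⟨A, ⟨hA, ?_, ?_⟩, fun hc => ?_⟩
  · rw [hσ, zero_smul]
    rintro rfl
    simp at hdet
  · rw [hσ]
    refine ⟨⟨_, hmem, rfl⟩, ?_⟩
    rintro _ ⟨μ, hμ, rfl⟩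
    exact (key μ hμ).le
  · exact (Real.sqrt_pos.2 hdet).ne' (hc _ hmem)

end PlanarMatrices

/-! ### Oriented angles and lengths in terms of slopes. -/

section Angles

theorem arg_mem_Ioo_iff (z : ℂ) : z.arg ∈ Ioo 0 Real.pi ↔ 0 < z.im := by
  have him : ‖z‖ * Real.sin z.arg = z.im := Complex.norm_mul_sin_arg z
  constructor
  · rintro ⟨h1, h2⟩
    have hz : z ≠ 0 := by rintro rfl; simp at h1
    rw [← him]
    exact mul_pos (norm_pos_iff.2 hz) (Real.sin_pos_of_pos_of_lt_pi h1 h2)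
  · intro h
    refine ⟨lt_of_le_of_ne (Complex.arg_nonneg_iff.2 h.le) fun h0 => ?_,
      lt_of_le_of_ne (Complex.arg_le_pi z) fun h0 => ?_⟩
    · rw [← h0, Real.sin_zero, mul_zero] at him; linarith
    · rw [h0, Real.sin_pi, mul_zero] at him; linarith

/-- In the upper half-plane re/im is the cotangent of the argument, so the smallest angle is the
largest slope. The sign of the sine of the difference of the arguments decides both comparisons. -/
theorem arg_le_arg_iff {z w : ℂ} (hz : 0 < z.im) (hw : 0 < w.im) :
    z.arg ≤ w.arg ↔ w.re / w.im ≤ z.re / z.im := by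
  have hz' := (arg_mem_Ioo_iff z).2 hz
  have hw' := (arg_mem_Ioo_iff w).2 hw
  have hz0 : 0 < ‖z‖ := norm_pos_iff.2 (by rintro rfl; simp at hz)
  have hw0 : 0 < ‖w‖ := norm_pos_iff.2 (by rintro rfl; simp at hw)
  have key : z.re * w.im - w.re * z.im = ‖z‖ * ‖w‖ * Real.sin (w.arg - z.arg) := by
    rw [Real.sin_sub, ← Complex.norm_mul_cos_arg z, ← Complex.norm_mul_sin_arg z,
      ← Complex.norm_mul_cos_arg w, ← Complex.norm_mul_sin_arg w]
    ring
  have hzw : 0 < ‖z‖ * ‖w‖ := mul_pos hz0 hw0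
  rw [div_le_div_iff₀ hw hz]
  constructor
  · intro h
    have := Real.sin_nonneg_of_nonneg_of_le_pi (sub_nonneg.2 h) (by linarith [hz'.1, hw'.2])
    have := mul_nonneg hzw.le this
    linarith
  · intro h
    by_contra! hlt
    have := Real.sin_neg_of_neg_of_neg_pi_lt (sub_neg.2 hlt) (by linarith [hw'.1, hz'.2])
    have := mul_neg_of_pos_of_neg hzw this
    linarith

theorem norm_le_norm_iff_of_slope_eq {z w : ℂ} (hz : 0 < z.im) (hw : 0 < w.im)
    (h : w.re / w.im = z.re / z.im) : ‖w‖ ≤ ‖z‖ ↔ w.im ≤ z.im := by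
  have key : ∀ u : ℂ, 0 < u.im → ‖u‖ = u.im * ‖((u.re / u.im : ℝ) : ℂ) + Complex.I‖ := by
    intro u hu
    conv_lhs => rw [show u = (u.im : ℂ) * (((u.re / u.im : ℝ) : ℂ) + Complex.I) by
      apply Complex.ext <;> simp; field_simp]
    rw [norm_mul, Complex.norm_real, Real.norm_of_nonneg hu.le]
  rw [key z hz, key w hw, h]
  have hpos : 0 < ‖((z.re / z.im : ℝ) : ℂ) + Complex.I‖ := by
    refine norm_pos_iff.2 fun h0 => ?_
    have := congrArg Complex.im h0
    simp at this
  exact mul_le_mul_iff_left₀ hpos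

theorem isLead_iff_arg {X : Type*} {Ψ : X → ℝ → ℂ} {θ : ℝ} {a : X} : IsLead Ψ θ a ↔
    (Ψ a θ).arg ∈ Ioo 0 Real.pi ∧ ∀ b, (Ψ b θ).arg ∈ Ioo 0 Real.pi →
      (Ψ a θ).arg ≤ (Ψ b θ).arg ∧ ((Ψ b θ).arg = (Ψ a θ).arg → ‖Ψ b θ‖ ≤ ‖Ψ a θ‖) := by
  simp only [arg_mem_Ioo_iff, IsLead]
  refine and_congr_right fun ha => forall_congr' fun b => forall_congr' fun hb => ?_
  rw [arg_le_arg_iff ha hb]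
  refine and_congr_right fun hle => ?_
  have heq : (Ψ b θ).arg = (Ψ a θ).arg ↔
      (Ψ b θ).re / (Ψ b θ).im = (Ψ a θ).re / (Ψ a θ).im := by
    rw [le_antisymm_iff, arg_le_arg_iff ha hb, arg_le_arg_iff hb ha, and_comm, le_antisymm_iff]
  rw [heq]
  exact forall_congr' fun he => (norm_le_norm_iff_of_slope_eq ha hb he).symm

theorem orientedAngle_act (A : Mat) (ζ : ℂ) :
    orientedAngle (toC.symm (Complex.exp ζ)) (act A (toC.symm (Complex.exp ζ))) =
      (polarVelocity A ζ.im).arg := by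
  have h : ∀ x y : Plane, orientedAngle x y = ((starRingEnd ℂ) (toC x) * toC y).arg := by
    intro x y
    rw [orientedAngle, toC_apply, toC_apply]
    congr 1
    apply Complex.ext <;> simp; ring
  rw [h, toC_act_exp, ContinuousLinearEquiv.apply_symm_apply, ← mul_assoc,
    ← Complex.normSq_eq_conj_mul_self]
  exact Complex.arg_real_mul _ (Complex.normSq_pos.2 (Complex.exp_ne_zero ζ))

theorem norm_act_exp (A : Mat) (ζ : ℂ) :
    ‖act A (toC.symm (Complex.exp ζ))‖ = ‖Complex.exp ζ‖ * ‖polarVelocity A ζ.im‖ := by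
  rw [← norm_toC, toC_act_exp, norm_mul]

variable {𝒜 : Set Mat}

theorem isLeadingLeft_iff (ζ : ℂ) (hf : IsFeasible 𝒜 (toC.symm (Complex.exp ζ))) (A : Mat) :
    IsLeadingLeft 𝒜 (toC.symm (Complex.exp ζ)) A ↔
      ∃ h : A ∈ 𝒜, IsLead (velocities 𝒜) ζ.im ⟨A, h⟩ := by
  have hpos : 0 < ‖Complex.exp ζ‖ := norm_pos_iff.2 (Complex.exp_ne_zero ζ)
  simp only [IsLeadingLeft, isLead_iff_arg, orientedAngle_act, norm_act_exp, velocities,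
    Subtype.forall, hf, true_and, mul_le_mul_iff_right₀ hpos]
  exact ⟨fun ⟨h1, h2⟩ => ⟨h1, h2⟩, fun ⟨h1, h2⟩ => ⟨h1, h2⟩⟩

theorem arg_conj_mem_Ioo_iff (z : ℂ) :
    z.arg ∈ Ioo (-Real.pi) 0 ↔ ((starRingEnd ℂ) z).arg ∈ Ioo 0 Real.pi := by
  rw [arg_mem_Ioo_iff, Complex.conj_im, neg_pos, ← Complex.arg_neg_iff]
  exact ⟨fun h => h.2, fun h => ⟨Complex.neg_pi_lt_arg z, h⟩⟩

theorem arg_conj_of_mem {z : ℂ} (h : z.arg ∈ Ioo (-Real.pi) 0) :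
    ((starRingEnd ℂ) z).arg = -z.arg := by
  rw [Complex.arg_conj, if_neg (h.2.trans Real.pi_pos).ne]

theorem isLeadingRight_iff (ζ : ℂ)
    (hf : IsFeasible 𝒜 (toC.symm ((starRingEnd ℂ) (Complex.exp ζ)))) (A : Mat) :
    IsLeadingRight 𝒜 (toC.symm ((starRingEnd ℂ) (Complex.exp ζ))) A ↔
      ∃ h : A ∈ 𝒜, IsLead (reflect (velocities 𝒜)) ζ.im ⟨A, h⟩ := by
  rw [← Complex.exp_conj] at hf ⊢
  have hpos : 0 < ‖Complex.exp ((starRingEnd ℂ) ζ)‖ := norm_pos_iff.2 (Complex.exp_ne_zero _)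
  simp only [IsLeadingRight, isLead_iff_arg, orientedAngle_act, norm_act_exp, velocities, reflect,
    Subtype.forall, hf, true_and, mul_le_mul_iff_right₀ hpos, Complex.conj_im, RCLike.norm_conj,
    ← arg_conj_mem_Ioo_iff]
  have key : ∀ z w : ℂ, z.arg ∈ Ioo (-Real.pi) 0 → w.arg ∈ Ioo (-Real.pi) 0 →
      ((w.arg ≤ z.arg ∧ (w.arg = z.arg → ‖w‖ ≤ ‖z‖)) ↔
      (((starRingEnd ℂ) z).arg ≤ ((starRingEnd ℂ) w).arg ∧
        (((starRingEnd ℂ) w).arg = ((starRingEnd ℂ) z).arg → ‖w‖ ≤ ‖z‖))) := by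
    intro z w hz hw
    rw [arg_conj_of_mem hz, arg_conj_of_mem hw, neg_le_neg_iff, neg_inj]
  constructor
  · rintro ⟨h1, h2, h3⟩
    exact ⟨h1, h2, fun B hB hm => (key _ _ h2 hm).1 (h3 B hB hm)⟩
  · rintro ⟨h1, h2, h3⟩
    exact ⟨h1, h2, fun B hB hm => (key _ _ h2 hm).2 (h3 B hB hm)⟩

end Angles

/-! ### Closed leading contours as spheres, for both sides at once. -/

section Sides

variable {𝒜 : Set Mat} {Ψ : 𝒜 → ℝ → ℂ} {c : ℂ ≃L[ℝ] ℂ} {L R : Plane → Mat → Prop} {g : ℝ → ℝ}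

/-- The point of the plane with logarithmic polar coordinates `ζ` in the chart `c`. -/
noncomputable def chartPoint (c : ℂ ≃L[ℝ] ℂ) (ζ : ℂ) : Plane := toC.symm (c (Complex.exp ζ))

/-- In the chart `c` the matrices of `𝒜` act by the velocities `Ψ`, the relation `L` selects the
leading left velocities, and `R` selects velocities directed to the right. -/
structure IsSide (𝒜 : Set Mat) (Ψ : 𝒜 → ℝ → ℂ) (c : ℂ ≃L[ℝ] ℂ) (L R : Plane → Mat → Prop) :
    Prop where
  polar : PolarSystem Ψ
  act_chartPoint : ∀ ζ (a : 𝒜),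
    act a (chartPoint c ζ) = toC.symm (c (Complex.exp ζ * Ψ a ζ.im))
  lead_iff : ∀ ζ A, L (chartPoint c ζ) A ↔ ∃ h : A ∈ 𝒜, IsLead Ψ ζ.im ⟨A, h⟩
  lead_ne_zero : ∀ x A, L x A → x ≠ 0
  opposite : ∀ ζ A, R (chartPoint c ζ) A → ∃ h : A ∈ 𝒜, (Ψ ⟨A, h⟩ ζ.im).im < 0

theorem chartPoint_add_real (c : ℂ ≃L[ℝ] ℂ) (r : ℝ) (ζ : ℂ) :
    chartPoint c (r + ζ) = Real.exp r • chartPoint c ζ := by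
  rw [chartPoint, chartPoint, Complex.exp_add, ← Complex.ofReal_exp, ← Complex.real_smul,
    map_smul, map_smul]

theorem chartPoint_ne_zero (c : ℂ ≃L[ℝ] ℂ) (ζ : ℂ) : chartPoint c ζ ≠ 0 := by
  rw [chartPoint, Ne, ContinuousLinearEquiv.map_eq_zero_iff, ContinuousLinearEquiv.map_eq_zero_iff]
  exact Complex.exp_ne_zero ζ

theorem exists_eq_chartPoint (c : ℂ ≃L[ℝ] ℂ) {x : Plane} (hx : x ≠ 0) :
    ∃ ζ, x = chartPoint c ζ := by
  have : c.symm (toC x) ≠ 0 := by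
    rwa [Ne, ContinuousLinearEquiv.map_eq_zero_iff, ContinuousLinearEquiv.map_eq_zero_iff]
  refine ⟨Complex.log (c.symm (toC x)), ?_⟩
  rw [chartPoint, Complex.exp_log this]
  simp

theorem chartPoint_eq_iff (c : ℂ ≃L[ℝ] ℂ) (ζ ξ : ℂ) :
    chartPoint c ζ = chartPoint c ξ ↔ Complex.exp ζ = Complex.exp ξ := by
  simp [chartPoint]

theorem hasDerivAt_chartPoint (c : ℂ ≃L[ℝ] ℂ) {ζ : ℝ → ℂ} {v : ℂ} {t : ℝ}
    (h : HasDerivAt ζ v t) :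
    HasDerivAt (fun t => chartPoint c (ζ t)) (toC.symm (c (Complex.exp (ζ t) * v))) t := by
  have := ((c.trans toC.symm : ℂ ≃L[ℝ] Plane) : ℂ →L[ℝ] Plane).hasFDerivAt.comp_hasDerivAt t
    h.cexp
  exact this

theorem contDiff_chartPoint (c : ℂ ≃L[ℝ] ℂ) : ContDiff ℝ 1 (chartPoint c) :=
  ((c.trans toC.symm : ℂ ≃L[ℝ] Plane) : ℂ →L[ℝ] Plane).contDiff.comp
    (Complex.contDiff_exp (𝕜 := ℝ))

theorem chartPoint_eq_smul (c : ℂ ≃L[ℝ] ℂ) (g : ℝ → ℝ) (ζ : ℂ) : chartPoint c ζ =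
    Real.exp (ζ.re - leadRadius g ζ.im) • chartPoint c (leadContour g ζ.im) := by
  rw [← chartPoint_add_real]
  congr 1
  apply Complex.ext <;> simp [leadContour]

theorem IsSide.exists_lift (hs : IsSide 𝒜 Ψ c L R) {A : ℝ → Mat} {x : ℝ → Plane} {I : Set ℝ}
    {r : ℝ → ℝ} (hr : IsTimeRetraction I r) (hA : ∀ t ∈ I, A t ∈ 𝒜) {M : ℝ}
    (hM : ∀ A ∈ 𝒜, ∀ x, ‖act A x‖ ≤ M * ‖x‖) (hx : IsSolutionOn A x I)
    (h0 : ∀ t ∈ I, x t ≠ 0) :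
    ∃ ζ : ℝ → ℂ, LocallyLipschitz ζ ∧ (∀ t ∈ I, x t = chartPoint c (ζ t)) ∧
      ∀ᵐ t, ∀ h : t ∈ I, HasDerivAt ζ (Ψ ⟨A t, hA t h⟩ (ζ t).im) t := by
  obtain ⟨hl, hd⟩ := hx.locallyLipschitz hr fun t ht => hM _ (hA t ht)
  let l : Plane ≃L[ℝ] ℂ := toC.trans c.symm
  have hz : LocallyLipschitz fun t => l ((x ∘ r) t) :=
    ((l : Plane →L[ℝ] ℂ).contDiff (n := 1)).locallyLipschitz.comp hl
  obtain ⟨ζ, hζ, he⟩ := exists_exp_lift hz.continuous (fun t => by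
    rw [Ne, ContinuousLinearEquiv.map_eq_zero_iff]
    exact h0 _ (hr.maps t))
  have hxe : ∀ t ∈ I, x t = chartPoint c (ζ t) := by
    intro t ht
    rw [chartPoint, he, Function.comp_apply, hr.eq t ht]
    simp [l]
  refine ⟨ζ, locallyLipschitz_of_exp_eq hζ he hz, hxe, ?_⟩
  filter_upwards [hd] with t ht hI
  have h1 : HasDerivAt (fun t => l ((x ∘ r) t)) (l (act (A t) (x t))) t :=
    (l : Plane →L[ℝ] ℂ).hasFDerivAt.comp_hasDerivAt t (ht hI)
  have h2 := hasDerivAt_of_exp_eq hζ he h1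
  rw [← he] at h2
  have h3 : l (act (A t) (x t)) = Complex.exp (ζ t) * Ψ ⟨A t, hA t hI⟩ (ζ t).im := by
    rw [hxe t hI]
    have := hs.act_chartPoint (ζ t) ⟨A t, hA t hI⟩
    simp only at this
    rw [this]
    simp [l]
  rwa [h3, mul_div_cancel_left₀ _ (Complex.exp_ne_zero _)] at h2

/-- The leading trajectory of the plane with the initial scale `r` and the time shift `τ`. -/
noncomputable def leadTrajectory (c : ℂ ≃L[ℝ] ℂ) [CompactSpace 𝒜] (h : PolarSystem Ψ)
    (hg : IsLeadSlope Ψ g) (r τ t : ℝ) : Plane := chartPoint c (r + leadCurve h hg (t + τ))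

variable [CompactSpace 𝒜]

/-- The leading matrix is selected as a function of the angle, with its four entries measurable, and
then composed with the continuous angle of the curve. -/
theorem IsSide.exists_isSolutionOn (hs : IsSide 𝒜 Ψ c L R) (hg : IsLeadSlope Ψ g) (r τ : ℝ) :
    ∃ A : ℝ → Mat, (∀ t, A t ∈ 𝒜 ∧ L (leadTrajectory c hs.polar hg r τ t) (A t)) ∧
      Measurable (fun t i j => A t i j) ∧
      LocallyLipschitz (leadTrajectory c hs.polar hg r τ) ∧
      ∀ᵐ t, HasDerivAt (leadTrajectory c hs.polar hg r τ)
        (act (A t) (leadTrajectory c hs.polar hg r τ t)) t := by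
  obtain ⟨s, hsl, hsm⟩ := exists_measurable_isLead hs.polar hg
    [fun a : 𝒜 => (a : Mat) 0 0, fun a => (a : Mat) 0 1, fun a => (a : Mat) 1 0,
      fun a => (a : Mat) 1 1] (by
      have := fun i j => (continuous_entry i j).comp (continuous_subtype_val (p := (· ∈ 𝒜)))
      intro u hu
      simp only [List.mem_cons, List.not_mem_nil, or_false] at hu
      rcases hu with rfl | rfl | rfl | rfl
      exacts [this 0 0, this 0 1, this 1 0, this 1 1])
  simp only [List.mem_cons, List.not_mem_nil, or_false, forall_eq_or_imp, forall_eq] at hsm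
  have him : ∀ t, ((r : ℂ) + leadCurve hs.polar hg (t + τ)).im =
      leadAngle hs.polar hg (t + τ) := fun t => by simp [leadCurve_im]
  have hshift : LocallyLipschitz fun t : ℝ => t + τ :=
    ContDiff.locallyLipschitz (𝕂 := ℝ) (by fun_prop)
  refine ⟨fun t => s (leadAngle hs.polar hg (t + τ)), fun t => ⟨Subtype.coe_prop _, ?_⟩, ?_, ?_, ?_⟩
  · refine (hs.lead_iff _ _).2 ⟨Subtype.coe_prop _, ?_⟩
    rw [him]
    exact hsl _
  · have hm : Measurable fun t => leadAngle hs.polar hg (t + τ) :=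
      ((leadAngle hs.polar hg).continuous.comp (by fun_prop)).measurable
    refine measurable_pi_lambda _ fun i => measurable_pi_lambda _ fun j => ?_
    fin_cases i <;> fin_cases j
    exacts [hsm.1.comp hm, hsm.2.1.comp hm, hsm.2.2.1.comp hm, hsm.2.2.2.comp hm]
  · exact (contDiff_chartPoint c).locallyLipschitz.comp
      ((LocallyLipschitz.const _).add ((lipschitz_leadCurve hs.polar hg).comp hshift))
  · have hae : ∀ᵐ t : ℝ, HasDerivAt (leadCurve hs.polar hg)
        (leadVelocity Ψ g (leadCurve hs.polar hg (t + τ)).im) (t + τ) :=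
      (measurePreserving_add_right volume τ).quasiMeasurePreserving.ae
        (ae_hasDerivAt_leadCurve hs.polar hg)
    filter_upwards [hae] with t ht
    have h1 := hasDerivAt_chartPoint c ((ht.comp_add_const t τ).const_add (r : ℂ))
    have h2 := hs.act_chartPoint (r + leadCurve hs.polar hg (t + τ))
      (s (leadAngle hs.polar hg (t + τ)))
    rw [leadTrajectory, h2, him, (isLead_iff hs.polar hg _ _).1 (hsl _)]
    exact h1

theorem stronglyMeasurable_of_entries {A : ℝ → Mat} (h : Measurable fun t i j => A t i j) :
    StronglyMeasurable A := by
  have : StronglyMeasurable (fun t => (fun i j => A t i j : Fin 2 → Fin 2 → ℝ)) :=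
    h.stronglyMeasurable
  exact this

theorem IsSide.isLeading_leadTrajectory (hs : IsSide 𝒜 Ψ c L R) (hg : IsLeadSlope Ψ g)
    (r τ : ℝ) : ∃ A : ℝ → Mat, (∀ t ∈ univ, L (leadTrajectory c hs.polar hg r τ t) (A t)) ∧
      IsSolutionOn A (leadTrajectory c hs.polar hg r τ) univ := by
  obtain ⟨A, hA, hm, hl, hd⟩ := hs.exists_isSolutionOn hg r τ
  exact ⟨A, fun t _ => (hA t).2, isSolutionOn_of_ae_hasDerivAt ordConnected_univ
    (stronglyMeasurable_of_entries hm).aestronglyMeasurable hl (fun _ _ => rfl)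
    (hd.mono fun t h _ => h)⟩

theorem IsSide.isTrajectory_leadTrajectory (hs : IsSide 𝒜 Ψ c L R) (hg : IsLeadSlope Ψ g)
    (r τ : ℝ) : IsTrajectory 𝒜 (leadTrajectory c hs.polar hg r τ) := by
  obtain ⟨A, hA, hm, hl, hd⟩ := hs.exists_isSolutionOn hg r τ
  exact IsMotion.isTrajectory ⟨stronglyMeasurable_of_entries hm, fun t => (hA t).1, hl,
    hd.mono fun t h _ => h⟩

/-- The seminorm `f` does not increase along the trajectories. -/
def IsMonotoneSeminorm (𝒜 : Set Mat) (f : Seminorm ℝ Plane) : Prop :=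
  ∀ x, IsTrajectory 𝒜 x → ∀ t, 0 ≤ t → f (x t) ≤ f (x 0)

theorem leadAngle_zero (h : PolarSystem Ψ) (hg : IsLeadSlope Ψ g) : leadAngle h hg 0 = 0 := by
  have := leadAngle_leadTime h hg 0
  rwa [show leadTime Ψ g 0 = 0 by simp [leadTime]] at this

theorem leadContour_zero (g : ℝ → ℝ) : leadContour g 0 = 0 := by
  simp [leadContour_eq, leadRadius]

/-- After a half-turn the leading trajectory reaches the opposite of its starting point, scaled by
the exponential of the integral, and `f` has not increased. -/
theorem IsSide.integral_nonpos (hs : IsSide 𝒜 Ψ c L R) (hg : IsLeadSlope Ψ g)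
    {f : Seminorm ℝ Plane} (hf : ∀ x, f x = 0 → x = 0) (hmono : IsMonotoneSeminorm 𝒜 f) :
    ∫ θ in 0..Real.pi, g θ ≤ 0 := by
  have h0 : 0 ≤ leadTime Ψ g Real.pi := by
    have := (strictMono_leadTime hs.polar hg).monotone Real.pi_pos.le
    rwa [show leadTime Ψ g 0 = 0 by simp [leadTime]] at this
  have h1 := hmono _ (hs.isTrajectory_leadTrajectory hg 0 0) _ h0
  simp only [leadTrajectory, add_zero, leadCurve, leadAngle_leadTime, leadAngle_zero,
    leadContour_zero, Complex.ofReal_zero, zero_add] at h1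
  have h2 : chartPoint c (leadContour g Real.pi) =
      Real.exp (leadRadius g Real.pi) • -chartPoint c 0 := by
    rw [leadContour_eq, chartPoint_add_real, chartPoint, chartPoint, Complex.exp_pi_mul_I,
      Complex.exp_zero, map_neg, map_neg]
  rw [h2, map_smul_eq_mul, map_neg_eq_map, Real.norm_of_nonneg (Real.exp_pos _).le] at h1
  have hpos : 0 < f (chartPoint c 0) := lt_of_le_of_ne (apply_nonneg f _)
    fun h => chartPoint_ne_zero c 0 (hf _ h.symm)
  have h3 : Real.exp (leadRadius g Real.pi) ≤ 1 := by
    refine le_of_mul_le_mul_right ?_ hpos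
    rwa [one_mul]
  exact Real.exp_le_one_iff.1 h3

theorem leadTrajectory_periodic (h : PolarSystem Ψ) (hg : IsLeadSlope Ψ g)
    (h0 : ∫ θ in 0..Real.pi, g θ = 0) (r τ : ℝ) :
    Function.Periodic (leadTrajectory c h hg r τ) (leadPeriod Ψ g) := by
  intro t
  rw [leadTrajectory, leadTrajectory, chartPoint_eq_iff, Complex.exp_add, Complex.exp_add,
    add_right_comm]
  congr 1
  exact exp_leadCurve_periodic h hg h0 (t + τ)

/-- A function that does not increase along a closed trajectory is constant on it. -/
theorem IsSide.seminorm_contour (hs : IsSide 𝒜 Ψ c L R) (hg : IsLeadSlope Ψ g)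
    (h0 : ∫ θ in 0..Real.pi, g θ = 0) {f : Seminorm ℝ Plane} (hmono : IsMonotoneSeminorm 𝒜 f)
    (θ : ℝ) : f (chartPoint c (leadContour g θ)) = f (chartPoint c 0) := by
  obtain ⟨t, ht, he⟩ := exists_leadCurve_eq hs.polar hg h0 θ
  have hT := leadPeriod_pos hs.polar hg
  have hX : ∀ τ t, leadTrajectory c hs.polar hg 0 τ t =
      chartPoint c (leadCurve hs.polar hg (t + τ)) := fun τ t => by simp [leadTrajectory]
  have h1 := hmono _ (hs.isTrajectory_leadTrajectory hg 0 0) t ht.1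
  have h2 := hmono _ (hs.isTrajectory_leadTrajectory hg 0 t) (leadPeriod Ψ g - t)
    (sub_nonneg.2 ht.2.le)
  have h3 := leadTrajectory_periodic (c := c) hs.polar hg h0 0 0 0
  simp only [hX, add_zero, zero_add, sub_add_cancel] at h1 h2 h3
  rw [h3] at h2
  rw [← (chartPoint_eq_iff c _ _).2 he, le_antisymm h1 h2, leadCurve, leadAngle_zero,
    leadContour_zero]

theorem IsSide.seminorm_chartPoint (hs : IsSide 𝒜 Ψ c L R) (hg : IsLeadSlope Ψ g)
    (h0 : ∫ θ in 0..Real.pi, g θ = 0) {f : Seminorm ℝ Plane} (hmono : IsMonotoneSeminorm 𝒜 f)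
    (ζ : ℂ) : f (chartPoint c ζ) =
      Real.exp (ζ.re - leadRadius g ζ.im) * f (chartPoint c 0) := by
  rw [chartPoint_eq_smul c g ζ, map_smul_eq_mul, hs.seminorm_contour hg h0 hmono,
    Real.norm_of_nonneg (Real.exp_pos _).le]

/-- Both norms are constant on the closed contour, which meets every ray, so homogeneity leaves one
free factor. -/
theorem IsSide.seminorm_unique (hs : IsSide 𝒜 Ψ c L R) (hg : IsLeadSlope Ψ g)
    (h0 : ∫ θ in 0..Real.pi, g θ = 0) {f f' : Seminorm ℝ Plane} (hf : ∀ x, f x = 0 → x = 0)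
    (hf' : ∀ x, f' x = 0 → x = 0) (hmono : IsMonotoneSeminorm 𝒜 f)
    (hmono' : IsMonotoneSeminorm 𝒜 f') : ∃ k : ℝ, 0 < k ∧ ∀ x, f' x = k * f x := by
  have hpos : ∀ f : Seminorm ℝ Plane, (∀ x, f x = 0 → x = 0) → 0 < f (chartPoint c 0) :=
    fun f hf => lt_of_le_of_ne (apply_nonneg f _) fun h => chartPoint_ne_zero c 0 (hf _ h.symm)
  refine ⟨f' (chartPoint c 0) / f (chartPoint c 0), div_pos (hpos f' hf') (hpos f hf),
    fun x => ?_⟩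
  by_cases hx : x = 0
  · simp [hx]
  obtain ⟨ζ, rfl⟩ := exists_eq_chartPoint c hx
  rw [hs.seminorm_chartPoint hg h0 hmono ζ, hs.seminorm_chartPoint hg h0 hmono' ζ]
  have := (hpos f hf).ne'
  field_simp

theorem IsSide.exists_constant_trajectory (hs : IsSide 𝒜 Ψ c L R) (hg : IsLeadSlope Ψ g)
    (h0 : ∫ θ in 0..Real.pi, g θ = 0) {f : Seminorm ℝ Plane} (hmono : IsMonotoneSeminorm 𝒜 f)
    {x₀ : Plane} (hx₀ : x₀ ≠ 0) :
    ∃ x : ℝ → Plane, IsTrajectory 𝒜 x ∧ x 0 = x₀ ∧ ∀ t, f (x t) = f x₀ := by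
  obtain ⟨ζ, rfl⟩ := exists_eq_chartPoint c hx₀
  have hx0 : leadTrajectory c hs.polar hg (ζ.re - leadRadius g ζ.im) (leadTime Ψ g ζ.im) 0 =
      chartPoint c ζ := by
    rw [leadTrajectory, zero_add, leadCurve, leadAngle_leadTime]
    congr 1
    apply Complex.ext <;> simp [leadContour]
  refine ⟨_, hs.isTrajectory_leadTrajectory hg (ζ.re - leadRadius g ζ.im) (leadTime Ψ g ζ.im),
    hx0, fun t => ?_⟩
  rw [leadTrajectory, hs.seminorm_chartPoint hg h0 hmono, hs.seminorm_chartPoint hg h0 hmono ζ]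
  congr 2
  simp [leadCurve, leadContour]

theorem IsSide.exists_sphere_parametrization (hs : IsSide 𝒜 Ψ c L R) (hg : IsLeadSlope Ψ g)
    (h0 : ∫ θ in 0..Real.pi, g θ = 0) {f : Seminorm ℝ Plane} (hf : ∀ x, f x = 0 → x = 0)
    (hmono : IsMonotoneSeminorm 𝒜 f) :
    ∃ (x : ℝ → Plane) (T : ℝ), (0 < T ∧ Function.Periodic x T ∧
      ∃ A : ℝ → Mat, (∀ t ∈ univ, L (x t) (A t)) ∧ IsSolutionOn A x univ) ∧
      InjOn x (Ico 0 T) ∧ x '' Ico 0 T = unitSphere f := by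
  have hpos : 0 < f (chartPoint c 0) :=
    lt_of_le_of_ne (apply_nonneg f _) fun h => chartPoint_ne_zero c 0 (hf _ h.symm)
  set r := -Real.log (f (chartPoint c 0)) with hr
  have hexp : Real.exp r * f (chartPoint c 0) = 1 := by
    rw [hr, Real.exp_neg, Real.exp_log hpos, inv_mul_cancel₀ hpos.ne']
  refine ⟨leadTrajectory c hs.polar hg r 0, leadPeriod Ψ g, ⟨leadPeriod_pos hs.polar hg,
    leadTrajectory_periodic hs.polar hg h0 r 0, hs.isLeading_leadTrajectory hg r 0⟩, ?_, ?_⟩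
  · intro s hs' t ht hst
    rw [leadTrajectory, leadTrajectory, chartPoint_eq_iff, Complex.exp_add, Complex.exp_add,
      add_zero, add_zero] at hst
    exact injOn_exp_leadCurve hs.polar hg hs' ht (mul_left_cancel₀ (Complex.exp_ne_zero _) hst)
  · apply Subset.antisymm
    · rintro _ ⟨t, -, rfl⟩
      change f _ = 1
      rw [leadTrajectory, hs.seminorm_chartPoint hg h0 hmono, ← hexp]
      congr 2
      simp [leadCurve, leadContour]
    · intro x hx
      have hx1 : f x = 1 := hx
      have hx0 : x ≠ 0 := by rintro rfl; simp at hx1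
      obtain ⟨ζ, rfl⟩ := exists_eq_chartPoint c hx0
      rw [hs.seminorm_chartPoint hg h0 hmono, ← hexp] at hx1
      have hre : ζ.re - leadRadius g ζ.im = r :=
        Real.exp_injective (mul_right_cancel₀ hpos.ne' hx1)
      obtain ⟨t, ht, he⟩ := exists_leadCurve_eq hs.polar hg h0 ζ.im
      refine ⟨t, ht, ?_⟩
      rw [leadTrajectory, add_zero, chartPoint_add_real, (chartPoint_eq_iff c _ _).2 he,
        chartPoint_eq_smul c g ζ, hre]

end Sides

/-! ### Rigidity of periodic leading trajectories; tangent and inward rays. -/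

section PeriodicTrajectories

variable {𝒜 : Set Mat} {Ψ : 𝒜 → ℝ → ℂ} {c : ℂ ≃L[ℝ] ℂ} {L R : Plane → Mat → Prop} {g : ℝ → ℝ}

theorem IsLeadSlope.unique {X : Type*} {Ψ : X → ℝ → ℂ} {g g' : ℝ → ℝ}
    (h : IsLeadSlope Ψ g) (h' : IsLeadSlope Ψ g') : g = g' := by
  ext θ
  obtain ⟨a, ha, he⟩ := h.attained θ
  obtain ⟨a', ha', he'⟩ := h'.attained θ
  refine le_antisymm ?_ ?_
  · have := h'.upper a θ ha
    rw [he] at this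
    exact le_of_mul_le_mul_right this ha
  · have := h.upper a' θ ha'
    rw [he'] at this
    exact le_of_mul_le_mul_right this ha'

/-- There is no uniform lower bound on `ω` to integrate. If the end values agreed, monotonicity
would make `φ` constant, and its derivative would vanish on an interval of positive measure. -/
theorem lt_of_ae_deriv_pos {φ ω : ℝ → ℝ} (hφ : LocallyLipschitz φ) {a b : ℝ} (hab : a < b)
    (h : ∀ᵐ t, t ∈ Icc a b → HasDerivAt φ (ω t) t ∧ 0 < ω t) : φ a < φ b := by
  have hmono : ∀ s t, a ≤ s → s ≤ t → t ≤ b → φ s ≤ φ t := by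
    intro s t has hst htb
    have := le_sub_of_ae_le_deriv (c := 0) hφ hst (by
      filter_upwards [h] with u hu hm d hd
      obtain ⟨h1, h2⟩ := hu ⟨has.trans hm.1, hm.2.trans htb⟩
      rw [hd.unique h1]
      exact h2.le)
    linarith
  by_contra! hle
  have hconst : ∀ t ∈ Icc a b, φ t = φ a := fun t ht =>
    le_antisymm ((hmono t b ht.1 ht.2 le_rfl).trans hle) (hmono a t le_rfl ht.1 ht.2)
  have hbad : ∀ᵐ t, t ∉ Ioo a b := by
    filter_upwards [h] with t ht hm
    obtain ⟨h1, h2⟩ := ht (Ioo_subset_Icc_self hm)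
    have h3 : HasDerivAt φ 0 t := (hasDerivAt_const t (φ a)).congr_of_eventuallyEq (by
      filter_upwards [Ioo_mem_nhds hm.1 hm.2] with s hs
      exact hconst s (Ioo_subset_Icc_self hs))
    rw [h1.unique h3] at h2
    exact lt_irrefl _ h2
  rw [ae_iff] at hbad
  simp only [not_not] at hbad
  have : volume (Ioo a b) = 0 := hbad
  rw [Real.volume_Ioo, ENNReal.ofReal_eq_zero] at this
  linarith

/-- The radius is a linear function of the angle with coefficient I/π plus a π-periodic one, so a
single return forces I = 0. -/
theorem integral_eq_zero_of_leadRadius_eq (hgc : IsLeadSlope Ψ g) {θ : ℝ} {n : ℤ} (hn : n ≠ 0)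
    (h : leadRadius g (θ + n * Real.pi) = leadRadius g θ) : ∫ s in 0..Real.pi, g s = 0 := by
  set I := leadRadius g Real.pi with hI
  have hpi := Real.pi_pos.ne'
  have hp : Function.Periodic (fun θ => leadRadius g θ - I / Real.pi * θ) Real.pi := by
    intro θ
    simp only
    rw [leadRadius_add_pi hgc, ← hI]
    field_simp
    ring
  have h1 := hp.int_mul n θ
  simp only [h] at h1
  have h2 : I * n * Real.pi = 0 := by
    field_simp at h1
    linarith
  exact (mul_eq_zero.1 ((mul_eq_zero.1 h2).resolve_right hpi)).resolve_right (by exact_mod_cast hn)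

variable [CompactSpace 𝒜]

/-- The angle strictly increases, so over one period it gains 2πn with n > 0 and meets every angle
modulo π. Hence leading velocities exist everywhere, the leading slope is defined, and the
trajectory follows its contour; the return of the radius then makes the integral vanish. -/
theorem IsSide.eq_leadTrajectory_of_periodic [Nonempty 𝒜] (hs : IsSide 𝒜 Ψ c L R) {M : ℝ}
    (hM : ∀ A ∈ 𝒜, ∀ x, ‖act A x‖ ≤ M * ‖x‖) {x : ℝ → Plane} {T : ℝ}
    (hx : 0 < T ∧ Function.Periodic x T ∧
      ∃ A : ℝ → Mat, (∀ t ∈ univ, L (x t) (A t)) ∧ IsSolutionOn A x univ) :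
    ∃ (g : ℝ → ℝ) (hg : IsLeadSlope Ψ g), ∫ θ in 0..Real.pi, g θ = 0 ∧
      ∃ r τ : ℝ, ∀ t, x t = leadTrajectory c hs.polar hg r τ t := by
  obtain ⟨hT, hper, A, hL, hsol⟩ := hx
  have hx0 : ∀ t, x t ≠ 0 := fun t => hs.lead_ne_zero _ _ (hL t (mem_univ t))
  have hA : ∀ t ∈ univ, A t ∈ 𝒜 := by
    intro t _
    obtain ⟨ζ, hζ⟩ := exists_eq_chartPoint c (hx0 t)
    have := hL t (mem_univ t)
    rw [hζ] at this
    exact ((hs.lead_iff _ _).1 this).1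
  obtain ⟨ζ, hζ, hxζ, hd⟩ := hs.exists_lift isTimeRetraction_univ hA hM hsol fun t _ => hx0 t
  have hlead : ∀ t, IsLead Ψ (ζ t).im ⟨A t, hA t (mem_univ t)⟩ := by
    intro t
    have := hL t (mem_univ t)
    rw [hxζ t (mem_univ t)] at this
    exact ((hs.lead_iff _ _).1 this).2
  have him : LocallyLipschitz fun t => (ζ t).im :=
    (Complex.imCLM.contDiff (n := 1)).locallyLipschitz.comp hζ
  have hlt : ∀ a b, a < b → (ζ a).im < (ζ b).im := fun a b hab =>
    lt_of_ae_deriv_pos him hab (ω := fun t => (Ψ ⟨A t, hA t (mem_univ t)⟩ (ζ t).im).im) (by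
      filter_upwards [hd] with t ht _
      exact ⟨Complex.imCLM.hasFDerivAt.comp_hasDerivAt t (ht (mem_univ t)), (hlead t).1⟩)
  have hexp : ∀ t, ∃ n : ℤ, ζ (t + T) = ζ t + n * (2 * Real.pi * Complex.I) := by
    intro t
    have := hper t
    rw [hxζ _ (mem_univ _), hxζ _ (mem_univ _), chartPoint_eq_iff] at this
    exact Complex.exp_eq_exp_iff_exists_int.1 this
  obtain ⟨n, hn⟩ := hexp 0
  rw [zero_add] at hn
  have hnim : (ζ T).im = (ζ 0).im + 2 * n * Real.pi := by
    rw [hn]; simp; ring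
  have hnre : (ζ T).re = (ζ 0).re := by rw [hn]; simp
  have hn0 : 0 < n := by
    have h1 := hlt 0 T hT
    rw [hnim] at h1
    have h2 : (0 : ℝ) < n := by
      by_contra hc
      nlinarith [Real.pi_pos]
    exact_mod_cast h2
  have hn1 : (1 : ℝ) ≤ n := by exact_mod_cast hn0
  have hwhole : ∀ θ, ∃ a, 0 < (Ψ a θ).im := by
    intro θ
    have hle : (ζ 0).im + Real.pi ≤ (ζ T).im := by rw [hnim]; nlinarith [Real.pi_pos]
    -- A multiple of π moves `θ` into the range of angles visited during one period.
    let k := toIcoDiv Real.pi_pos (ζ 0).im θ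
    have hk := sub_toIcoDiv_zsmul_mem_Ico Real.pi_pos (ζ 0).im θ
    obtain ⟨t, -, ht⟩ := intermediate_value_Icc hT.le him.continuous.continuousOn
      ⟨hk.1, hk.2.le.trans hle⟩
    refine ⟨⟨A t, hA t (mem_univ t)⟩, ?_⟩
    have h1 := (hlead t).1
    simp only at ht
    rw [ht] at h1
    have h2 := ((hs.polar.periodic' ⟨A t, hA t (mem_univ t)⟩).zsmul k).sub_eq θ
    rwa [h2] at h1
  obtain ⟨M₀, hM₀⟩ := exists_isLeadSlope hs.polar hwhole
  have hg := hM₀ M₀ le_rfl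
  obtain ⟨τ, r, he⟩ := exists_eq_leadCurve hs.polar hg hζ (by
    filter_upwards [hd] with t ht
    rw [← (isLead_iff hs.polar hg _ _).1 (hlead t)]
    exact ht (mem_univ t))
  refine ⟨_, hg, ?_, r, τ, fun t => by rw [hxζ t (mem_univ t), he, leadTrajectory]⟩
  rw [he 0, he T] at hnim hnre
  simp only [Complex.add_im, Complex.add_re, Complex.ofReal_re, Complex.ofReal_im, zero_add,
    add_right_inj, leadCurve, leadContour] at hnim hnre
  refine integral_eq_zero_of_leadRadius_eq hg (θ := leadAngle hs.polar hg τ) (n := 2 * n)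
    (by omega) ?_
  rw [← hnre, hnim]
  push_cast
  rfl

theorem IsSide.periodic_unique [Nonempty 𝒜] (hs : IsSide 𝒜 Ψ c L R) {M : ℝ}
    (hM : ∀ A ∈ 𝒜, ∀ x, ‖act A x‖ ≤ M * ‖x‖) {x y : ℝ → Plane} {T T' : ℝ}
    (hx : 0 < T ∧ Function.Periodic x T ∧
      ∃ A : ℝ → Mat, (∀ t ∈ univ, L (x t) (A t)) ∧ IsSolutionOn A x univ)
    (hy : 0 < T' ∧ Function.Periodic y T' ∧
      ∃ A : ℝ → Mat, (∀ t ∈ univ, L (y t) (A t)) ∧ IsSolutionOn A y univ) :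
    ∃ k : ℝ, 0 < k ∧ ∃ τ : ℝ, ∀ t, y t = k • x (t + τ) := by
  obtain ⟨g, hg, -, r, τ, hxe⟩ := hs.eq_leadTrajectory_of_periodic hM hx
  obtain ⟨g', hg', -, r', τ', hye⟩ := hs.eq_leadTrajectory_of_periodic hM hy
  obtain rfl := hg.unique hg'
  refine ⟨Real.exp (r' - r), Real.exp_pos _, τ' - τ, fun t => ?_⟩
  rw [hxe, hye, leadTrajectory, leadTrajectory, ← chartPoint_add_real, ← add_assoc,
    ← Complex.ofReal_add, sub_add_cancel, add_assoc, sub_add_cancel]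

theorem IsSide.exists_contour_of_mem_sphere (hs : IsSide 𝒜 Ψ c L R) (hg : IsLeadSlope Ψ g)
    (h0 : ∫ θ in 0..Real.pi, g θ = 0) {f : Seminorm ℝ Plane} (hf : ∀ x, f x = 0 → x = 0)
    (hmono : IsMonotoneSeminorm 𝒜 f) :
    ∃ r : ℝ, (∀ θ, f (chartPoint c (r + leadContour g θ)) = 1) ∧
      ∀ p, f p = 1 → ∃ θ, p = chartPoint c (r + leadContour g θ) := by
  have hpos : 0 < f (chartPoint c 0) :=
    lt_of_le_of_ne (apply_nonneg f _) fun h => chartPoint_ne_zero c 0 (hf _ h.symm)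
  set r := -Real.log (f (chartPoint c 0)) with hr
  have hexp : Real.exp r * f (chartPoint c 0) = 1 := by
    rw [hr, Real.exp_neg, Real.exp_log hpos, inv_mul_cancel₀ hpos.ne']
  refine ⟨r, fun θ => ?_, fun p hp => ?_⟩
  · rw [chartPoint_add_real, map_smul_eq_mul, hs.seminorm_contour hg h0 hmono,
      Real.norm_of_nonneg (Real.exp_pos _).le, hexp]
  · have hp0 : p ≠ 0 := by rintro rfl; simp at hp
    obtain ⟨ζ, rfl⟩ := exists_eq_chartPoint c hp0
    rw [hs.seminorm_chartPoint hg h0 hmono, ← hexp] at hp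
    have hre : ζ.re - leadRadius g ζ.im = r :=
      Real.exp_injective (mul_right_cancel₀ hpos.ne' hp)
    exact ⟨ζ.im, by rw [chartPoint_add_real, chartPoint_eq_smul c g ζ, hre]⟩

theorem hasDerivAt_contourPoint (hg : Continuous g) (r θ : ℝ) :
    HasDerivAt (fun θ => chartPoint c (r + leadContour g θ))
      (toC.symm (c (Complex.exp (r + leadContour g θ) * ⟨g θ, 1⟩))) θ :=
  hasDerivAt_chartPoint c ((hasDerivAt_leadContour hg θ).const_add (r : ℂ))

theorem IsSide.isTangentTo (hs : IsSide 𝒜 Ψ c L R) (hg : IsLeadSlope Ψ g)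
    (h0 : ∫ θ in 0..Real.pi, g θ = 0) {f : Seminorm ℝ Plane} (hf : ∀ x, f x = 0 → x = 0)
    (hmono : IsMonotoneSeminorm 𝒜 f) {p : Plane} (hp : p ∈ unitSphere f) {A : Mat}
    (hA : L p A) : IsTangentTo (unitSphere f) p (act A p) := by
  obtain ⟨r, hr1, hr2⟩ := hs.exists_contour_of_mem_sphere hg h0 hf hmono
  obtain ⟨θ, rfl⟩ := hr2 p hp
  obtain ⟨hA', hlead⟩ := (hs.lead_iff _ _).1 hA
  have him : ((r : ℂ) + leadContour g θ).im = θ := by simp [leadContour]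
  rw [isLead_iff hs.polar hg, him] at hlead
  set w := leadSpeed Ψ g θ with hw
  have hlin : HasDerivAt (fun s : ℝ => θ + s * w) w 0 := by
    simpa using ((hasDerivAt_id (0 : ℝ)).mul_const w).const_add θ
  have h1 := (hasDerivAt_contourPoint (c := c) hg.continuous r (θ + 0 * w)).scomp (0 : ℝ) hlin
  have hact : act A (chartPoint c (r + leadContour g θ)) =
      w • toC.symm (c (Complex.exp (r + leadContour g (θ + 0 * w)) * ⟨g (θ + 0 * w), 1⟩)) := by
    have := hs.act_chartPoint (r + leadContour g θ) ⟨A, hA'⟩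
    simp only at this
    rw [this, him, hlead, zero_mul, add_zero, ← map_smul, ← map_smul]
    congr 2
    rw [Complex.real_smul, mul_left_comm]
    congr 1
    apply Complex.ext <;> simp [leadVelocity, hw, mul_comm]
  rw [← hact] at h1
  have h2 := (hasDerivAt_iff_isLittleO_nhds_zero.1 h1).mono
    (nhdsWithin_le_nhds (s := Ioi (0 : ℝ)))
  refine IsBigO.trans_isLittleO (IsBigO.of_bound 1 (Eventually.of_forall fun s => ?_)) h2
  rw [one_mul, Real.norm_of_nonneg Metric.infDist_nonneg]
  refine (Metric.infDist_le_dist_of_mem (y := chartPoint c (r + leadContour g (θ + s * w)))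
    (hr1 _)).trans (le_of_eq ?_)
  rw [dist_eq_norm, ← norm_neg]
  congr 1
  simp only [Function.comp_apply, zero_add, zero_mul, add_zero]
  abel

/-- The vector `act B p` is a multiple of the tangent of the contour plus `k • p`, where k = re - g
im is negative by the gap. Hence `f` decreases at rate k to the first order. -/
theorem IsSide.isDirectedInside (hs : IsSide 𝒜 Ψ c L R) (hg : IsLeadSlope Ψ g)
    (h0 : ∫ θ in 0..Real.pi, g θ = 0) {f : Seminorm ℝ Plane} (hf : ∀ x, f x = 0 → x = 0)
    (hmono : IsMonotoneSeminorm 𝒜 f)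
    (hgap : ∀ a b θ, 0 < (Ψ a θ).im → (Ψ b θ).im < 0 →
      (Ψ b θ).re * (Ψ a θ).im < (Ψ a θ).re * (Ψ b θ).im)
    {p : Plane} (hp : p ∈ unitSphere f) {B : Mat} (hB : R p B) :
    IsDirectedInside (unitBall f) p (act B p) := by
  obtain ⟨r, hr1, hr2⟩ := hs.exists_contour_of_mem_sphere hg h0 hf hmono
  obtain ⟨θ, rfl⟩ := hr2 p hp
  obtain ⟨hB', hneg⟩ := hs.opposite _ _ hB
  have him : ((r : ℂ) + leadContour g θ).im = θ := by simp [leadContour]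
  rw [him] at hneg
  set ρ := (Ψ ⟨B, hB'⟩ θ).re with hρ
  set w := (Ψ ⟨B, hB'⟩ θ).im with hw
  set k := ρ - g θ * w with hk
  have hk0 : k < 0 := by
    obtain ⟨a, ha, he⟩ := hg.attained θ
    have h1 := hgap a ⟨B, hB'⟩ θ ha hneg
    rw [he, ← hρ, ← hw] at h1
    have h2 : ρ * (Ψ a θ).im < g θ * w * (Ψ a θ).im := by linarith
    have := lt_of_mul_lt_mul_right h2 ha.le
    linarith
  set P := chartPoint c (r + leadContour g θ) with hP
  have hlin : HasDerivAt (fun s : ℝ => θ + s * w) w 0 := by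
    simpa using ((hasDerivAt_id (0 : ℝ)).mul_const w).const_add θ
  have h1 := (hasDerivAt_contourPoint (c := c) hg.continuous r (θ + 0 * w)).scomp (0 : ℝ) hlin
  have hact : act B P = k • P +
      w • toC.symm (c (Complex.exp (r + leadContour g (θ + 0 * w)) * ⟨g (θ + 0 * w), 1⟩)) := by
    have := hs.act_chartPoint (r + leadContour g θ) ⟨B, hB'⟩
    simp only at this
    rw [hP, this, him, zero_mul, add_zero, chartPoint, ← map_smul, ← map_smul, ← map_smul,
      ← map_smul, ← map_add, ← map_add]
    congr 2
    rw [Complex.real_smul, Complex.real_smul, mul_left_comm, mul_comm (k : ℂ), ← mul_add]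
    congr 1
    apply Complex.ext
    · simp [hk, hρ, hw]; ring
    · simp [hk, hρ, hw]
  set y : ℝ → Plane := fun s => chartPoint c (r + leadContour g (θ + s * w)) with hy
  have hfy : ∀ s, f (y s) = 1 := fun s => hr1 _
  have hy0 : y 0 = P := by simp [hy, hP]
  -- The comparison curve has f equal to 1 + sk for small s > 0. An error of at most -ks/2 then
  -- leaves the ray at f ≤ 1 + sk/2 < 1.
  have h2 : HasDerivAt (fun s : ℝ => y s + (s * k) • y s) (act B P) 0 := by
    have hyd : HasDerivAt y (w • toC.symm
        (c (Complex.exp (r + leadContour g (θ + 0 * w)) * ⟨g (θ + 0 * w), 1⟩))) 0 := h1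
    have hsk : HasDerivAt (fun s : ℝ => s * k) k 0 := by
      simpa using (hasDerivAt_id (0 : ℝ)).mul_const k
    refine (hyd.add (hsk.smul hyd)).congr_deriv ?_
    rw [hact]
    simp only [zero_mul, zero_smul, add_zero, zero_add, hy0]
    abel
  have h3 := eventually_seminorm_le_of_hasDerivAt f h2 (ε := -k / 2) (by linarith)
  have hsmall : ∀ᶠ s : ℝ in 𝓝[>] 0, s < 1 / (-k) :=
    (eventually_lt_nhds (by have : 0 < -k := by linarith
                            positivity)).filter_mono nhdsWithin_le_nhds
  obtain ⟨K, hK⟩ := Seminorm.exists_lipschitzWith f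
  filter_upwards [h3, hsmall, self_mem_nhdsWithin] with s hs3 hss hpos
  have hp' : 0 < s := hpos
  have hopen : IsOpen {x | f x < 1} := isOpen_lt hK.continuous continuous_const
  refine interior_maximal (fun x (hx : f x < 1) => (le_of_lt hx : f x ≤ 1)) hopen ?_
  change f (P + s • act B P) < 1
  simp only [zero_add, zero_mul, zero_smul, add_zero, hy0] at hs3
  have hks : 0 < 1 + s * k := by
    rw [lt_div_iff₀ (by linarith)] at hss
    linarith
  have h4 : f (P + s • act B P) ≤ f (y s + (s * k) • y s) +
      f (y s + (s * k) • y s - (P + s • act B P)) := by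
    have := map_sub_le_add f (y s + (s * k) • y s) (y s + (s * k) • y s - (P + s • act B P))
    rwa [sub_sub_cancel] at this
  have h5 : f (y s + (s * k) • y s) = 1 + s * k := by
    rw [show y s + (s * k) • y s = (1 + s * k) • y s by rw [add_smul, one_smul],
      map_smul_eq_mul, hfy, mul_one, Real.norm_of_nonneg hks.le]
  have h6 : s * k < 0 := mul_neg_of_pos_of_neg hp' hk0
  linarith

theorem IsSide.exists_lead (hs : IsSide 𝒜 Ψ c L R) (hg : IsLeadSlope Ψ g) {p : Plane}
    (hp : p ≠ 0) : ∃ A, L p A := by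
  obtain ⟨ζ, rfl⟩ := exists_eq_chartPoint c hp
  obtain ⟨s, hl, -⟩ := exists_measurable_isLead hs.polar hg [] (by simp)
  exact ⟨s ζ.im, (hs.lead_iff _ _).2 ⟨Subtype.coe_prop _, hl _⟩⟩

end PeriodicTrajectories

/-! ### The gap between left and right slopes, and existence of a closed contour. -/

section TwoSides

variable {𝒜 : Set Mat}

theorem isFeasible_of_ne_zero
    (hneg : ∀ A ∈ 𝒜, ∀ θ, (polarVelocity A θ).im = 0 → (polarVelocity A θ).re < 0)
    {x : Plane} (hx : x ≠ 0) : IsFeasible 𝒜 x := by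
  rintro ⟨A, hA, c, hc, he⟩
  obtain ⟨ζ, rfl⟩ : ∃ ζ, x = toC.symm (Complex.exp ζ) :=
    exists_eq_chartPoint (ContinuousLinearEquiv.refl ℝ ℂ) hx
  have h := congrArg toC he
  rw [toC_act_exp, map_smul, ContinuousLinearEquiv.apply_symm_apply, Complex.real_smul,
    mul_comm] at h
  have h1 := mul_right_cancel₀ (Complex.exp_ne_zero ζ) h
  have h2 := hneg A hA ζ.im (by rw [h1, Complex.ofReal_im])
  rw [h1, Complex.ofReal_re] at h2
  exact h2.not_ge hc

theorem IsFeasible.ne_zero {x : Plane} (h : IsFeasible 𝒜 x) {A : Mat} (hA : A ∈ 𝒜) : x ≠ 0 := by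
  rintro rfl
  exact h ⟨A, hA, 0, le_rfl, by rw [act_zero_right, smul_zero]⟩

theorem isSide_left (hcompact : IsCompact 𝒜)
    (hneg : ∀ A ∈ 𝒜, ∀ θ, (polarVelocity A θ).im = 0 → (polarVelocity A θ).re < 0) :
    IsSide 𝒜 (velocities 𝒜) (ContinuousLinearEquiv.refl ℝ ℂ) (IsLeadingLeft 𝒜)
      (IsLeadingRight 𝒜) where
  polar := polarSystem_velocities hcompact hneg
  act_chartPoint ζ a := by
    apply toC.injective
    rw [ContinuousLinearEquiv.apply_symm_apply]
    exact toC_act_exp a ζ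
  lead_iff ζ A := isLeadingLeft_iff ζ
    (isFeasible_of_ne_zero hneg (chartPoint_ne_zero (ContinuousLinearEquiv.refl ℝ ℂ) ζ)) A
  lead_ne_zero x A h := h.1.ne_zero h.2.1
  opposite ζ A h := by
    refine ⟨h.2.1, ?_⟩
    have h1 := h.2.2.1
    rw [show chartPoint (ContinuousLinearEquiv.refl ℝ ℂ) ζ = toC.symm (Complex.exp ζ) from rfl,
      orientedAngle_act] at h1
    exact Complex.arg_neg_iff.1 h1.2

theorem chartPoint_conjCLE (ζ : ℂ) :
    chartPoint Complex.conjCLE ζ = toC.symm (Complex.exp ((starRingEnd ℂ) ζ)) := by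
  rw [Complex.exp_conj, chartPoint, Complex.conjCLE_apply]

theorem isSide_right (hcompact : IsCompact 𝒜)
    (hneg : ∀ A ∈ 𝒜, ∀ θ, (polarVelocity A θ).im = 0 → (polarVelocity A θ).re < 0) :
    IsSide 𝒜 (reflect (velocities 𝒜)) Complex.conjCLE (IsLeadingRight 𝒜)
      (IsLeadingLeft 𝒜) where
  polar := (polarSystem_velocities hcompact hneg).reflect
  act_chartPoint ζ a := by
    apply toC.injective
    rw [ContinuousLinearEquiv.apply_symm_apply, chartPoint_conjCLE, toC_act_exp,
      Complex.conjCLE_apply, map_mul, Complex.exp_conj, Complex.conj_im, reflect,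
      Complex.conj_conj, velocities]
  lead_iff ζ A := by
    have := isFeasible_of_ne_zero hneg (chartPoint_ne_zero Complex.conjCLE ζ)
    rw [chartPoint_conjCLE, Complex.exp_conj] at this ⊢
    exact isLeadingRight_iff ζ this A
  lead_ne_zero x A h := h.1.ne_zero h.2.1
  opposite ζ A h := by
    refine ⟨h.2.1, ?_⟩
    have h1 := h.2.2.1
    rw [chartPoint_conjCLE, orientedAngle_act, arg_mem_Ioo_iff, Complex.conj_im] at h1
    rw [reflect_im, neg_lt_zero]
    exact h1

theorem polarVelocity_combination (A B : Mat) (s t θ : ℝ) :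
    polarVelocity (s • A + t • B) θ = s * polarVelocity A θ + t * polarVelocity B θ := by
  apply Complex.ext
  · simp only [polarVelocity_re, Complex.add_re, Complex.re_ofReal_mul, Matrix.add_apply,
      Matrix.smul_apply, smul_eq_mul]
    ring
  · simp only [polarVelocity_im, Complex.add_im, Complex.im_ofReal_mul, Matrix.add_apply,
      Matrix.smul_apply, smul_eq_mul]
    ring

theorem trace_neg_of_mem_convexHull (htr : ∀ A ∈ 𝒜, A 0 0 + A 1 1 < 0) {A : Mat}
    (hA : A ∈ convexHull ℝ 𝒜) : A 0 0 + A 1 1 < 0 := by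
  refine convexHull_min (t := {A : Mat | A 0 0 + A 1 1 < 0}) htr ?_ hA
  intro A hA B hB a b ha hb hab
  simp only [mem_ofPred_eq] at hA hB
  simp only [mem_ofPred_eq, Matrix.add_apply, Matrix.smul_apply, smul_eq_mul]
  rcases eq_or_lt_of_le ha with rfl | ha'
  · obtain rfl : b = 1 := by linarith
    linarith
  · nlinarith [mul_neg_of_pos_of_neg ha' hA, mul_nonpos_of_nonneg_of_nonpos hb hB.le]

/-- The convex combination of the two matrices that cancels the imaginary part has negative real
part. After division by the imaginary parts this says that the left slope is smaller than the right
one. -/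
theorem velocities_gap (hneg : ∀ A ∈ convexHull ℝ 𝒜, ∀ θ, (polarVelocity A θ).im = 0 →
    (polarVelocity A θ).re < 0) (a b : 𝒜) (θ : ℝ) (ha : 0 < (velocities 𝒜 a θ).im)
    (hb : (velocities 𝒜 b θ).im < 0) : (velocities 𝒜 b θ).re * (velocities 𝒜 a θ).im <
      (velocities 𝒜 a θ).re * (velocities 𝒜 b θ).im := by
  set p := velocities 𝒜 a θ with hp
  set q := velocities 𝒜 b θ with hq
  have hpos : 0 < p.im - q.im := by linarith
  have hmem : (-q.im / (p.im - q.im)) • (a : Mat) + (p.im / (p.im - q.im)) • (b : Mat) ∈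
      convexHull ℝ 𝒜 := by
    refine convex_convexHull ℝ 𝒜 (subset_convexHull ℝ 𝒜 a.2) (subset_convexHull ℝ 𝒜 b.2)
      (div_nonneg (by linarith) hpos.le) (div_nonneg ha.le hpos.le) ?_
    field_simp
    ring
  have hv := polarVelocity_combination a b (-q.im / (p.im - q.im)) (p.im / (p.im - q.im)) θ
  change _ = _ * p + _ * q at hv
  have h1 := hneg _ hmem θ (by
    rw [hv, Complex.add_im, Complex.im_ofReal_mul, Complex.im_ofReal_mul]
    field_simp
    ring)
  rw [hv, Complex.add_re, Complex.re_ofReal_mul, Complex.re_ofReal_mul, div_mul_eq_mul_div,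
    div_mul_eq_mul_div, ← add_div, div_neg_iff] at h1
  rcases h1 with h1 | h1 <;> linarith

/-- Only the zero matrix could be degenerate in co(𝒜), and the traces, negative on 𝒜, are negative
on its hull and so exclude it. -/
theorem velocities_gap_of_trace_ne_zero {f : Seminorm ℝ Plane} (hf : ∀ x, f x = 0 → x = 0)
    (hdiss : ∀ A ∈ convexHull ℝ 𝒜, IsDissipative f A)
    (hdet : ∀ A ∈ convexHull ℝ 𝒜, A.det = 0 → A = 0) (htr : ∀ A ∈ 𝒜, A 0 0 + A 1 1 ≠ 0)
    (a b : 𝒜) (θ : ℝ) (ha : 0 < (velocities 𝒜 a θ).im) (hb : (velocities 𝒜 b θ).im < 0) :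
    (velocities 𝒜 b θ).re * (velocities 𝒜 a θ).im <
      (velocities 𝒜 a θ).re * (velocities 𝒜 b θ).im := by
  refine velocities_gap (fun A hA θ => (hdiss A hA).polarVelocity_re_neg hf fun h0 => ?_) a b θ
    ha hb
  have := trace_neg_of_mem_convexHull (fun A hA =>
    ((hdiss A (subset_convexHull ℝ 𝒜 hA)).trace_nonpos hf).lt_of_ne (htr A hA)) hA
  rw [hdet A hA h0] at this
  simp at this

theorem reflect_gap {X : Type*} {Ψ : X → ℝ → ℂ}
    (hgap : ∀ a b θ, 0 < (Ψ a θ).im → (Ψ b θ).im < 0 →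
      (Ψ b θ).re * (Ψ a θ).im < (Ψ a θ).re * (Ψ b θ).im) (a b : X) (θ : ℝ)
    (ha : 0 < (reflect Ψ a θ).im) (hb : (reflect Ψ b θ).im < 0) :
    (reflect Ψ b θ).re * (reflect Ψ a θ).im < (reflect Ψ a θ).re * (reflect Ψ b θ).im := by
  rw [reflect_im] at ha hb
  have := hgap b a (-θ) (by linarith) (by linarith)
  simp only [reflect_re, reflect_im]
  linarith

/-- The gap gives g(θ) + g'(-θ) < 0 at every angle, so the sum of the two integrals is negative. -/
theorem not_both_integral_eq_zero {X : Type*} {Ψ : X → ℝ → ℂ} {g g' : ℝ → ℝ}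
    (hgap : ∀ a b θ, 0 < (Ψ a θ).im → (Ψ b θ).im < 0 →
      (Ψ b θ).re * (Ψ a θ).im < (Ψ a θ).re * (Ψ b θ).im)
    (hg : IsLeadSlope Ψ g) (h0 : ∫ θ in 0..Real.pi, g θ = 0)
    (hg' : IsLeadSlope (reflect Ψ) g') (h0' : ∫ θ in 0..Real.pi, g' θ = 0) : False := by
  have hlt : ∀ θ, 0 < -(g θ + g' (-θ)) := by
    intro θ
    obtain ⟨a, ha, hae⟩ := hg.attained θ
    obtain ⟨b, hb, hbe⟩ := hg'.attained (-θ)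
    rw [reflect_im, neg_neg] at hb
    rw [reflect_re, reflect_im, neg_neg] at hbe
    have h1 := hgap a b θ ha (by linarith)
    rw [hae, hbe] at h1
    by_contra! hle
    nlinarith [mul_pos ha hb]
  have hc' : Continuous fun θ => g' (-θ) := hg'.continuous.comp continuous_neg
  have hint : ∫ θ in 0..Real.pi, -(g θ + g' (-θ)) = 0 := by
    rw [intervalIntegral.integral_neg, intervalIntegral.integral_add
      (hg.continuous.intervalIntegrable _ _) (hc'.intervalIntegrable _ _), h0,
      intervalIntegral.integral_comp_neg (fun θ => g' θ), neg_zero]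
    have := hg'.periodic.intervalIntegral_add_eq (-Real.pi) 0
    rw [neg_add_cancel, zero_add, h0'] at this
    rw [this]
    simp
  have := intervalIntegral.intervalIntegral_pos_of_pos
    (((hg.continuous.add hc').neg).intervalIntegrable 0 Real.pi) hlt Real.pi_pos
  exact this.ne' hint

section ClosedSide

variable {X : Type*} [TopologicalSpace X] [CompactSpace X] [Nonempty X] {Ψ : X → ℝ → ℂ}

/-- The slope of `a` is the derivative of -(1/2) log Im, which integrates to zero by periodicity,
and the leading slope dominates it. -/
theorem PolarSystem.exists_isLeadSlope_of_conservative (h : PolarSystem Ψ) {a : X}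
    (hpos : ∀ θ, 0 < (Ψ a θ).im)
    (hd : ∀ θ, HasDerivAt (fun θ => (Ψ a θ).im) (-2 * (Ψ a θ).re) θ) :
    ∃ g, IsLeadSlope Ψ g ∧ 0 ≤ ∫ θ in 0..Real.pi, g θ := by
  obtain ⟨M, hM⟩ := exists_isLeadSlope h fun θ => ⟨a, hpos θ⟩
  have hg := hM M le_rfl
  refine ⟨_, hg, ?_⟩
  have hc : Continuous (Ψ a) := h.continuous.comp (by fun_prop : Continuous fun θ : ℝ => (a, θ))
  have hq : Continuous fun θ => (Ψ a θ).re / (Ψ a θ).im :=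
    (Complex.continuous_re.comp hc).div (Complex.continuous_im.comp hc) fun θ => (hpos θ).ne'
  have hF : ∀ θ, HasDerivAt (fun θ => -(1 / 2) * Real.log (Ψ a θ).im)
      ((Ψ a θ).re / (Ψ a θ).im) θ := fun θ =>
    (((hd θ).log (hpos θ).ne').const_mul (-(1 / 2))).congr_deriv (by ring)
  have h1 : ∫ θ in 0..Real.pi, (Ψ a θ).re / (Ψ a θ).im = 0 := by
    rw [intervalIntegral.integral_eq_sub_of_hasDerivAt (fun θ _ => hF θ)
      (hq.intervalIntegrable _ _)]
    have := h.periodic a 0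
    rw [zero_add] at this
    rw [this, sub_self]
  refine h1.symm.le.trans ?_
  refine intervalIntegral.integral_mono_on Real.pi_pos.le (hq.intervalIntegrable _ _)
    (hg.continuous.intervalIntegrable _ _) fun θ _ => ?_
  rw [div_le_iff₀ (hpos θ)]
  exact hg.upper a θ (hpos θ)

end ClosedSide

/-- Infinitesimal form of a conservation law: the flow of a traceless matrix preserves x ∧ Ax = r²
Im. -/
theorem polarVelocity_hasDerivAt_im {A : Mat} (htr : A 0 0 + A 1 1 = 0) (θ : ℝ) :
    HasDerivAt (fun θ => (polarVelocity A θ).im) (-2 * (polarVelocity A θ).re) θ := by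
  simp only [polarVelocity_im, polarVelocity_re, htr]
  have h2 : HasDerivAt (fun θ : ℝ => 2 * θ) 2 θ := by
    simpa using (hasDerivAt_id θ).const_mul 2
  exact (((h2.cos.const_mul ((A 1 0 + A 0 1) / 2)).const_add ((A 1 0 - A 0 1) / 2)).sub
    (h2.sin.const_mul ((A 0 0 - A 1 1) / 2))).congr_deriv (by ring)

/-- The velocities lie on the circle with centre iu and squared radius u² - det A < u², which misses
the real axis. -/
theorem polarVelocity_im_pos_or_neg {A : Mat} (htr : A 0 0 + A 1 1 = 0) (hdet : 0 < A.det) :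
    (∀ θ, 0 < (polarVelocity A θ).im) ∨ ∀ θ, (polarVelocity A θ).im < 0 := by
  set u := (A 1 0 - A 0 1) / 2 with hu
  have key : ∀ θ, ((polarVelocity A θ).im - u) ^ 2 < u ^ 2 := by
    intro θ
    have h1 : ((polarVelocity A θ).im - u) ^ 2 + (polarVelocity A θ).re ^ 2 =
        ((A 1 0 + A 0 1) / 2) ^ 2 + ((A 0 0 - A 1 1) / 2) ^ 2 := by
      rw [polarVelocity_im, polarVelocity_re, htr, ← hu]
      linear_combination (((A 1 0 + A 0 1) / 2) ^ 2 + ((A 0 0 - A 1 1) / 2) ^ 2) *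
        Real.sin_sq_add_cos_sq (2 * θ)
    have h2 : A.det = u ^ 2 - (((A 1 0 + A 0 1) / 2) ^ 2 + ((A 0 0 - A 1 1) / 2) ^ 2) := by
      rw [det_eq, hu]
      linear_combination (A 0 0 + A 1 1) / 4 * htr
    nlinarith [sq_nonneg (polarVelocity A θ).re]
  rcases le_total 0 u with h | h
  · exact Or.inl fun θ => by nlinarith [key θ]
  · exact Or.inr fun θ => by nlinarith [key θ]

theorem exists_isLeadSlope_of_trace_eq_zero [CompactSpace 𝒜] [Nonempty 𝒜]
    (h : PolarSystem (velocities 𝒜)) {A : Mat} (hA : A ∈ 𝒜) (htr : A 0 0 + A 1 1 = 0)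
    (hdet : 0 < A.det) :
    (∃ g, IsLeadSlope (velocities 𝒜) g ∧ 0 ≤ ∫ θ in 0..Real.pi, g θ) ∨
    (∃ g, IsLeadSlope (reflect (velocities 𝒜)) g ∧ 0 ≤ ∫ θ in 0..Real.pi, g θ) := by
  rcases polarVelocity_im_pos_or_neg htr hdet with hs | hs
  · exact Or.inl (h.exists_isLeadSlope_of_conservative (a := ⟨A, hA⟩) hs
      (polarVelocity_hasDerivAt_im htr))
  · refine Or.inr (h.reflect.exists_isLeadSlope_of_conservative (a := ⟨A, hA⟩)
      (fun θ => ?_) fun θ => ?_)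
    · rw [reflect_im]
      exact neg_pos.2 (hs (-θ))
    · simp only [reflect_im, reflect_re, velocities]
      exact (((polarVelocity_hasDerivAt_im htr (-θ)).comp θ (hasDerivAt_neg θ)).neg).congr_deriv
        (by ring)

/-- Otherwise V = log r - ∫k decreases along trajectories at a rate δ > 0, uniform by compactness.
As `k` has mean zero, ∫k is periodic and bounded, so every nonzero trajectory is O(exp(-δt)) and the
exponent is negative. -/
theorem IsSide.exists_slope_le {Ψ : 𝒜 → ℝ → ℂ} {c : ℂ ≃L[ℝ] ℂ} {L R : Plane → Mat → Prop}
    [CompactSpace 𝒜] [Nonempty 𝒜] (hs : IsSide 𝒜 Ψ c L R) {M : ℝ}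
    (hM : ∀ A ∈ 𝒜, ∀ x, ‖act A x‖ ≤ M * ‖x‖) (hσ : lyapunovExponent 𝒜 = 0) {k : ℝ → ℝ}
    (hk : Continuous k) (hkp : Function.Periodic k Real.pi)
    (hk0 : ∫ θ in 0..Real.pi, k θ = 0) : ∃ a θ, k θ * (Ψ a θ).im ≤ (Ψ a θ).re := by
  by_contra! hlt
  have hre := Complex.continuous_re.comp hs.polar.continuous
  have him := Complex.continuous_im.comp hs.polar.continuous
  obtain ⟨δ, hδ, hle⟩ := exists_forall_pos_le (f := fun a θ => k θ * (Ψ a θ).im - (Ψ a θ).re)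
    (((hk.comp continuous_snd).mul him).sub hre)
    (fun a θ => by simp only [hs.polar.periodic a θ, hkp θ]) (fun a θ => sub_pos.2 (hlt a θ))
  have hper : Function.Periodic (leadRadius k) Real.pi := by
    intro θ
    have hi := fun a b => hk.intervalIntegrable (μ := volume) a b
    have := hkp.intervalIntegral_add_eq θ 0
    rw [zero_add, hk0] at this
    rw [leadRadius, leadRadius, ← intervalIntegral.integral_add_adjacent_intervals
      (hi 0 θ) (hi θ _), this, add_zero]
  obtain ⟨B, -, hB⟩ := exists_forall_bound (X := 𝒜) (f := fun _ θ => leadRadius k θ)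
    ((contDiff_leadRadius hk).continuous.comp continuous_snd) (fun _ => hper)
  have hB' : ∀ θ, leadRadius k θ ≤ B := fun θ =>
    (le_abs_self _).trans (hB (Classical.arbitrary 𝒜) θ)
  refine absurd (lyapunovExponent_le_of_forall hM (nonempty_coe_sort.1 inferInstance) (σ := -δ)
    fun x hx => ?_) (by rw [hσ]; linarith)
  by_cases hx0 : x 0 = 0
  · refine ⟨0, fun t ht => ?_⟩
    have := (hx.norm_bounds hM ht).1
    rw [hx0, norm_zero, mul_zero] at this
    rwa [zero_mul]
  have hxt : ∀ t ∈ Ici (0 : ℝ), x t ≠ 0 := by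
    intro t ht h0
    have := (hx.norm_bounds hM ht).2
    rw [h0, norm_zero] at this
    exact (mul_pos (Real.exp_pos _) (norm_pos_iff.2 hx0)).not_ge this
  obtain ⟨A, hA, hsol⟩ := hx
  obtain ⟨ζ, hζ, hxζ, hd⟩ := hs.exists_lift isTimeRetraction_Ici hA hM hsol hxt
  set V : ℝ → ℝ := fun t => (ζ t).re - leadRadius k (ζ t).im with hV
  have hVl : LocallyLipschitz V := by
    have h1 : LocallyLipschitz fun t => (ζ t).re :=
      (Complex.reCLM.contDiff (n := 1)).locallyLipschitz.comp hζ
    have h2 : LocallyLipschitz fun t => leadRadius k (ζ t).im :=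
      (contDiff_leadRadius hk).locallyLipschitz.comp
        ((Complex.imCLM.contDiff (n := 1)).locallyLipschitz.comp hζ)
    simpa [hV, sub_eq_add_neg] using h1.add h2.neg
  set l : ℂ →L[ℝ] Plane := ((c.trans toC.symm : ℂ ≃L[ℝ] Plane) : ℂ →L[ℝ] Plane)
  refine ⟨‖l‖ * Real.exp (V 0 + B), fun t ht => ?_⟩
  have hVt := sub_le_of_ae_deriv_le (c := -δ) hVl ht (by
    filter_upwards [hd] with s hs' hm d hd'
    have h1 := hs' hm.1
    have h2 : HasDerivAt V _ s := (Complex.reCLM.hasFDerivAt.comp_hasDerivAt s h1).sub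
      ((hasDerivAt_leadRadius hk _).comp s (Complex.imCLM.hasFDerivAt.comp_hasDerivAt s h1))
    rw [hd'.unique h2]
    have := hle ⟨A s, hA s hm.1⟩ (ζ s).im
    simp only [Complex.reCLM_apply, Complex.imCLM_apply]
    linarith)
  rw [hxζ t ht, mul_assoc, ← Real.exp_add]
  refine (l.le_opNorm (Complex.exp (ζ t))).trans ?_
  rw [Complex.norm_exp]
  gcongr
  have := hB' (ζ t).im
  simp only [hV] at hVt ⊢
  linarith

theorem exists_dissipative_norm (hcompact : IsCompact 𝒜) (hirr : IsIrreducible 𝒜)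
    (hσ : lyapunovExponent 𝒜 = 0) : ∃ f : Seminorm ℝ Plane, (∀ x, f x = 0 → x = 0) ∧
      ∀ A ∈ convexHull ℝ 𝒜, IsDissipative f A := by
  obtain ⟨f, hf, hflow⟩ := exists_extremal_norm hcompact hirr hσ
  exact ⟨f, hf, fun A hA => convexHull_min (fun A hA => isDissipative_of_flow (hflow A hA))
    (convex_isDissipative f) hA⟩

theorem isMonotoneSeminorm_of_dissipative (hcompact : IsCompact 𝒜) {f : Seminorm ℝ Plane}
    (hdiss : ∀ A ∈ 𝒜, IsDissipative f A) : IsMonotoneSeminorm 𝒜 f := by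
  obtain ⟨M, -, hM⟩ := exists_norm_act_le hcompact
  exact fun x hx t ht => seminorm_trajectory_le hM hdiss hx ht

theorem IsBarabanovNorm.isMonotoneSeminorm (hσ : lyapunovExponent 𝒜 = 0) {f : Seminorm ℝ Plane}
    (h : IsBarabanovNorm 𝒜 f) : IsMonotoneSeminorm 𝒜 f := by
  intro x hx t ht
  have := h.2.1 x hx t ht
  rwa [hσ, zero_mul, Real.exp_zero, one_mul] at this

theorem isTrajectory_zero {A : Mat} (hA : A ∈ 𝒜) : IsTrajectory 𝒜 fun _ => 0 := by
  have := (isMotion_flow hA 0).isTrajectory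
  simpa using this

theorem IsTrajectory.mono {ℬ : Set Mat} (h : 𝒜 ⊆ ℬ) {x : ℝ → Plane} (hx : IsTrajectory 𝒜 x) :
    IsTrajectory ℬ x := by
  obtain ⟨A, hA, hs⟩ := hx
  exact ⟨A, fun t ht => h (hA t ht), hs⟩

theorem IsSide.isBarabanovNorm {Ψ : 𝒜 → ℝ → ℂ} {c : ℂ ≃L[ℝ] ℂ} {L R : Plane → Mat → Prop}
    [CompactSpace 𝒜] [Nonempty 𝒜] (hs : IsSide 𝒜 Ψ c L R) {g : ℝ → ℝ} (hg : IsLeadSlope Ψ g)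
    (h0 : ∫ θ in 0..Real.pi, g θ = 0) (hσ : lyapunovExponent 𝒜 = 0) {f : Seminorm ℝ Plane}
    (hf : ∀ x, f x = 0 → x = 0) (hmono : IsMonotoneSeminorm 𝒜 f) : IsBarabanovNorm 𝒜 f := by
  simp only [IsBarabanovNorm, hσ, zero_mul, Real.exp_zero, one_mul]
  refine ⟨hf, hmono, fun x₀ => ?_⟩
  have hsub := subset_convexHull ℝ 𝒜
  by_cases hx₀ : x₀ = 0
  · exact ⟨_, isTrajectory_zero (hsub (Classical.arbitrary 𝒜).2), hx₀.symm, fun t _ => by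
      rw [hx₀]⟩
  · obtain ⟨x, hx, hx0, hc⟩ := hs.exists_constant_trajectory hg h0 hmono hx₀
    exact ⟨x, hx.mono hsub, hx0, fun t _ => hc t⟩

theorem ne_zero_of_mem_unitSphere {f : Seminorm ℝ Plane} {p : Plane} (hp : p ∈ unitSphere f) :
    p ≠ 0 := by
  rintro rfl
  have : f 0 = 1 := hp
  simp at this

/-- The integral is nonnegative on some side, by a traceless matrix of 𝒜 or else by the gap; on
either side it is nonpositive because `f` does not grow over a half-turn. -/
theorem exists_closed_leadSlope [CompactSpace 𝒜] [Nonempty 𝒜] (hcompact : IsCompact 𝒜)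
    (hzero : (0 : Mat) ∉ 𝒜) (hσ : lyapunovExponent 𝒜 = 0)
    (hdet : ∀ A ∈ convexHull ℝ 𝒜, A.det = 0 → A = 0) {f : Seminorm ℝ Plane}
    (hf : ∀ x, f x = 0 → x = 0) (hdiss : ∀ A ∈ convexHull ℝ 𝒜, IsDissipative f A) :
    (∃ g, IsLeadSlope (velocities 𝒜) g ∧ ∫ θ in 0..Real.pi, g θ = 0) ∨
    (∃ g, IsLeadSlope (reflect (velocities 𝒜)) g ∧ ∫ θ in 0..Real.pi, g θ = 0) := by
  have hsub := subset_convexHull ℝ 𝒜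
  have hdet' : ∀ A ∈ 𝒜, A.det ≠ 0 := fun A hA h => hzero (hdet A (hsub hA) h ▸ hA)
  have hneg : ∀ A ∈ 𝒜, ∀ θ, (polarVelocity A θ).im = 0 → (polarVelocity A θ).re < 0 :=
    fun A hA θ => (hdiss A (hsub hA)).polarVelocity_re_neg hf (hdet' A hA)
  have hleft := isSide_left hcompact hneg
  have hright := isSide_right hcompact hneg
  have hmono := isMonotoneSeminorm_of_dissipative hcompact fun A hA => hdiss A (hsub hA)
  obtain ⟨M, -, hM⟩ := exists_norm_act_le hcompact
  have hex : (∃ g, IsLeadSlope (velocities 𝒜) g ∧ 0 ≤ ∫ θ in 0..Real.pi, g θ) ∨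
      (∃ g, IsLeadSlope (reflect (velocities 𝒜)) g ∧ 0 ≤ ∫ θ in 0..Real.pi, g θ) := by
    by_cases htr : ∃ A ∈ 𝒜, A 0 0 + A 1 1 = 0
    · obtain ⟨A, hA, htr⟩ := htr
      exact exists_isLeadSlope_of_trace_eq_zero hleft.polar hA htr
        (((hdiss A (hsub hA)).det_nonneg hf).lt_of_ne' (hdet' A hA))
    · push Not at htr
      refine exists_isLeadSlope_of_gap hleft.polar (velocities_gap_of_trace_ne_zero hf hdiss hdet
        htr) fun k hk hkp hk0 => hleft.exists_slope_le hM hσ hk hkp hk0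
  rcases hex with ⟨g, hg, h0⟩ | ⟨g, hg, h0⟩
  · exact Or.inl ⟨g, hg, (hleft.integral_nonpos hg hf hmono).antisymm h0⟩
  · exact Or.inr ⟨g, hg, (hright.integral_nonpos hg hf hmono).antisymm h0⟩

end TwoSides
end Barabanov

open Barabanov in
theorem mainTheorem1 (𝒜 : Set Barabanov.Mat) (hcompact : IsCompact 𝒜)
    (hirred : Barabanov.IsIrreducible 𝒜) (hzero : (0 : Barabanov.Mat) ∉ 𝒜)
    (hσ : Barabanov.lyapunovExponent 𝒜 = 0) :
    -- no real dominance means that `co(𝒜)` contains no degenerate matrix other than zero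
    (¬ Barabanov.HasRealDominance 𝒜 ↔ ∀ A ∈ convexHull ℝ 𝒜, A.det = 0 → A = 0) ∧
    (¬ Barabanov.HasRealDominance 𝒜 →
      -- the Barabanov norm exists and is unique up to a positive factor
      (∃ f : Seminorm ℝ Barabanov.Plane, Barabanov.IsBarabanovNorm 𝒜 f) ∧
      (∀ f g : Seminorm ℝ Barabanov.Plane,
        Barabanov.IsBarabanovNorm 𝒜 f → Barabanov.IsBarabanovNorm 𝒜 g →
          ∃ c : ℝ, 0 < c ∧ ∀ x, g x = c * f x) ∧
      -- its unit sphere is one period of a periodic leading trajectory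
      (∀ f : Seminorm ℝ Barabanov.Plane, Barabanov.IsBarabanovNorm 𝒜 f →
        ∃ (x : ℝ → Barabanov.Plane) (T : ℝ), Barabanov.IsPeriodicLeading 𝒜 x T ∧
          Set.InjOn x (Set.Ico 0 T) ∧ x '' Set.Ico 0 T = Barabanov.unitSphere f) ∧
      (¬ Barabanov.HasComplexDominance 𝒜 →
        -- the periodic leading trajectory is unique up to scaling and the choice of initial time
        (∀ (x y : ℝ → Barabanov.Plane) (T T' : ℝ),
          Barabanov.IsPeriodicLeading 𝒜 x T → Barabanov.IsPeriodicLeading 𝒜 y T' →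
            ∃ c : ℝ, 0 < c ∧ ∃ τ : ℝ, ∀ t : ℝ, y t = c • x (t + τ)) ∧
        (∀ f : Seminorm ℝ Barabanov.Plane, Barabanov.IsBarabanovNorm 𝒜 f →
          -- if it is a left trajectory, then `a_p` is tangent, and `b_p` is directed inside
          -- or does not exist, at every point `p` of the sphere
          ((∃ (x : ℝ → Barabanov.Plane) (T : ℝ), Barabanov.IsPeriodicLeadingLeft 𝒜 x T) →
            ∀ p ∈ Barabanov.unitSphere f,
              (∃ A, Barabanov.IsLeadingLeft 𝒜 p A) ∧
              (∀ A, Barabanov.IsLeadingLeft 𝒜 p A →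
                Barabanov.IsTangentTo (Barabanov.unitSphere f) p (Barabanov.act A p)) ∧
              (∀ B, Barabanov.IsLeadingRight 𝒜 p B →
                Barabanov.IsDirectedInside (Barabanov.unitBall f) p (Barabanov.act B p))) ∧
          -- if it is a right trajectory, then vice versa
          ((∃ (x : ℝ → Barabanov.Plane) (T : ℝ), Barabanov.IsPeriodicLeadingRight 𝒜 x T) →
            ∀ p ∈ Barabanov.unitSphere f,
              (∃ B, Barabanov.IsLeadingRight 𝒜 p B) ∧
              (∀ B, Barabanov.IsLeadingRight 𝒜 p B →
                Barabanov.IsTangentTo (Barabanov.unitSphere f) p (Barabanov.act B p)) ∧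
              (∀ A, Barabanov.IsLeadingLeft 𝒜 p A →
                Barabanov.IsDirectedInside (Barabanov.unitBall f) p (Barabanov.act A p)))))) := by
  obtain ⟨f₀, hf₀, hdiss⟩ := exists_dissipative_norm hcompact hirred hσ
  have hsub := subset_convexHull ℝ 𝒜
  have hiff : ¬ HasRealDominance 𝒜 ↔ ∀ A ∈ convexHull ℝ 𝒜, A.det = 0 → A = 0 := by
    refine ⟨fun h A hA h0 => ?_, fun h hreal => ?_⟩
    · by_contra hA0
      exact h (hasRealDominance_of_det_eq_zero hσ hA hA0 h0 ((hdiss A hA).trace_nonpos hf₀))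
    · obtain ⟨A, hA, h0, hA0⟩ := hreal.exists_det_eq_zero hσ
      exact hA0 (h A hA h0)
  refine ⟨hiff, fun hreal => ?_⟩
  have hdet := hiff.1 hreal
  have hdet' : ∀ A ∈ 𝒜, A.det ≠ 0 := fun A hA h => hzero (hdet A (hsub hA) h ▸ hA)
  have hneg : ∀ A ∈ 𝒜, ∀ θ, (polarVelocity A θ).im = 0 → (polarVelocity A θ).re < 0 :=
    fun A hA θ => (hdiss A (hsub hA)).polarVelocity_re_neg hf₀ (hdet' A hA)
  have hleft := isSide_left hcompact hneg
  have hright := isSide_right hcompact hneg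
  have : CompactSpace 𝒜 := isCompact_iff_compactSpace.1 hcompact
  have : Nonempty 𝒜 := hirred.nonempty.to_subtype
  have hclosed := exists_closed_leadSlope hcompact hzero hσ hdet hf₀ hdiss
  have hmono₀ := isMonotoneSeminorm_of_dissipative hcompact fun A hA => hdiss A (hsub hA)
  obtain ⟨M, -, hM⟩ := exists_norm_act_le hcompact
  refine ⟨⟨f₀, ?_⟩, fun f g hf hg => ?_, fun f hf => ?_, fun hcomplex => ?_⟩
  · rcases hclosed with ⟨s, hs, h0⟩ | ⟨s, hs, h0⟩
    · exact hleft.isBarabanovNorm hs h0 hσ hf₀ hmono₀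
    · exact hright.isBarabanovNorm hs h0 hσ hf₀ hmono₀
  · have hfm := hf.isMonotoneSeminorm hσ
    have hgm := hg.isMonotoneSeminorm hσ
    rcases hclosed with ⟨s, hs, h0⟩ | ⟨s, hs, h0⟩
    · exact hleft.seminorm_unique hs h0 hf.1 hg.1 hfm hgm
    · exact hright.seminorm_unique hs h0 hf.1 hg.1 hfm hgm
  · have hfm := hf.isMonotoneSeminorm hσ
    rcases hclosed with ⟨s, hs, h0⟩ | ⟨s, hs, h0⟩
    · obtain ⟨x, T, hx, h⟩ := hleft.exists_sphere_parametrization hs h0 hf.1 hfm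
      exact ⟨x, T, Or.inl hx, h⟩
    · obtain ⟨x, T, hx, h⟩ := hright.exists_sphere_parametrization hs h0 hf.1 hfm
      exact ⟨x, T, Or.inr hx, h⟩
  -- A traceless matrix of 𝒜 would have positive determinant, hence purely imaginary eigenvalues,
  -- and would be a case of complex dominance.
  · have hgap := velocities_gap_of_trace_ne_zero hf₀ hdiss hdet fun A hA htr =>
      hcomplex (hasComplexDominance_of_trace_eq_zero hσ (hsub hA)
        (((hdiss A (hsub hA)).det_nonneg hf₀).lt_of_ne' (hdet' A hA)) htr)
    have hexcl : ∀ (x y : ℝ → Plane) (T T' : ℝ), IsPeriodicLeadingLeft 𝒜 x T →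
        IsPeriodicLeadingRight 𝒜 y T' → False := by
      intro x y T T' hx hy
      obtain ⟨s, hs, h0, -⟩ := hleft.eq_leadTrajectory_of_periodic hM hx
      obtain ⟨s', hs', h0', -⟩ := hright.eq_leadTrajectory_of_periodic hM hy
      exact not_both_integral_eq_zero hgap hs h0 hs' h0'
    refine ⟨?_, fun f hf => ⟨?_, ?_⟩⟩
    · rintro x y T T' (hx | hx) (hy | hy)
      · exact hleft.periodic_unique hM hx hy
      · exact (hexcl x y T T' hx hy).elim
      · exact (hexcl y x T' T hy hx).elim
      · exact hright.periodic_unique hM hx hy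
    · rintro ⟨x, T, hx⟩ p hp
      -- Any periodic left trajectory, not only one on this sphere, shows that the left contour
      -- closes.
      obtain ⟨s, hs, h0, -⟩ := hleft.eq_leadTrajectory_of_periodic hM hx
      have hfm := hf.isMonotoneSeminorm hσ
      exact ⟨hleft.exists_lead hs (ne_zero_of_mem_unitSphere hp),
        fun A hA => hleft.isTangentTo hs h0 hf.1 hfm hp hA,
        fun B hB => hleft.isDirectedInside hs h0 hf.1 hfm hgap hp hB⟩
    · rintro ⟨x, T, hx⟩ p hp
      obtain ⟨s, hs, h0, -⟩ := hright.eq_leadTrajectory_of_periodic hM hx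
      have hfm := hf.isMonotoneSeminorm hσ
      exact ⟨hright.exists_lead hs (ne_zero_of_mem_unitSphere hp),
        fun A hA => hright.isTangentTo hs h0 hf.1 hfm hp hA,
        fun B hB => hright.isDirectedInside hs h0 hf.1 hfm (reflect_gap hgap) hp hB⟩
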